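/- Commutative rings have an identity element $1$, which may be $0$. A finite commutative ring $R$ and a finite $R$-module $M$ are given as follows: the additive groups of $R$ and of $M$ are given by finitely many generators and relations, and one is given all products of pairs of generators of $R$, and all products of a generator of $R$ with a generator of $M$, as integer combinations of the generators. The module $M$ is cyclic if $M = Ry$ for some $y \in M$. Consider the following algorithm, in which $A$ is a quotient algebra of $R$, $M_A = A\otimes_R M$, $y\in M$, and $N$ is a submodule of $M$. (i) Initially, take $A=R$, $y=0$, $N=M$. (ii) If $M_A=0$, stop and output "yes" with generator $y$. (iii) Otherwise, pick $x\in N$ with $1\otimes x\neq 0$ in $M_A$, and let $\mathfrak a=\mathrm{Ann}_A(1\otimes x)$ and $\mathfrak b=\mathrm{Ann}_A\,\mathfrak a$. (iv) If $\mathfrak a\cap\mathfrak b\neq 0$, replace $A$ by $A/(\mathfrak a\cap\mathfrak b)$ and go back to (ii). (v) If $\mathfrak a\cap\mathfrak b=0$ and $(A/\mathfrak a)\otimes x\neq M_{A/\mathfrak a}$, stop and output "no". If $\mathfrak a\cap\mathfrak b=0$ and $(A/\mathfrak a)\otimes x= M_{A/\mathfrak a}$, replace $A$, $y$, $N$ by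 $A/\mathfrak b$, $x+y$, $\mathfrak a N$, respectively, where $\mathfrak aN$ is the product of $N$ with the preimage of $\mathfrak a$ in $R$, and go back to (ii). Theorem. (1) There is a deterministic program that, on every input $(R,M)$ as above, halts in time polynomial in the bit length of the input, having carried out a complete run of the algorithm, and that decides whether $M$ is cyclic and, if it is, outputs $y\in M$ with $M=Ry$. (The program also outputs the successive states $(A,y,N)$ of the run, with $A=R/I$, where $I$ and $N$ are given by generators of their additive groups.) (2) For every finite commutative ring $R$, every finite $R$-module $M$, and every choice of the elements $x$ in step (iii): if the algorithm stops with "yes" and $y$, then $M=Ry$; if it stops with "no", then $M$ is not cyclic; an element $x$ as in step (iii) always exists if $M_A\ne 0$; if $\mathfrak a\cap\mathfrak b=0$, then there is an idempotent $e\in A$ with $\mathfrak a=eA$ and $\mathfrak b=(1-e)A$, and the natural map $A\to A/\mathfrak a\times A/\mathfrak b$ is bijective; and each new $A$ has at most half as many elements as the $A$ that it replaces. (3) There is a constant $C$ such that, for every input of bit length $\ell$ and every choice of the elements $x$, the algorithm goes through at most $C\ell$ rounds. -/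

import Mathlib

open scoped TensorProduct

universe u v

namespace CyclicModule

/-! ### The model of computation

Programs act on finite binary trees whose leaves are integers. The cost of every elementary operation
is the number of bits that it reads and writes, so that the running time of a program is, up to a
polynomial, the one of a Turing machine. -/

/-- Finite binary trees with integers at the leaves. -/
inductive Data : Type
  | int (z : ℤ) : Data
  | pair (a b : Data) : Data

namespace Data

/-- The bit length of a tree: integers are written in binary with a sign, and there is one symbol
for each inner node. -/
def size : Data → ℕ
  | int z => z.natAbs.size + 1
  | pair a b => a.size + b.size + 1

/-- A list of trees: `0` is the empty list, and a pair consists of the head and the tail. -/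
def ofList : List Data → Data
  | [] => int 0
  | d :: l => pair d (ofList l)

/-- A vector of integers, as the list of its entries. -/
def ofVec {n : ℕ} (w : Fin n → ℤ) : Data := ofList (List.ofFn fun i => int (w i))

/-- A list of vectors of integers. -/
def ofVecs {n : ℕ} (l : List (Fin n → ℤ)) : Data := ofList (l.map ofVec)

/-- A table of vectors of integers. -/
def ofTable {k l n : ℕ} (T : Fin k → Fin l → Fin n → ℤ) : Data :=
  ofList (List.ofFn fun i => ofList (List.ofFn fun j => ofVec (T i j)))

end Data

/-- The elementary operations. -/
inductive Prim : Type
  /-- leaves its argument unchanged -/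
  | id : Prim
  /-- the constant `z` -/
  | const (z : ℤ) : Prim
  /-- the first component of a pair -/
  | fst : Prim
  /-- the second component of a pair -/
  | snd : Prim
  /-- is the argument a pair? -/
  | isPair : Prim
  /-- addition of two integers -/
  | add : Prim
  /-- subtraction of two integers -/
  | sub : Prim
  /-- multiplication of two integers -/
  | mul : Prim
  /-- division with remainder: the quotient of two integers -/
  | div : Prim
  /-- is the first integer smaller than the second? -/
  | lt : Prim

/-- The effect of an elementary operation. Truth values are `1` and `0`, and the result is `0` on an
argument of the wrong shape. -/
def Prim.apply : Prim → Data → Data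
  | .id, d => d
  | .const z, _ => .int z
  | .fst, .pair a _ => a
  | .snd, .pair _ b => b
  | .isPair, .pair _ _ => .int 1
  | .add, .pair (.int a) (.int b) => .int (a + b)
  | .sub, .pair (.int a) (.int b) => .int (a - b)
  | .mul, .pair (.int a) (.int b) => .int (a * b)
  | .div, .pair (.int a) (.int b) => .int (a / b)
  | .lt, .pair (.int a) (.int b) => .int (if a < b then 1 else 0)
  | _, _ => .int 0

/-- Programs. -/
inductive Prog : Type
  /-- an elementary operation -/
  | prim (o : Prim) : Prog
  /-- `seq f g`: first `f`, then `g` on the result -/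
  | seq (f g : Prog) : Prog
  /-- `both f g`: run `f` and `g` on the argument, and pair the two results -/
  | both (f g : Prog) : Prog
  /-- `ite c f g`: run `f` on the argument if `c` answers something else than `0` on it, and `g`
  otherwise -/
  | ite (c f g : Prog) : Prog
  /-- `loop c f`: as long as `c` does not answer `0`, replace the data by the result of `f` on it -/
  | loop (c f : Prog) : Prog

/-- `Exec c d d' t`: on input `d`, the program `c` halts with output `d'`, and this takes time `t`. -/
inductive Exec : Prog → Data → Data → ℕ → Prop
  | prim (o : Prim) (d : Data) : Exec (.prim o) d (o.apply d) (d.size + (o.apply d).size)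
  | seq {f g : Prog} {d d₁ d₂ : Data} {t₁ t₂ : ℕ} :
      Exec f d d₁ t₁ → Exec g d₁ d₂ t₂ → Exec (.seq f g) d d₂ (t₁ + t₂ + 1)
  | both {f g : Prog} {d d₁ d₂ : Data} {t₁ t₂ : ℕ} :
      Exec f d d₁ t₁ → Exec g d d₂ t₂ → Exec (.both f g) d (.pair d₁ d₂) (t₁ + t₂ + 1)
  | ite_true {c f g : Prog} {d b d' : Data} {t₁ t₂ : ℕ} :
      Exec c d b t₁ → b ≠ .int 0 → Exec f d d' t₂ → Exec (.ite c f g) d d' (t₁ + t₂ + 1)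
  | ite_false {c f g : Prog} {d d' : Data} {t₁ t₂ : ℕ} :
      Exec c d (.int 0) t₁ → Exec g d d' t₂ → Exec (.ite c f g) d d' (t₁ + t₂ + 1)
  | loop_stop {c f : Prog} {d : Data} {t : ℕ} :
      Exec c d (.int 0) t → Exec (.loop c f) d d (t + 1)
  | loop_next {c f : Prog} {d b d₁ d₂ : Data} {t₁ t₂ t₃ : ℕ} :
      Exec c d b t₁ → b ≠ .int 0 → Exec f d d₁ t₂ → Exec (.loop c f) d₁ d₂ t₃ →
      Exec (.loop c f) d d₂ (t₁ + t₂ + t₃ + 1)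

/-- Programs are deterministic: output and running time are determined by the input. -/
theorem Exec.deterministic {c : Prog} {d d₁ : Data} {t₁ : ℕ} (h₁ : Exec c d d₁ t₁) :
    ∀ {d₂ : Data} {t₂ : ℕ}, Exec c d d₂ t₂ → d₁ = d₂ ∧ t₁ = t₂ := by
  induction h₁ with
  | prim o d => intro _ _ h; cases h; exact ⟨rfl, rfl⟩
  | seq _ _ i₁ i₂ =>
    intro _ _ h
    cases h with
    | seq a b =>
      obtain ⟨rfl, rfl⟩ := i₁ a
      obtain ⟨rfl, rfl⟩ := i₂ b
      exact ⟨rfl, rfl⟩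
  | both _ _ i₁ i₂ =>
    intro _ _ h
    cases h with
    | both a b =>
      obtain ⟨rfl, rfl⟩ := i₁ a
      obtain ⟨rfl, rfl⟩ := i₂ b
      exact ⟨rfl, rfl⟩
  | ite_true _ hb _ i₁ i₂ =>
    intro _ _ h
    cases h with
    | ite_true a _ b =>
      obtain ⟨rfl, rfl⟩ := i₁ a
      obtain ⟨rfl, rfl⟩ := i₂ b
      exact ⟨rfl, rfl⟩
    | ite_false a _ => exact absurd (i₁ a).1 hb
  | ite_false _ _ i₁ i₂ =>
    intro _ _ h
    cases h with
    | ite_true a hb _ => exact absurd (i₁ a).1.symm hb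
    | ite_false a b =>
      obtain ⟨-, rfl⟩ := i₁ a
      obtain ⟨rfl, rfl⟩ := i₂ b
      exact ⟨rfl, rfl⟩
  | loop_stop _ i₁ =>
    intro _ _ h
    cases h with
    | loop_stop a =>
      obtain ⟨-, rfl⟩ := i₁ a
      exact ⟨rfl, rfl⟩
    | loop_next a hb _ _ => exact absurd (i₁ a).1.symm hb
  | loop_next _ hb _ _ i₁ i₂ i₃ =>
    intro _ _ h
    cases h with
    | loop_stop a => exact absurd (i₁ a).1 hb
    | loop_next a _ b e =>
      obtain ⟨rfl, rfl⟩ := i₁ a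
      obtain ⟨rfl, rfl⟩ := i₂ b
      obtain ⟨rfl, rfl⟩ := i₃ e
      exact ⟨rfl, rfl⟩

/-- The running time is at least the length of the input and at least the length of the output. -/
theorem Exec.size_le {c : Prog} {d d' : Data} {t : ℕ} (h : Exec c d d' t) :
    d.size ≤ t ∧ d'.size ≤ t := by
  induction h with
  | prim o d => omega
  | both => simp only [Data.size]; omega
  | _ => omega

/-! ### The input -/

/-- A finite ring `R` and a finite `R`-module `M` as they are given to the algorithm: two abelian
groups by generators and relations, the products of pairs of generators of `R`, and the products of
the generators of `R` with the generators of `M`. Elements are given by integer coefficients with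
respect to the generators. -/
structure Input where
  /-- the number of generators of `R` -/
  n : ℕ
  /-- the number of generators of `M` -/
  m : ℕ
  /-- the relations between the generators of `R` -/
  relR : List (Fin n → ℤ)
  /-- the products of pairs of generators of `R` -/
  mul : Fin n → Fin n → Fin n → ℤ
  /-- the relations between the generators of `M` -/
  relM : List (Fin m → ℤ)
  /-- the products of generators of `R` with generators of `M` -/
  smul : Fin n → Fin m → Fin m → ℤ

/-- The input as a tree. -/
def Input.encode (P : Input) : Data :=
  .pair (.pair (.int P.n) (.pair (Data.ofVecs P.relR) (Data.ofTable P.mul)))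
    (.pair (.int P.m) (.pair (Data.ofVecs P.relM) (Data.ofTable P.smul)))

/-- The length of the input in bits. -/
def Input.length (P : Input) : ℕ := P.encode.size

/-- The element of an abelian group `G` with coefficients `w` with respect to `g`. -/
def comb {G : Type*} [AddCommGroup G] {k : ℕ} (g : Fin k → G) (w : Fin k → ℤ) : G :=
  ∑ i, w i • g i

/-- The input `P` describes the ring `R` and the `R`-module `M`, with `g` and `h` as the generators
of their additive groups. -/
structure Input.Presents (P : Input) {R : Type*} {M : Type*} [CommRing R] [AddCommGroup M]
    [Module R M] (g : Fin P.n → R) (h : Fin P.m → M) : Prop where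
  genR : Function.Surjective (comb g)
  relR : ∀ w, comb g w = 0 ↔ w ∈ AddSubgroup.closure {w | w ∈ P.relR}
  mul : ∀ i j, g i * g j = comb g (P.mul i j)
  genM : Function.Surjective (comb h)
  relM : ∀ w, comb h w = 0 ↔ w ∈ AddSubgroup.closure {w | w ∈ P.relM}
  smul : ∀ i j, g i • h j = comb h (P.smul i j)

/-! ### The algorithm -/

section Algorithm

variable (R : Type u) (M : Type v) [CommRing R] [AddCommGroup M] [Module R M]

/-- What the algorithm maintains: a quotient algebra `A = R ⧸ I` of `R`, an element `y` of `M` and a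
submodule `N` of `M`. -/
structure State where
  /-- the ideal `I` with `A = R ⧸ I` -/
  I : Ideal R
  /-- the element `y` -/
  y : M
  /-- the submodule `N` -/
  N : Submodule R M

variable {R M}

/-- Initially `A = R`, `y = 0` and `N = M`. -/
def State.init : State R M := ⟨⊥, 0, ⊤⟩

/-- The algebra `A`. -/
abbrev State.A (s : State R M) : Type u := R ⧸ s.I

/-- The `A`-module `M_A = A ⊗ M`. -/
abbrev State.MA (s : State R M) : Type (max u v) := s.A ⊗[R] M

/-- The elements `x` of `N` that the algorithm may pick: those with `1 ⊗ x ≠ 0` in `M_A`. -/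
def State.Pick (s : State R M) (x : M) : Prop :=
  x ∈ s.N ∧ ((1 : s.A) ⊗ₜ[R] x : s.MA) ≠ 0

/-- `𝔞`, the annihilator of `1 ⊗ x` in `A`. -/
def State.a (s : State R M) (x : M) : Ideal s.A :=
  Ideal.torsionOf s.A s.MA ((1 : s.A) ⊗ₜ[R] x)

/-- `𝔟`, the annihilator of `𝔞` in `A`. -/
def State.b (s : State R M) (x : M) : Ideal s.A := (s.a x).annihilator

/-- The preimage in `R` of an ideal `c` of `A`, so that `R ⧸ s.pre c = A ⧸ c`. -/
def State.pre (s : State R M) (c : Ideal s.A) : Ideal R := c.comap (Ideal.Quotient.mk s.I)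

/-- The condition `(A ⧸ 𝔞) ⊗ x = M_{A ⧸ 𝔞}`. -/
def State.Full (s : State R M) (x : M) : Prop :=
  ∀ z : (R ⧸ s.pre (s.a x)) ⊗[R] M, ∃ t : R ⧸ s.pre (s.a x), t ⊗ₜ[R] x = z

/-- One round of the algorithm that does not stop. -/
inductive Step : State R M → State R M → Prop
  /-- if `𝔞 ∩ 𝔟 ≠ 0`, then `A` is replaced by `A ⧸ (𝔞 ∩ 𝔟)` -/
  | shrink (s : State R M) (x : M) (hx : s.Pick x) (hab : s.a x ⊓ s.b x ≠ ⊥) :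
      Step s ⟨s.pre (s.a x ⊓ s.b x), s.y, s.N⟩
  /-- if `𝔞 ∩ 𝔟 = 0` and `(A ⧸ 𝔞) ⊗ x = M_{A ⧸ 𝔞}`, then `A`, `y`, `N` are replaced by `A ⧸ 𝔟`,
  `x + y`, `𝔞 N` -/
  | split (s : State R M) (x : M) (hx : s.Pick x) (hab : s.a x ⊓ s.b x = ⊥) (hf : s.Full x) :
      Step s ⟨s.pre (s.b x), x + s.y, s.pre (s.a x) • s.N⟩

/-- The algorithm stops, with an answer: `some y` for the answer "yes" with generator `y`, and `none`
for the answer "no". -/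
inductive Stops : State R M → Option M → Prop
  | yes (s : State R M) (h : ∀ z : s.MA, z = 0) : Stops s (some s.y)
  | no (s : State R M) (x : M) (hx : s.Pick x) (hab : s.a x ⊓ s.b x = ⊥) (hf : ¬ s.Full x) :
      Stops s none

/-- The list of the states in the first rounds of the algorithm, for some choice of the elements
that it picks. -/
def IsPartialRun (τ : List (State R M)) : Prop :=
  τ.head? = some State.init ∧ τ.IsChain Step

/-- The list of the states in a complete run of the algorithm, and its answer. -/
def IsRun (τ : List (State R M)) (ans : Option M) : Prop :=
  IsPartialRun τ ∧ ∃ s, τ.getLast? = some s ∧ Stops s ans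

end Algorithm

/-! ### The output -/

/-- A state of the algorithm as a program writes it down: `I` and `N` by generators of their additive
groups, and `y`, in coordinates. -/
structure StateCode (n m : ℕ) where
  /-- generators of the additive group of `I` -/
  I : List (Fin n → ℤ)
  /-- the element `y` -/
  y : Fin m → ℤ
  /-- generators of the additive group of `N` -/
  N : List (Fin m → ℤ)

/-- A written state as a tree. -/
def StateCode.encode {n m : ℕ} (q : StateCode n m) : Data :=
  .pair (Data.ofVecs q.I) (.pair (Data.ofVec q.y) (Data.ofVecs q.N))

/-- The state that is written down. -/
structure StateCode.Describes {n m : ℕ} (q : StateCode n m) {R : Type u} {M : Type v} [CommRing R]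
    [AddCommGroup M] [Module R M] (g : Fin n → R) (h : Fin m → M) (s : State R M) : Prop where
  I : AddSubgroup.closure (comb g '' {w | w ∈ q.I}) = s.I.toAddSubgroup
  y : comb h q.y = s.y
  N : AddSubgroup.closure (comb h '' {w | w ∈ q.N}) = s.N.toAddSubgroup

/-- The output of a program: the answer (`none` for "no", and "yes" together with a generator), and
the states through which it went. -/
structure Output (n m : ℕ) where
  /-- the answer -/
  answer : Option (Fin m → ℤ)
  /-- the states -/
  states : List (StateCode n m)

/-- The output as a tree. The answer "no" is `0`, and the answer "yes" is a pair of `1` and the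
generator. -/
def Output.encode {n m : ℕ} (o : Output n m) : Data :=
  .pair (match o.answer with
    | none => .int 0
    | some y => .pair (.int 1) (Data.ofVec y))
    (Data.ofList (o.states.map StateCode.encode))

end CyclicModule

namespace CyclicModule

/-- Types whose elements are written down as trees. -/
class Enc (α : Type) where
  /-- the tree of an element -/
  enc : α → Data

open Enc

/-- The bit length of an element. -/
def esize {α : Type} [Enc α] (a : α) : ℕ := (enc a).size

instance : Enc ℤ := ⟨Data.int⟩
instance : Enc Bool := ⟨fun b => Data.int (if b then 1 else 0)⟩
instance {α β : Type} [Enc α] [Enc β] : Enc (α × β) := ⟨fun a => .pair (enc a.1) (enc a.2)⟩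
instance {α : Type} [Enc α] : Enc (List α) := ⟨fun l => Data.ofList (l.map enc)⟩
instance {α : Type} [Enc α] : Enc (Option α) :=
  ⟨fun o => match o with
    | none => .int 0
    | some a => .pair (.int 1) (enc a)⟩

variable {α β γ δ : Type} [Enc α] [Enc β] [Enc γ] [Enc δ]

theorem one_le_size (d : Data) : 1 ≤ d.size := by
  cases d <;> simp [Data.size]

theorem one_le_esize (a : α) : 1 ≤ esize a := one_le_size _

@[simp] theorem esize_pair (a : α) (b : β) : esize (a, b) = esize a + esize b + 1 := rfl

@[simp] theorem esize_nil : esize ([] : List α) = 1 := rfl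

@[simp] theorem esize_cons (a : α) (l : List α) : esize (a :: l) = esize a + esize l + 1 := rfl

theorem esize_int (z : ℤ) : esize z = z.natAbs.size + 1 := rfl

theorem esize_bool_le (b : Bool) : esize b ≤ 2 := by cases b <;> decide

theorem esize_none : esize (none : Option α) = 1 := rfl

theorem esize_some (a : α) : esize (some a) = esize a + 3 := by
  change (1 + 1) + esize a + 1 = _
  omega

theorem length_le_esize (l : List α) : l.length ≤ esize l := by
  induction l with
  | nil => simp
  | cons a l ih => simp; omega

theorem esize_le_of_mem {a : α} {l : List α} (h : a ∈ l) : esize a ≤ esize l := by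
  induction l with
  | nil => simp at h
  | cons b l ih =>
    rcases List.mem_cons.1 h with rfl | h
    · simp; omega
    · have := ih h; simp; omega

theorem esize_list_le {l : List α} {L s : ℕ} (hL : l.length ≤ L) (h : ∀ a ∈ l, esize a ≤ s) :
    esize l ≤ L * (s + 1) + 1 := by
  refine le_trans ?_ (Nat.add_le_add_right (Nat.mul_le_mul_right _ hL) 1)
  clear hL
  induction l with
  | nil => simp
  | cons a l ih =>
    have h1 := h a (by simp)
    have h2 := ih fun b hb => h b (by simp [hb])
    simp only [esize_cons, List.length_cons, Nat.add_mul]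
    omega

theorem eval_mono (p : Polynomial ℕ) {a b : ℕ} (h : a ≤ b) : p.eval a ≤ p.eval b := by
  induction p using Polynomial.induction_on' with
  | add p q hp hq => simp only [Polynomial.eval_add]; omega
  | monomial n c =>
    simp only [Polynomial.eval_monomial]
    exact Nat.mul_le_mul_left _ (Nat.pow_le_pow_left h _)

/-- The function `b` is bounded by a polynomial in the bit length. -/
def PolyBound (b : α → ℕ) : Prop := ∃ p : Polynomial ℕ, ∀ a, b a ≤ p.eval (esize a)

theorem PolyBound.mono {b b' : α → ℕ} (h : PolyBound b') (hb : ∀ a, b a ≤ b' a) : PolyBound b :=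
  let ⟨p, hp⟩ := h
  ⟨p, fun a => (hb a).trans (hp a)⟩

theorem PolyBound.const (n : ℕ) : PolyBound fun _ : α => n := ⟨Polynomial.C n, fun a => by simp⟩

theorem PolyBound.self : PolyBound fun a : α => esize a := ⟨Polynomial.X, fun a => by simp⟩

theorem PolyBound.add {b b' : α → ℕ} (h : PolyBound b) (h' : PolyBound b') :
    PolyBound fun a => b a + b' a :=
  let ⟨p, hp⟩ := h
  let ⟨q, hq⟩ := h'
  ⟨p + q, fun a => by simpa using Nat.add_le_add (hp a) (hq a)⟩

theorem PolyBound.mul {b b' : α → ℕ} (h : PolyBound b) (h' : PolyBound b') :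
    PolyBound fun a => b a * b' a :=
  let ⟨p, hp⟩ := h
  let ⟨q, hq⟩ := h'
  ⟨p * q, fun a => by simpa using Nat.mul_le_mul (hp a) (hq a)⟩

theorem PolyBound.eval {b : α → ℕ} (h : PolyBound b) (p : Polynomial ℕ) :
    PolyBound fun a => p.eval (b a) :=
  let ⟨q, hq⟩ := h
  ⟨p.comp q, fun a => by simpa using eval_mono p (hq a)⟩

/-- The function `f` is computed by a program in polynomial time. -/
def PolyTime (f : α → β) : Prop :=
  ∃ (c : Prog) (p : Polynomial ℕ), ∀ a, ∃ t, Exec c (enc a) (enc (f a)) t ∧ t ≤ p.eval (esize a)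

theorem PolyTime.bound {f : α → β} (h : PolyTime f) : PolyBound fun a => esize (f a) := by
  obtain ⟨c, p, hc⟩ := h
  refine ⟨p, fun a => ?_⟩
  obtain ⟨t, h1, h2⟩ := hc a
  exact h1.size_le.2.trans h2

theorem PolyTime.of_prim (o : Prim) {f : α → β} (h : ∀ a, o.apply (enc a) = enc (f a))
    (hb : PolyBound fun a => esize (f a)) : PolyTime f := by
  obtain ⟨p, hp⟩ := hb
  refine ⟨.prim o, .X + p, fun a => ⟨(enc a).size + (enc (f a)).size, ?_, ?_⟩⟩
  · rw [← h a]
    exact .prim o _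
  · simpa [esize] using hp a

theorem PolyTime.comp {g : β → γ} {f : α → β} (hg : PolyTime g) (hf : PolyTime f) :
    PolyTime fun a => g (f a) := by
  obtain ⟨c, p, hc⟩ := hg
  obtain ⟨c', p', hc'⟩ := hf
  refine ⟨.seq c' c, p' + p.comp p' + 1, fun a => ?_⟩
  obtain ⟨t, h1, h2⟩ := hc' a
  obtain ⟨t', h3, h4⟩ := hc (f a)
  refine ⟨_, .seq h1 h3, ?_⟩
  have := h4.trans (eval_mono p (h1.size_le.2.trans h2))
  simp only [Polynomial.eval_add, Polynomial.eval_comp, Polynomial.eval_one]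
  omega

theorem PolyTime.pair {f : α → β} {g : α → γ} (hf : PolyTime f) (hg : PolyTime g) :
    PolyTime fun a => (f a, g a) := by
  obtain ⟨c, p, hc⟩ := hf
  obtain ⟨c', p', hc'⟩ := hg
  refine ⟨.both c c', p + p' + 1, fun a => ?_⟩
  obtain ⟨t, h1, h2⟩ := hc a
  obtain ⟨t', h3, h4⟩ := hc' a
  refine ⟨_, .both h1 h3, ?_⟩
  simp only [Polynomial.eval_add, Polynomial.eval_one]
  omega

theorem PolyTime.id : PolyTime fun a : α => a := .of_prim .id (fun _ => rfl) .self

theorem PolyTime.fst : PolyTime fun a : α × β => a.1 :=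
  .of_prim .fst (fun _ => rfl) (PolyBound.self.mono fun a => by
    obtain ⟨a, b⟩ := a; simp; omega)

theorem PolyTime.snd : PolyTime fun a : α × β => a.2 :=
  .of_prim .snd (fun _ => rfl) (PolyBound.self.mono fun a => by
    obtain ⟨a, b⟩ := a; simp; omega)

theorem exec_const (d : Data) : ∃ (c : Prog) (p : Polynomial ℕ),
    ∀ d₀, ∃ t, Exec c d₀ d t ∧ t ≤ p.eval d₀.size := by
  induction d with
  | int z =>
    exact ⟨.prim (.const z), .X + .C (Data.int z).size, fun d₀ => ⟨_, .prim _ _, by simp [Prim.apply]⟩⟩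
  | pair a b iha ihb =>
    obtain ⟨c, p, hc⟩ := iha
    obtain ⟨c', p', hc'⟩ := ihb
    refine ⟨.both c c', p + p' + 1, fun d₀ => ?_⟩
    obtain ⟨t, h1, h2⟩ := hc d₀
    obtain ⟨t', h3, h4⟩ := hc' d₀
    refine ⟨_, .both h1 h3, ?_⟩
    simp only [Polynomial.eval_add, Polynomial.eval_one]
    omega

theorem PolyTime.const (b : β) : PolyTime fun _ : α => b := by
  obtain ⟨c, p, hc⟩ := exec_const (enc b)
  exact ⟨c, p, fun a => hc _⟩

theorem PolyTime.ite {c : α → Bool} {f g : α → β} (hc : PolyTime c) (hf : PolyTime f)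
    (hg : PolyTime g) : PolyTime fun a => if c a then f a else g a := by
  obtain ⟨c0, p0, h0⟩ := hc
  obtain ⟨c1, p1, h1⟩ := hf
  obtain ⟨c2, p2, h2⟩ := hg
  refine ⟨.ite c0 c1 c2, p0 + p1 + p2 + 1, fun a => ?_⟩
  obtain ⟨t0, e0, b0⟩ := h0 a
  obtain ⟨t1, e1, b1⟩ := h1 a
  obtain ⟨t2, e2, b2⟩ := h2 a
  simp only [Polynomial.eval_add, Polynomial.eval_one]
  cases hca : c a with
  | true =>
    rw [hca] at e0
    exact ⟨_, .ite_true e0 (by simp [enc]) (by simpa using e1), by omega⟩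
  | false =>
    rw [hca] at e0
    exact ⟨_, .ite_false e0 (by simpa using e2), by omega⟩

/-- A loop runs in polynomial time if the number of rounds and the lengths of the states are
polynomially bounded. -/
theorem PolyTime.loop {σ : Type} [Enc σ] {c : σ → Bool} {f : σ → σ} {g : α → σ} {n B : α → ℕ}
    (hc : PolyTime c) (hf : PolyTime f) (hg : PolyTime g) (hn : PolyBound n) (hB : PolyBound B)
    (hfix : ∀ a, c (f^[n a] (g a)) = false) (hnext : ∀ a, ∀ j < n a, c (f^[j] (g a)) = true)
    (hs : ∀ a, ∀ j ≤ n a, esize (f^[j] (g a)) ≤ B a) :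
    PolyTime fun a => f^[n a] (g a) := by
  obtain ⟨c0, p0, h0⟩ := hc
  obtain ⟨c1, p1, h1⟩ := hf
  obtain ⟨c2, p2, h2⟩ := hg
  obtain ⟨q, hq⟩ := hn
  obtain ⟨r, hr⟩ := hB
  have key : ∀ (k : ℕ) (s : σ) (b : ℕ), c (f^[k] s) = false → (∀ j < k, c (f^[j] s) = true) →
      (∀ j ≤ k, esize (f^[j] s) ≤ b) →
      ∃ t, Exec (.loop c0 c1) (enc s) (enc (f^[k] s)) t ∧
        t ≤ (k + 1) * (p0.eval b + p1.eval b + 1) := by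
    intro k
    induction k with
    | zero =>
      intro s b hend _ hb
      obtain ⟨t0, e0, b0⟩ := h0 s
      simp only [Function.iterate_zero, id_eq] at hend
      rw [hend] at e0
      refine ⟨_, by constructor; exact e0, ?_⟩
      have := b0.trans (eval_mono p0 (hb 0 le_rfl))
      omega
    | succ k ih =>
      intro s b hend hnext hb
      obtain ⟨t0, e0, b0⟩ := h0 s
      obtain ⟨t1, e1, b1⟩ := h1 s
      have hcs := hnext 0 (by omega)
      simp only [Function.iterate_zero, id_eq] at hcs
      rw [hcs] at e0
      obtain ⟨t, e, bt⟩ := ih (f s) b hend (fun j hj => hnext (j + 1) (by omega))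
        (fun j hj => hb (j + 1) (by omega))
      refine ⟨_, .loop_next e0 (by simp [enc]) e1 e, ?_⟩
      have h3 := b0.trans (eval_mono p0 (hb 0 (by omega)))
      have h4 := b1.trans (eval_mono p1 (hb 0 (by omega)))
      rw [Nat.succ_mul (k + 1)]
      omega
  refine ⟨.seq c2 (.loop c0 c1), p2 + (q + 1) * (p0.comp r + p1.comp r + 1) + 1, fun a => ?_⟩
  obtain ⟨t2, e2, b2⟩ := h2 a
  obtain ⟨t, e, bt⟩ := key (n a) (g a) (B a) (hfix a) (hnext a) (hs a)
  refine ⟨_, .seq e2 e, ?_⟩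
  simp only [Polynomial.eval_add, Polynomial.eval_mul, Polynomial.eval_comp, Polynomial.eval_one]
  have := bt.trans (Nat.mul_le_mul (Nat.add_le_add_right (hq a) 1) (Nat.add_le_add_right
    (Nat.add_le_add (eval_mono p0 (hr a)) (eval_mono p1 (hr a))) 1))
  omega

/-! #### Arithmetic -/

theorem size_le_of_natAbs_le {x y : ℤ} (h : x.natAbs ≤ y.natAbs) : esize x ≤ esize y :=
  Nat.add_le_add_right (Nat.size_le_size h) 1

theorem natAbs_lt_two_pow (z : ℤ) : z.natAbs < 2 ^ esize z :=
  (Nat.lt_size_self _).trans_le (Nat.pow_le_pow_right (by simp) (by simp [esize_int]))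

theorem esize_le_of_lt {z : ℤ} {k : ℕ} (h : z.natAbs < 2 ^ k) : esize z ≤ k + 1 :=
  Nat.add_le_add_right (Nat.size_le.2 h) 1

theorem PolyTime.add {f g : α → ℤ} (hf : PolyTime f) (hg : PolyTime g) :
    PolyTime fun a => f a + g a := by
  refine PolyTime.comp (g := fun p : ℤ × ℤ => p.1 + p.2) ?_ (hf.pair hg)
  refine .of_prim .add (fun _ => rfl) (PolyBound.self.add (.const 1) |>.mono ?_)
  rintro ⟨a, b⟩
  have h1 := natAbs_lt_two_pow a
  have h2 := natAbs_lt_two_pow b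
  simp only [esize_pair]
  refine esize_le_of_lt ?_
  calc (a + b).natAbs ≤ a.natAbs + b.natAbs := Int.natAbs_add_le _ _
    _ < 2 ^ (esize a + esize b) + 2 ^ (esize a + esize b) := by
        have := Nat.pow_le_pow_right (n := 2) (by simp) (Nat.le_add_right (esize a) (esize b))
        have := Nat.pow_le_pow_right (n := 2) (by simp) (Nat.le_add_left (esize b) (esize a))
        omega
    _ = _ := by ring

theorem PolyTime.mul {f g : α → ℤ} (hf : PolyTime f) (hg : PolyTime g) :
    PolyTime fun a => f a * g a := by
  refine PolyTime.comp (g := fun p : ℤ × ℤ => p.1 * p.2) ?_ (hf.pair hg)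
  refine .of_prim .mul (fun _ => rfl) (PolyBound.self.mono ?_)
  rintro ⟨a, b⟩
  have h1 := natAbs_lt_two_pow a
  have h2 := natAbs_lt_two_pow b
  simp only [esize_pair]
  refine esize_le_of_lt ?_
  rw [Int.natAbs_mul, pow_add]
  exact Nat.mul_lt_mul'' h1 h2

theorem PolyTime.neg {f : α → ℤ} (hf : PolyTime f) : PolyTime fun a => -f a := by
  simpa using (PolyTime.const (-1)).mul hf

theorem PolyTime.sub {f g : α → ℤ} (hf : PolyTime f) (hg : PolyTime g) :
    PolyTime fun a => f a - g a := by
  simpa [sub_eq_add_neg] using hf.add hg.neg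

theorem PolyTime.div {f g : α → ℤ} (hf : PolyTime f) (hg : PolyTime g) :
    PolyTime fun a => f a / g a := by
  refine PolyTime.comp (g := fun p : ℤ × ℤ => p.1 / p.2) ?_ (hf.pair hg)
  refine .of_prim .div (fun _ => rfl) (PolyBound.self.mono ?_)
  rintro ⟨a, b⟩
  have : esize (a / b) ≤ esize a := size_le_of_natAbs_le (Int.natAbs_ediv_le_natAbs a b)
  simp only [esize_pair]
  omega

theorem PolyTime.mod {f g : α → ℤ} (hf : PolyTime f) (hg : PolyTime g) :
    PolyTime fun a => f a % g a := by
  simpa [Int.emod_def] using hf.sub (hg.mul (hf.div hg))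

theorem PolyTime.lt {f g : α → ℤ} (hf : PolyTime f) (hg : PolyTime g) :
    PolyTime fun a => decide (f a < g a) := by
  refine PolyTime.comp (g := fun p : ℤ × ℤ => decide (p.1 < p.2)) ?_ (hf.pair hg)
  refine .of_prim .lt ?_ ((PolyBound.const 2).mono fun _ => esize_bool_le _)
  rintro ⟨a, b⟩
  by_cases h : a < b <;> simp [Prim.apply, enc, h]

theorem PolyTime.not {f : α → Bool} (hf : PolyTime f) : PolyTime fun a => !f a := by
  convert hf.ite (PolyTime.const false) (PolyTime.const true) using 2 with a
  cases f a <;> rfl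

theorem PolyTime.and {f g : α → Bool} (hf : PolyTime f) (hg : PolyTime g) :
    PolyTime fun a => f a && g a := by
  convert hf.ite hg (PolyTime.const false) using 2 with a
  cases f a <;> rfl

theorem PolyTime.eq_zero {f : α → ℤ} (hf : PolyTime f) : PolyTime fun a => decide (f a = 0) := by
  convert (hf.lt (PolyTime.const 0)).not.and ((PolyTime.const 0).lt hf).not using 2 with a
  rw [← decide_not, ← decide_not, ← Bool.decide_and, decide_eq_decide]
  omega

/-! #### Lists -/

theorem PolyTime.nil : PolyTime fun _ : α => ([] : List β) := .const []

theorem PolyTime.cons {f : α → β} {l : α → List β} (hf : PolyTime f) (hl : PolyTime l) :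
    PolyTime fun a => f a :: l a := by
  simpa [PolyTime, enc, Data.ofList] using hf.pair hl

theorem PolyTime.some {f : α → β} (hf : PolyTime f) : PolyTime fun a => some (f a) := by
  simpa [PolyTime, enc, Data.ofList] using (PolyTime.const (1 : ℤ)).pair hf

theorem PolyTime.isPair {l : α → List β} (hl : PolyTime l) : PolyTime fun a => !(l a).isEmpty := by
  refine PolyTime.comp (g := fun l : List β => !l.isEmpty) ?_ hl
  refine .of_prim .isPair ?_ ((PolyBound.const 2).mono fun _ => esize_bool_le _)
  rintro (_ | ⟨a, l⟩) <;> rfl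

theorem PolyTime.tail {l : α → List β} (hl : PolyTime l) : PolyTime fun a => (l a).tail := by
  refine PolyTime.comp (g := fun l : List β => l.tail) ?_ hl
  refine .of_prim .snd ?_ (PolyBound.self.mono ?_)
  · rintro (_ | ⟨a, l⟩) <;> rfl
  · rintro (_ | ⟨a, l⟩) <;> simp
    omega

/-- If the function `f` takes on nonempty lists the values of a function of the head and the tail
that is computable in polynomial time, then `f` is computable in polynomial time. -/
theorem PolyTime.casesOn {l : α → List β} {f : α → γ} {g : α × β × List β → γ} (hl : PolyTime l)
    (hf : PolyTime f) (hg : PolyTime g) :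
    PolyTime fun a => match l a with
      | [] => f a
      | b :: l' => g (a, b, l') := by
  obtain ⟨c0, p0, h0⟩ := hl.isPair
  obtain ⟨c1, p1, h1⟩ := hf
  obtain ⟨c2, p2, h2⟩ := hg
  obtain ⟨c3, p3, h3⟩ := hl
  refine ⟨.ite c0 (.seq (.both (.prim .id) c3) c2) c1,
    p0 + p1 + p3 + 2 * .X + p2.comp (.X + p3 + 1) + 3, fun a => ?_⟩
  obtain ⟨t0, e0, b0⟩ := h0 a
  obtain ⟨t1, e1, b1⟩ := h1 a
  obtain ⟨t3, e3, b3⟩ := h3 a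
  simp only [Polynomial.eval_add, Polynomial.eval_one, Polynomial.eval_comp, Polynomial.eval_X,
    Polynomial.eval_mul, Polynomial.eval_ofNat]
  cases hl : l a with
  | nil =>
    simp only [hl] at e0
    exact ⟨_, .ite_false e0 e1, by omega⟩
  | cons b l' =>
    obtain ⟨t2, e2, b2⟩ := h2 (a, b, l')
    simp only [hl] at e0 e3
    have e4 : Exec (.both (.prim .id) c3) (enc a) (enc (a, b, l')) _ := .both (.prim .id _) e3
    refine ⟨_, .ite_true e0 (by simp [enc]) (.seq e4 e2), ?_⟩
    have h5 : esize (a, b, l') ≤ esize a + p3.eval (esize a) + 1 := by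
      have := e3.size_le.2
      change esize (b :: l') ≤ _ at this
      simp only [esize_cons, esize_pair] at this ⊢
      omega
    have := b2.trans (eval_mono p2 h5)
    have h6 : ((Prim.id.apply (enc a)).size) = esize a := rfl
    have h7 : (enc a).size = esize a := rfl
    omega

theorem PolyTime.headD {l : α → List β} {f : α → β} (hl : PolyTime l) (hf : PolyTime f) :
    PolyTime fun a => (l a).headD (f a) := by
  convert PolyTime.casesOn hl hf (PolyTime.fst.comp PolyTime.snd) using 2 with a
  cases l a <;> rfl

theorem PolyTime.foldl {f : α → β → γ → β} {i : α → β} {l : α → List γ} {B : α → ℕ}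
    (hf : PolyTime fun p : α × β × γ => f p.1 p.2.1 p.2.2) (hi : PolyTime i) (hl : PolyTime l)
    (hB : PolyBound B) (hs : ∀ a l', l' <+: l a → esize (l'.foldl (f a) (i a)) ≤ B a) :
    PolyTime fun a => (l a).foldl (f a) (i a) := by
  let F : α × β × List γ → α × β × List γ := fun s =>
    match s.2.2 with
    | [] => s
    | c :: l' => (s.1, f s.1 s.2.1 c, l')
  have hF : PolyTime F := by
    refine PolyTime.casesOn (l := fun s : α × β × List γ => s.2.2) (PolyTime.snd.comp .snd) .id
      (g := fun s => (s.1.1, f s.1.1 s.1.2.1 s.2.1, s.2.2)) ?_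
    refine (PolyTime.fst.comp .fst).pair (.pair ?_ (PolyTime.snd.comp .snd))
    exact hf.comp (((PolyTime.fst.comp .fst)).pair ((PolyTime.fst.comp (PolyTime.snd.comp .fst)).pair
      (PolyTime.fst.comp .snd)))
  have it : ∀ (k : ℕ) (a : α) (b : β) (l : List γ), k ≤ l.length →
      F^[k] (a, b, l) = (a, (l.take k).foldl (f a) b, l.drop k) := by
    intro k
    induction k with
    | zero => intro a b l _; simp
    | succ k ih =>
      intro a b l hl
      cases l with
      | nil => simp at hl
      | cons c l =>
        simp only [Function.iterate_succ, Function.comp, List.take_succ_cons, List.foldl_cons,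
          List.drop_succ_cons]
        exact ih a _ l (by simpa using hl)
  have hbl := hl.bound
  have : PolyTime fun a => F^[(l a).length] (a, i a, l a) := by
    refine PolyTime.loop (c := fun s => !s.2.2.isEmpty) (B := fun a => esize a + B a + esize (l a) + 2)
      (PolyTime.snd.comp .snd).isPair hF (.pair .id (hi.pair hl))
      (hbl.mono fun a => length_le_esize _) (((PolyBound.self.add hB).add hbl).add (.const 2)) ?_ ?_ ?_
    · intro a
      rw [it _ _ _ _ le_rfl]
      simp
    · intro a j hj
      rw [it _ _ _ _ hj.le]
      simpa using hj
    · intro a j hj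
      rw [it _ _ _ _ hj]
      have h1 := hs a _ (List.take_prefix j (l a))
      have h2 : ∀ (j : ℕ) (l : List γ), esize (l.drop j) ≤ esize l := by
        intro j
        induction j with
        | zero => simp
        | succ j ih =>
          rintro (_ | ⟨c, l⟩)
          · simp
          · have := ih l; simp; omega
      have := h2 j (l a)
      simp only [esize_pair]
      omega
  convert (PolyTime.fst.comp (PolyTime.snd.comp this)) using 2 with a
  rw [it _ _ _ _ le_rfl]
  simp

theorem PolyTime.reverse {l : α → List β} (hl : PolyTime l) : PolyTime fun a => (l a).reverse := by
  have hr : ∀ l : List β, esize l.reverse = esize l := by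
    intro l
    induction l with
    | nil => rfl
    | cons a l ih =>
      have : ∀ (l : List β) (a : β), esize (l ++ [a]) = esize l + esize a + 1 := by
        intro l a
        induction l with
        | nil => simp; omega
        | cons b l ih => simp [ih]; omega
      simp [this, ih]; omega
  have : PolyTime fun a => (l a).foldl (fun acc x => x :: acc) [] := by
    refine PolyTime.foldl (f := fun _ acc x => x :: acc) (PolyTime.cons (.comp .snd .snd) (.comp .fst .snd))
      .nil hl hl.bound ?_
    intro a l' hl'
    obtain ⟨r, hr'⟩ := hl'
    have h2 : ∀ l' r : List β, esize l' ≤ esize (l' ++ r) := by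
      intro l' r
      induction l' with
      | nil => exact one_le_esize _
      | cons b l ih => simp; omega
    have h1 : l'.foldl (fun acc x => x :: acc) [] = l'.reverse := by simp
    rw [h1, hr, ← hr']
    exact h2 _ _
  simpa using this

theorem PolyTime.map {f : α → β → γ} {l : α → List β} (hf : PolyTime fun p : α × β => f p.1 p.2)
    (hl : PolyTime l) : PolyTime fun a => (l a).map (f a) := by
  have : PolyTime fun a => (l a).foldl (fun acc x => f a x :: acc) [] := by
    obtain ⟨p, hp⟩ := hf.bound
    refine PolyTime.foldl (f := fun a acc x => f a x :: acc)
      (B := fun a => esize (l a) * (p.eval (esize a + esize (l a) + 1) + 1) + 1)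
      (PolyTime.cons (hf.comp (.pair .fst (.comp .snd .snd))) (.comp .fst .snd))
      .nil hl ?_ ?_
    · exact (hl.bound.mul ((((PolyBound.self.add hl.bound).add (.const 1)).eval p).add (.const 1))).add
        (.const 1)
    intro a l' hl'
    have h1 : ∀ acc, l'.foldl (fun acc x => f a x :: acc) acc = (l'.map (f a)).reverse ++ acc := by
      clear hl'
      induction l' with
      | nil => simp
      | cons b l' ih => intro acc; simp [ih]
    rw [h1, List.append_nil]
    refine esize_list_le (by simpa using hl'.length_le.trans (length_le_esize _)) ?_
    intro c hc
    simp only [List.mem_reverse, List.mem_map] at hc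
    obtain ⟨b, hb, rfl⟩ := hc
    refine (hp (a, b)).trans (eval_mono p ?_)
    have := esize_le_of_mem (hl'.subset hb)
    simp; omega
  convert this.reverse using 2 with a
  have h1 : ∀ (l' : List β) (acc : List γ),
      l'.foldl (fun acc x => f a x :: acc) acc = (l'.map (f a)).reverse ++ acc := by
    intro l'
    induction l' with
    | nil => simp
    | cons b l' ih => intro acc; simp [ih]
  rw [h1]; simp

theorem PolyTime.append {l l' : α → List β} (hl : PolyTime l) (hl' : PolyTime l') :
    PolyTime fun a => l a ++ l' a := by
  have h1 : ∀ l l' : List β, l.foldl (fun acc x => x :: acc) l' = l.reverse ++ l' := by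
    intro l
    induction l with
    | nil => simp
    | cons b l ih => intro l'; simp
  have h3 : ∀ l' r : List β, esize (l' ++ r) ≤ esize l' + esize r := by
    intro l' r
    induction l' with
    | nil => simp
    | cons b l ih => simp; omega
  have : PolyTime fun a => (l a).reverse.foldl (fun acc x => x :: acc) (l' a) := by
    refine PolyTime.foldl (f := fun _ acc x => x :: acc) (PolyTime.cons (.comp .snd .snd) (.comp .fst .snd))
      hl' hl.reverse (B := fun a => esize (l a).reverse * (esize (l a).reverse + 1) + 1 + esize (l' a)) ?_ ?_
    · exact ((hl.reverse.bound.mul (hl.reverse.bound.add (.const 1))).add (.const 1)).add hl'.bound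
    intro a r hr
    rw [h1]
    refine (h3 _ _).trans (Nat.add_le_add_right (esize_list_le ?_ ?_) _)
    · simpa using hr.length_le.trans (length_le_esize _)
    · intro b hb
      exact esize_le_of_mem (hr.subset (by simpa using hb))
  convert this using 2 with a
  rw [h1]; simp

theorem PolyTime.filter {f : α → β → Bool} {l : α → List β}
    (hf : PolyTime fun p : α × β => f p.1 p.2) (hl : PolyTime l) :
    PolyTime fun a => (l a).filter (f a) := by
  have h1 : ∀ (a : α) (l' acc : List β), l'.foldl (fun acc x => if f a x then x :: acc else acc) acc =
      (l'.filter (f a)).reverse ++ acc := by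
    intro a l'
    induction l' with
    | nil => simp
    | cons b l' ih =>
      intro acc
      by_cases h : f a b <;> simp [h, ih]
  have : PolyTime fun a => (l a).foldl (fun acc x => if f a x then x :: acc else acc) [] := by
    refine PolyTime.foldl (f := fun a acc x => if f a x then x :: acc else acc)
      (B := fun a => esize (l a) * (esize (l a) + 1) + 1)
      (.ite (hf.comp (.pair .fst (.comp .snd .snd)))
        (PolyTime.cons (.comp .snd .snd) (.comp .fst .snd)) (.comp .fst .snd)) .nil hl
      ((hl.bound.mul (hl.bound.add (.const 1))).add (.const 1)) ?_
    intro a l' hl'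
    rw [h1, List.append_nil]
    refine esize_list_le ?_ ?_
    · simpa using (List.length_filter_le _ _).trans (hl'.length_le.trans (length_le_esize _))
    · intro c hc
      simp only [List.mem_reverse, List.mem_filter] at hc
      exact esize_le_of_mem (hl'.subset hc.1)
  convert this.reverse using 2 with a
  rw [h1]; simp

theorem PolyTime.all {f : α → β → Bool} {l : α → List β}
    (hf : PolyTime fun p : α × β => f p.1 p.2) (hl : PolyTime l) :
    PolyTime fun a => (l a).all (f a) := by
  convert (PolyTime.filter (f := fun a b => !f a b) hf.not hl).isPair.not using 2 with a
  simp only [Bool.not_not]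
  rw [Bool.eq_iff_iff]
  simp [List.filter_eq_nil_iff]

theorem PolyTime.flatMap {f : α → β → List γ} {l : α → List β}
    (hf : PolyTime fun p : α × β => f p.1 p.2) (hl : PolyTime l) :
    PolyTime fun a => (l a).flatMap (f a) := by
  have h1 : ∀ (a : α) (l' : List β) (acc : List γ), l'.foldl (fun acc x => acc ++ f a x) acc =
      acc ++ l'.flatMap (f a) := by
    intro a l'
    induction l' with
    | nil => simp
    | cons b l' ih => intro acc; simp [ih]
  have h3 : ∀ l' r : List γ, esize (l' ++ r) ≤ esize l' + esize r := by
    intro l' r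
    induction l' with
    | nil => simp
    | cons b l ih => simp; omega
  obtain ⟨p, hp⟩ := hf.bound
  have : PolyTime fun a => (l a).foldl (fun acc x => acc ++ f a x) [] := by
    refine PolyTime.foldl (f := fun a acc x => acc ++ f a x)
      (B := fun a => esize (l a) * p.eval (esize a + esize (l a) + 1) + 1)
      (.append (.comp .fst .snd) (hf.comp (.pair .fst (.comp .snd .snd)))) .nil hl
      ((hl.bound.mul (((PolyBound.self.add hl.bound).add (.const 1)).eval p)).add (.const 1)) ?_
    intro a l' hl'
    rw [h1, List.nil_append]
    refine le_trans ?_ (Nat.add_le_add_right (Nat.mul_le_mul_right _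
      (hl'.length_le.trans (length_le_esize _))) 1)
    have hm := hl'.subset
    clear hl'
    induction l' with
    | nil => simp
    | cons b l' ih =>
      have h4 := ih (fun x hx => hm (by simp [hx]))
      have h5 := (hp (a, b)).trans (eval_mono p (b := esize a + esize (l a) + 1) (by
        have := esize_le_of_mem (hm (List.mem_cons_self (a := b) (l := l')))
        simp; omega))
      have h6 := h3 (f a b) (l'.flatMap (f a))
      simp only [List.flatMap_cons, List.length_cons, Nat.add_mul, one_mul]
      simp only at h5
      omega
  convert this using 2 with a
  rw [h1]; simp

theorem PolyTime.zipWith {f : α → β → γ → δ} {l : α → List β} {l' : α → List γ}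
    (hf : PolyTime fun p : α × β × γ => f p.1 p.2.1 p.2.2) (hl : PolyTime l) (hl' : PolyTime l') :
    PolyTime fun a => List.zipWith (f a) (l a) (l' a) := by
  let step : List (β × γ) × List γ → β → List (β × γ) × List γ := fun acc x =>
    match acc.2 with
    | [] => acc
    | y :: r => ((x, y) :: acc.1, r)
  have h1 : ∀ (l : List β) (l' : List γ) (acc : List (β × γ)),
      (l.foldl step (acc, l')) = ((List.zip l l').reverse ++ acc, l'.drop l.length) := by
    intro l
    induction l with
    | nil => simp
    | cons b l ih =>
      intro l' acc
      cases l' with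
      | nil =>
        have : ∀ l : List β, l.foldl step (acc, []) = (acc, []) := by
          intro l
          induction l with
          | nil => rfl
          | cons b l ih => exact ih
        simp [this]
      | cons c l' =>
        have : step (acc, c :: l') b = ((b, c) :: acc, l') := rfl
        rw [List.foldl_cons, this, ih]
        simp
  have h2 : PolyTime fun a => (l a).foldl step ([], l' a) := by
    refine PolyTime.foldl (f := fun _ => step)
      (B := fun a => (esize (l a) * ((esize (l a) + esize (l' a) + 1) + 1) + 1) +
        (esize (l' a) * (esize (l' a) + 1) + 1) + 1) ?_ (.pair .nil hl') hl
      ((((hl.bound.mul (((hl.bound.add hl'.bound).add (.const 1)).add (.const 1))).add (.const 1)).add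
        ((hl'.bound.mul (hl'.bound.add (.const 1))).add (.const 1))).add (.const 1)) ?_
    · refine PolyTime.casesOn (l := fun p : α × (List (β × γ) × List γ) × β => p.2.1.2)
        (.comp .snd (.comp .fst .snd)) (.comp .fst .snd)
        (g := fun q => ((q.1.2.2, q.2.1) :: q.1.2.1.1, q.2.2)) ?_
      refine .pair (.cons (.pair ?_ (.comp .fst .snd)) ?_) (.comp .snd .snd)
      · exact .comp .snd (.comp .snd .fst)
      · exact .comp .fst (.comp .fst (.comp .snd .fst))
    · intro a r hr
      rw [h1, List.append_nil, esize_pair]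
      refine Nat.add_le_add_right (Nat.add_le_add (esize_list_le ?_ ?_) (esize_list_le ?_ ?_)) 1
      · have := hr.length_le.trans (length_le_esize _)
        simp; omega
      · rintro ⟨b, c⟩ h
        have h := List.of_mem_zip (List.mem_reverse.1 h)
        have h3 := esize_le_of_mem (hr.subset h.1)
        have h4 := esize_le_of_mem h.2
        simp; omega
      · have := length_le_esize (l' a)
        simp; omega
      · intro c hc
        exact esize_le_of_mem (List.drop_subset _ _ hc)
  have h3 : PolyTime fun a => (((l a).foldl step ([], l' a)).1.reverse.map fun q => f a q.1 q.2) :=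
    PolyTime.map (f := fun a (q : β × γ) => f a q.1 q.2) hf (PolyTime.reverse (.comp .fst h2))
  convert h3 using 2 with a
  rw [h1]
  simp [List.zip, List.map_zipWith]

theorem PolyTime.foldl_of_invariant {f : α → β → γ → β} {i : α → β} {l : α → List γ} {B : α → ℕ}
    (hf : PolyTime fun p : α × β × γ => f p.1 p.2.1 p.2.2) (hi : PolyTime i) (hl : PolyTime l)
    (hB : PolyBound B) (J : α → ℕ → β → Prop) (h0 : ∀ a, J a 0 (i a))
    (hs : ∀ a k b, ∀ x ∈ l a, J a k b → J a (k + 1) (f a b x))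
    (hJ : ∀ a b, ∀ k ≤ (l a).length, J a k b → esize b ≤ B a) :
    PolyTime fun a => (l a).foldl (f a) (i a) := by
  refine .foldl hf hi hl hB fun a l' hl' => hJ a _ l'.length hl'.length_le ?_
  have key : ∀ (l' : List γ) (k : ℕ) (b : β), l' ⊆ l a → J a k b →
      J a (k + l'.length) (l'.foldl (f a) b) := by
    intro l'
    induction l' with
    | nil => intro k b _ h; exact h
    | cons x l' ih =>
      intro k b h1 h2
      have := ih (k + 1) (f a b x) (fun y hy => h1 (by simp [hy])) (hs a k b x (h1 (by simp)) h2)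
      rwa [add_assoc, add_comm 1] at this
  simpa using key l' 0 (i a) hl'.subset (h0 a)

theorem PolyTime.fst_comp {f : α → β × γ} (hf : PolyTime f) : PolyTime fun a => (f a).1 :=
  PolyTime.fst.comp hf

theorem PolyTime.snd_comp {f : α → β × γ} (hf : PolyTime f) : PolyTime fun a => (f a).2 :=
  PolyTime.snd.comp hf

theorem PolyBound.esize {f : α → β} (hf : PolyTime f) : PolyBound fun a => esize (f a) := hf.bound

attribute [fun_prop] PolyTime PolyBound
attribute [fun_prop] PolyTime.id PolyTime.const PolyTime.comp PolyTime.pair PolyTime.fst_comp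
  PolyTime.snd_comp PolyTime.ite PolyTime.add PolyTime.mul PolyTime.neg PolyTime.sub PolyTime.div
  PolyTime.mod PolyTime.lt PolyTime.not PolyTime.and PolyTime.eq_zero PolyTime.cons PolyTime.some
  PolyTime.isPair PolyTime.tail PolyTime.headD PolyTime.reverse PolyTime.map PolyTime.append
  PolyTime.filter PolyTime.all PolyTime.flatMap PolyTime.zipWith
attribute [fun_prop] PolyBound.const PolyBound.add PolyBound.mul PolyBound.esize

end CyclicModule

namespace CyclicModule

open Enc

variable {α : Type} [Enc α]

/-! ### Linear algebra over the integers modulo `d` -/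

/-- Reduction modulo a positive integer. -/
def md (d x : ℤ) : ℤ := if decide (0 < d) then x % d else 0

/-- The vector `u + c v`, reduced modulo `d`. -/
def axpy (d c : ℤ) (u v : List ℤ) : List ℤ := List.zipWith (fun a b => md d (a + c * b)) u v

/-- One step of the Euclidean algorithm on the first entries of two rows; the other entries are
reduced modulo `d`. -/
def euclidStep (d : ℤ) (s : List ℤ × List ℤ) : List ℤ × List ℤ :=
  if decide (s.2.headD 0 = 0) then s
  else (s.2, (s.1.headD 0 % s.2.headD 0) ::
    axpy d (-(s.1.headD 0 / s.2.headD 0)) s.1.tail s.2.tail)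

/-- The Euclidean algorithm on the first entries of two rows, for two steps per entry of `fuel`. -/
def euclid (fuel : List ℤ) (d : ℤ) (p v : List ℤ) : List ℤ × List ℤ :=
  fuel.foldl (fun s _ => euclidStep d (euclidStep d s)) (p, v)

/-- Elimination of the first column of the rows `S` with the pivot row `p`: the new pivot row, and
the other rows without their first entries. -/
def elimCol (fuel : List ℤ) (d : ℤ) (p : List ℤ) (S : List (List ℤ)) : List ℤ × List (List ℤ) :=
  S.foldl (fun acc v => ((euclid fuel d acc.1 v).1, (euclid fuel d acc.1 v).2.tail :: acc.2)) (p, [])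

/-- Elimination of as many columns as `zs₀` has entries; the entries of `zs` stand for the columns.
The pivot rows are collected, the last one first. -/
def sweep (fuel : List ℤ) (d : ℤ) (zs₀ zs : List ℤ) (S : List (List ℤ)) :
    List ℤ × List (List ℤ) × List (List ℤ) :=
  zs₀.foldl (fun s _ => (s.1.tail, (elimCol fuel d (d :: s.1.tail) s.2.1).2,
    (elimCol fuel d (d :: s.1.tail) s.2.1).1 :: s.2.2)) (zs, S, [])

/-- The rows of a staircase, filled up with zeros on the left. -/
def pad (out : List (List ℤ)) : List (List ℤ) :=
  out.foldl (fun acc p => p :: acc.map fun v => 0 :: v) []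

/-- The rows `S`, cut off to the length of `zs` and reduced modulo `d`. -/
def trim (d : ℤ) (zs : List ℤ) (S : List (List ℤ)) : List (List ℤ) :=
  S.map fun v => List.zipWith (fun _ x => md d x) zs v

/-- The pivot rows for the lattice spanned by `S` and the multiples of `d`, the last one first. -/
def stair (fuel : List ℤ) (d : ℤ) (zs : List ℤ) (S : List (List ℤ)) : List (List ℤ) :=
  (sweep fuel d zs zs (trim d zs S)).2.2

/-- An echelon basis of the lattice spanned by `S` and the multiples of `d`. -/
def echelon (fuel : List ℤ) (d : ℤ) (zs : List ℤ) (S : List (List ℤ)) : List (List ℤ) :=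
  pad (stair fuel d zs S)

/-- A basis of the lattice of combinations of the rows `B` for which the same combination of the
rows `F` is in the lattice spanned by `S`. -/
def restrict (fuel : List ℤ) (d : ℤ) (zk zn : List ℤ) (F B S : List (List ℤ)) : List (List ℤ) :=
  echelon fuel d zn (sweep fuel d zk (zk ++ zn)
    (trim d (zk ++ zn) (List.zipWith (fun v b => v ++ b) F B ++ S.map fun v => v ++ zn))).2.1

/-- Is the vector `w` in the lattice with the pivot rows `st`, the first one first? -/
def memb (d : ℤ) (st : List (List ℤ)) (w : List ℤ) : Bool :=
  (st.foldl (fun s p => (s.1 && decide (s.2.headD 0 % p.headD 0 = 0),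
    axpy d (-(s.2.headD 0 / p.headD 0)) s.2.tail p.tail)) (true, w)).1

/-- The identity matrix. -/
def idMat (zs : List ℤ) : List (List ℤ) :=
  zs.foldl (fun acc _ => (1 :: acc.map fun _ => 0) :: acc.map fun v => 0 :: v) []

/-- The linear combination of the rows `V` with coefficients `x`. -/
def lc (zs : List ℤ) (x : List ℤ) (V : List (List ℤ)) : List ℤ :=
  (List.zipWith (fun c v => (c, v)) x V).foldl
    (fun acc q => List.zipWith (fun a b => a + q.1 * b) acc q.2) zs

/-- The bilinear map with the table `T`, modulo `d`. -/
def act (d : ℤ) (zs : List ℤ) (T : List (List (List ℤ))) (r x : List ℤ) : List ℤ :=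
  (lc zs r (T.map fun V => (lc zs x V).map (md d))).map (md d)

/-! #### The bit lengths -/

/-- A vector with at most `L` entries, of bit length at most `s`. -/
def Small (L s : ℕ) (v : List ℤ) : Prop := v.length ≤ L ∧ ∀ x ∈ v, esize x ≤ s

theorem Small.esize_le {L s : ℕ} {v : List ℤ} (h : Small L s v) : esize v ≤ L * (s + 1) + 1 :=
  esize_list_le h.1 h.2

theorem small_self (v : List ℤ) : Small (esize v) (esize v) v :=
  ⟨length_le_esize v, fun _ hx => esize_le_of_mem hx⟩

theorem Small.mono {L s L' s' : ℕ} {v : List ℤ} (h : Small L s v) (hL : L ≤ L') (hs : s ≤ s') :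
    Small L' s' v := ⟨h.1.trans hL, fun x hx => (h.2 x hx).trans hs⟩

theorem Small.tail {L s : ℕ} {v : List ℤ} (h : Small L s v) : Small L s v.tail :=
  ⟨by simpa using h.1.trans (Nat.le_succ L), fun x hx => h.2 x (List.mem_of_mem_tail hx)⟩

theorem esize_md_le (d x : ℤ) : esize (md d x) ≤ esize d := by
  refine size_le_of_natAbs_le ?_
  unfold md
  split_ifs with h
  · have h : 0 < d := by simpa using h
    have h1 := Int.emod_lt_of_pos x h
    have h2 := Int.emod_nonneg x h.ne'
    omega
  · simp

theorem esize_emod_le {x y : ℤ} (hy : y ≠ 0) : esize (x % y) ≤ esize y := by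
  refine size_le_of_natAbs_le ?_
  have h1 := Int.emod_lt x hy
  have h2 := Int.emod_nonneg x hy
  omega

theorem length_axpy_le (d c : ℤ) (u v : List ℤ) : (axpy d c u v).length ≤ v.length := by
  simp [axpy]

theorem esize_mem_zipWith_md {γ δ : Type} (d : ℤ) (f : γ → δ → ℤ) (u : List γ) (v : List δ) :
    ∀ x ∈ List.zipWith (fun a b => md d (f a b)) u v, esize x ≤ esize d := by
  induction u generalizing v with
  | nil => simp
  | cons a u ih =>
    cases v with
    | nil => simp
    | cons b v =>
      intro x hx
      rcases List.mem_cons.1 (by simpa using hx) with rfl | hx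
      · exact esize_md_le _ _
      · exact ih v x (by simpa using hx)

theorem small_axpy {L s : ℕ} {d : ℤ} {v : List ℤ} (hd : esize d ≤ s) (hv : v.length ≤ L) (c : ℤ)
    (u : List ℤ) : Small L s (axpy d c u v) :=
  ⟨(length_axpy_le d c u v).trans hv, fun x hx => (esize_mem_zipWith_md d _ u v x hx).trans hd⟩

theorem small_euclidStep {L s : ℕ} {d : ℤ} {q : List ℤ × List ℤ} (hd : esize d ≤ s)
    (h : Small L s q.1 ∧ Small L s q.2) :
    Small L s (euclidStep d q).1 ∧ Small L s (euclidStep d q).2 := by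
  unfold euclidStep
  split_ifs with h0
  · exact h
  · obtain ⟨p, v⟩ := q
    cases v with
    | nil => simp at h0
    | cons y v =>
      have h0 : y ≠ 0 := by simpa using h0
      refine ⟨h.2, ?_, ?_⟩
      · have := length_axpy_le d (-(p.headD 0 / y)) p.tail v
        have := h.2.1
        simp only [List.length_cons, List.headD_cons, List.tail_cons] at *
        omega
      · intro x hx
        rcases List.mem_cons.1 hx with rfl | hx
        · exact (esize_emod_le h0).trans (h.2.2 _ (by simp))
        · exact (esize_mem_zipWith_md d _ _ _ x hx).trans hd

theorem small_foldl_euclidStep {L s : ℕ} {d : ℤ} (fuel : List ℤ) (hd : esize d ≤ s)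
    {q : List ℤ × List ℤ} (h : Small L s q.1 ∧ Small L s q.2) :
    Small L s (fuel.foldl (fun s _ => euclidStep d (euclidStep d s)) q).1 ∧
      Small L s (fuel.foldl (fun s _ => euclidStep d (euclidStep d s)) q).2 := by
  induction fuel generalizing q with
  | nil => exact h
  | cons _ _ ih => exact ih (small_euclidStep hd (small_euclidStep hd h))

theorem small_euclid {L s : ℕ} {d : ℤ} {p v : List ℤ} (fuel : List ℤ) (hd : esize d ≤ s)
    (hp : Small L s p) (hv : Small L s v) :
    Small L s (euclid fuel d p v).1 ∧ Small L s (euclid fuel d p v).2 :=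
  small_foldl_euclidStep fuel hd ⟨hp, hv⟩

@[fun_prop]
theorem PolyTime.md {f g : α → ℤ} (hf : PolyTime f) (hg : PolyTime g) :
    PolyTime fun a => md (f a) (g a) := by
  unfold CyclicModule.md
  fun_prop

@[fun_prop]
theorem PolyTime.axpy {d c : α → ℤ} {u v : α → List ℤ} (hd : PolyTime d) (hc : PolyTime c)
    (hu : PolyTime u) (hv : PolyTime v) : PolyTime fun a => axpy (d a) (c a) (u a) (v a) := by
  unfold CyclicModule.axpy
  fun_prop

@[fun_prop]
theorem PolyTime.euclidStep {d : α → ℤ} {s : α → List ℤ × List ℤ} (hd : PolyTime d)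
    (hs : PolyTime s) : PolyTime fun a => euclidStep (d a) (s a) := by
  unfold CyclicModule.euclidStep
  fun_prop

@[fun_prop]
theorem PolyTime.euclid {fuel : α → List ℤ} {d : α → ℤ} {p v : α → List ℤ} (hfuel : PolyTime fuel)
    (hd : PolyTime d) (hp : PolyTime p) (hv : PolyTime v) :
    PolyTime fun a => euclid (fuel a) (d a) (p a) (v a) := by
  let M : α → ℕ := fun a => esize (d a) + esize (p a) + esize (v a)
  have hM : PolyBound M := by fun_prop
  refine .foldl_of_invariant (f := fun a s _ => CyclicModule.euclidStep (d a) (CyclicModule.euclidStep (d a) s))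
    (B := fun a => (M a * (M a + 1) + 1) + (M a * (M a + 1) + 1) + 1)
    (by fun_prop) (by fun_prop) hfuel (by fun_prop)
    (fun a _ s => Small (M a) (M a) s.1 ∧ Small (M a) (M a) s.2) ?_ ?_ ?_
  · intro a
    exact ⟨(small_self _).mono (by simp [M]; omega) (by simp [M]; omega),
      (small_self _).mono (by simp [M]) (by simp [M])⟩
  · intro a k s x _ h
    have : esize (d a) ≤ M a := by simp [M]; omega
    exact small_euclidStep this (small_euclidStep this h)
  · intro a s k _ h
    exact Nat.add_le_add_right (Nat.add_le_add h.1.esize_le h.2.esize_le) 1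

/-- All rows are short vectors with short entries. -/
def SmallRows (L s : ℕ) (S : List (List ℤ)) : Prop := ∀ v ∈ S, Small L s v

theorem SmallRows.esize_le {N L s : ℕ} {S : List (List ℤ)} (h : SmallRows L s S)
    (hN : S.length ≤ N) : esize S ≤ N * (L * (s + 1) + 1 + 1) + 1 :=
  esize_list_le hN fun v hv => (h v hv).esize_le

theorem smallRows_self (S : List (List ℤ)) : SmallRows (esize S) (esize S) S := fun v hv =>
  (small_self v).mono (esize_le_of_mem hv) (esize_le_of_mem hv)

theorem SmallRows.mono {L s L' s' : ℕ} {S : List (List ℤ)} (h : SmallRows L s S) (hL : L ≤ L')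
    (hs : s ≤ s') : SmallRows L' s' S := fun v hv => (h v hv).mono hL hs

theorem SmallRows.cons {L s : ℕ} {v : List ℤ} {S : List (List ℤ)} (hv : Small L s v)
    (h : SmallRows L s S) : SmallRows L s (v :: S) := by
  intro w hw
  rcases List.mem_cons.1 hw with rfl | hw
  exacts [hv, h w hw]

theorem small_elimCol_aux {L s : ℕ} {d : ℤ} (fuel : List ℤ) (hd : esize d ≤ s)
    {S : List (List ℤ)} {acc : List ℤ × List (List ℤ)} (hS : SmallRows L s S)
    (hp : Small L s acc.1) (ha : SmallRows L s acc.2) :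
    let r := S.foldl (fun acc v => ((euclid fuel d acc.1 v).1,
      (euclid fuel d acc.1 v).2.tail :: acc.2)) acc
    Small L s r.1 ∧ SmallRows L s r.2 ∧ r.2.length = acc.2.length + S.length := by
  induction S generalizing acc with
  | nil => exact ⟨hp, ha, rfl⟩
  | cons v S ih =>
    have h := small_euclid fuel hd hp (hS v (by simp))
    have := ih (acc := ((euclid fuel d acc.1 v).1, (euclid fuel d acc.1 v).2.tail :: acc.2))
      (fun w hw => hS w (by simp [hw])) h.1 (.cons h.2.tail ha)
    refine ⟨this.1, this.2.1, this.2.2.trans ?_⟩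
    simp; omega

theorem small_elimCol {L s : ℕ} {d : ℤ} (fuel : List ℤ) (hd : esize d ≤ s)
    {S : List (List ℤ)} {p : List ℤ} (hS : SmallRows L s S) (hp : Small L s p) :
    Small L s (elimCol fuel d p S).1 ∧ SmallRows L s (elimCol fuel d p S).2 ∧
      (elimCol fuel d p S).2.length = S.length := by
  have := small_elimCol_aux fuel hd (acc := (p, [])) hS hp (by simp [SmallRows])
  refine ⟨this.1, this.2.1, this.2.2.trans ?_⟩
  simp

@[fun_prop]
theorem PolyTime.elimCol {fuel : α → List ℤ} {d : α → ℤ} {p : α → List ℤ} {S : α → List (List ℤ)}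
    (hfuel : PolyTime fuel) (hd : PolyTime d) (hp : PolyTime p) (hS : PolyTime S) :
    PolyTime fun a => elimCol (fuel a) (d a) (p a) (S a) := by
  let M : α → ℕ := fun a => esize (d a) + esize (p a) + esize (S a)
  have hM : PolyBound M := by fun_prop
  refine .foldl_of_invariant (f := fun a acc v => ((CyclicModule.euclid (fuel a) (d a) acc.1 v).1,
      (CyclicModule.euclid (fuel a) (d a) acc.1 v).2.tail :: acc.2))
    (B := fun a => (M a * (M a + 1) + 1) + (M a * (M a * (M a + 1) + 1 + 1) + 1) + 1)
    (by fun_prop) (by fun_prop) hS (by fun_prop)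
    (fun a k s => Small (M a) (M a) s.1 ∧ SmallRows (M a) (M a) s.2 ∧ s.2.length = k) ?_ ?_ ?_
  · intro a
    exact ⟨(small_self _).mono (by simp [M]; omega) (by simp [M]; omega), by simp [SmallRows], rfl⟩
  · intro a k s v hv h
    have h1 : esize (d a) ≤ M a := by simp [M]; omega
    have h2 := small_euclid (fuel a) h1 h.1
      ((smallRows_self (S a) v hv).mono (by simp [M]) (by simp [M]))
    exact ⟨h2.1, .cons h2.2.tail h.2.1, by simp [h.2.2]⟩
  · intro a s k hk h
    refine Nat.add_le_add_right (Nat.add_le_add h.1.esize_le (h.2.1.esize_le ?_)) 1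
    rw [h.2.2]
    have := length_le_esize (S a)
    simp [M]; omega

theorem small_sweepStep {L s : ℕ} {d : ℤ} (fuel : List ℤ) (hd : esize d ≤ s) (hL : 1 ≤ L)
    {q : List ℤ × List (List ℤ) × List (List ℤ)} (h1 : Small L s q.1) (h2 : SmallRows L s q.2.1)
    (h3 : SmallRows L s q.2.2) :
    Small L s q.1.tail ∧ SmallRows L s (elimCol fuel d (d :: q.1.tail) q.2.1).2 ∧
      SmallRows L s ((elimCol fuel d (d :: q.1.tail) q.2.1).1 :: q.2.2) ∧
      (elimCol fuel d (d :: q.1.tail) q.2.1).2.length = q.2.1.length := by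
  have h4 : Small L s (d :: q.1.tail) := by
    refine ⟨?_, ?_⟩
    · have := h1.1
      simp only [List.length_cons, List.length_tail]
      omega
    · intro x hx
      rcases List.mem_cons.1 hx with rfl | hx
      exacts [hd, h1.tail.2 x hx]
  have h5 := small_elimCol fuel hd h2 h4
  exact ⟨h1.tail, h5.2.1, .cons h5.1 h3, h5.2.2⟩

@[fun_prop]
theorem PolyTime.sweep {fuel : α → List ℤ} {d : α → ℤ} {zs₀ zs : α → List ℤ} {S : α → List (List ℤ)}
    (hfuel : PolyTime fuel) (hd : PolyTime d) (hzs₀ : PolyTime zs₀) (hzs : PolyTime zs)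
    (hS : PolyTime S) : PolyTime fun a => sweep (fuel a) (d a) (zs₀ a) (zs a) (S a) := by
  let M : α → ℕ := fun a => esize (d a) + esize (zs a) + esize (S a) + esize (zs₀ a) + 1
  have hM : PolyBound M := by fun_prop
  refine .foldl_of_invariant (f := fun a s _ => (s.1.tail,
      (CyclicModule.elimCol (fuel a) (d a) (d a :: s.1.tail) s.2.1).2,
      (CyclicModule.elimCol (fuel a) (d a) (d a :: s.1.tail) s.2.1).1 :: s.2.2))
    (i := fun a => (zs a, S a, [])) (B := fun a => (M a * (M a + 1) + 1) + ((M a * (M a * (M a + 1) + 1 + 1) + 1) +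
      (M a * (M a * (M a + 1) + 1 + 1) + 1) + 1) + 1)
    (by fun_prop) (by fun_prop) hzs₀ (by fun_prop)
    (fun a k s => (Small (M a) (M a) s.1 ∧ SmallRows (M a) (M a) s.2.1 ∧ SmallRows (M a) (M a) s.2.2) ∧
      s.2.1.length = (S a).length ∧ s.2.2.length = k) ?_ ?_ ?_
  · intro a
    exact ⟨⟨(small_self _).mono (by simp [M]; omega) (by simp [M]; omega),
      (smallRows_self _).mono (by simp [M]; omega) (by simp [M]; omega), by simp [SmallRows]⟩, rfl, rfl⟩
  · intro a k s v hv h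
    have h1 : esize (d a) ≤ M a := by simp [M]; omega
    have h2 := small_sweepStep (fuel a) h1 (by simp [M]) h.1.1 h.1.2.1 h.1.2.2
    exact ⟨⟨h2.1, h2.2.1, h2.2.2.1⟩, by rw [h2.2.2.2, h.2.1], by simp [h.2.2]⟩
  · intro a s k hk h
    obtain ⟨⟨h1, h2, h3⟩, h4, h5⟩ := h
    have h6 := length_le_esize (S a)
    have h7 := length_le_esize (zs₀ a)
    have h8 := h2.esize_le (N := M a) (by simp [M]; omega)
    have h9 := h3.esize_le (N := M a) (by simp [M]; omega)
    have h10 := h1.esize_le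
    exact Nat.add_le_add_right (Nat.add_le_add h10 (Nat.add_le_add_right (Nat.add_le_add h8 h9) 1)) 1

theorem small_sweep_aux {L s : ℕ} {d : ℤ} (fuel zs₀ : List ℤ) (hd : esize d ≤ s) (hL : 1 ≤ L)
    {q : List ℤ × List (List ℤ) × List (List ℤ)} (h1 : Small L s q.1) (h2 : SmallRows L s q.2.1)
    (h3 : SmallRows L s q.2.2) :
    let r := zs₀.foldl (fun s _ => (s.1.tail, (elimCol fuel d (d :: s.1.tail) s.2.1).2,
      (elimCol fuel d (d :: s.1.tail) s.2.1).1 :: s.2.2)) q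
    SmallRows L s r.2.2 ∧ r.2.2.length = q.2.2.length + zs₀.length := by
  induction zs₀ generalizing q with
  | nil => exact ⟨h3, rfl⟩
  | cons z zs₀ ih =>
    have h := small_sweepStep fuel hd hL h1 h2 h3
    have := ih (q := (_, _, _)) h.1 h.2.1 h.2.2.1
    refine ⟨this.1, this.2.trans ?_⟩
    simp; omega

@[fun_prop]
theorem PolyTime.pad {out : α → List (List ℤ)} (h : PolyTime out) : PolyTime fun a => pad (out a) := by
  let M : α → ℕ := fun a => esize (out a)
  have hM : PolyBound M := by fun_prop
  refine .foldl_of_invariant (f := fun _ acc p => p :: acc.map fun v => 0 :: v)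
    (B := fun a => M a * ((M a + M a) * (M a + 1) + 1 + 1) + 1)
    (by fun_prop) (by fun_prop) h (by fun_prop)
    (fun a k s => SmallRows (M a + k) (M a) s ∧ s.length = k) ?_ ?_ ?_
  · intro a
    simp [SmallRows]
  · intro a k s v hv h
    refine ⟨.cons ((smallRows_self (out a) v hv).mono (by simp [M]) (by simp [M])) ?_, by simp [h.2]⟩
    intro w hw
    obtain ⟨u, hu, rfl⟩ := List.mem_map.1 hw
    refine ⟨?_, ?_⟩
    · have := (h.1 u hu).1
      simp; omega
    · intro x hx
      rcases List.mem_cons.1 hx with rfl | hx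
      exacts [one_le_esize (out a), (h.1 u hu).2 x hx]
  · intro a s k hk h
    have := length_le_esize (out a)
    exact (h.1.mono (Nat.add_le_add_left (hk.trans this) _) le_rfl).esize_le
      (h.2.trans_le (hk.trans this))

theorem small_pad_aux {L s k : ℕ} (hs : 1 ≤ s) {out acc : List (List ℤ)} (h : SmallRows L s out)
    (ha : SmallRows (L + k) s acc) :
    SmallRows (L + (k + out.length)) s (out.foldl (fun acc p => p :: acc.map fun v => 0 :: v) acc) ∧
      (out.foldl (fun acc p => p :: acc.map fun v => 0 :: v) acc).length = acc.length + out.length := by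
  induction out generalizing acc k with
  | nil => exact ⟨ha, rfl⟩
  | cons p out ih =>
    have := ih (k := k + 1) (acc := p :: acc.map fun v => 0 :: v) (fun v hv => h v (by simp [hv])) ?_
    · refine ⟨this.1.mono (by simp; omega) le_rfl, this.2.trans (by simp; omega)⟩
    · refine .cons ((h p (by simp)).mono (by omega) le_rfl) ?_
      intro w hw
      obtain ⟨u, hu, rfl⟩ := List.mem_map.1 hw
      refine ⟨?_, ?_⟩
      · have := (ha u hu).1
        simp; omega
      · intro x hx
        rcases List.mem_cons.1 hx with rfl | hx
        exacts [hs, (ha u hu).2 x hx]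

theorem esize_echelon_le (fuel : List ℤ) (d : ℤ) (zs : List ℤ) (S : List (List ℤ)) :
    let M := esize zs + esize d
    esize (echelon fuel d zs S) ≤ M * ((M + M) * (M + 1) + 1 + 1) + 1 := by
  intro M
  have hl := length_le_esize zs
  have hM : 1 ≤ M := (one_le_esize zs).trans (by simp [M])
  have h1 : SmallRows M M (trim d zs S) := by
    intro v hv
    obtain ⟨v, hv, rfl⟩ := List.mem_map.1 hv
    refine ⟨?_, fun x hx => (esize_mem_zipWith_md d (fun _ x => x) zs v x hx).trans (by simp [M])⟩
    simp [M]; omega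
  have h2 := small_sweep_aux (L := M) (s := M) (d := d) (q := (zs, trim d zs S, [])) fuel zs (by simp [M]) hM
    ((small_self zs).mono (by simp [M]) (by simp [M])) h1 (by simp [SmallRows])
  have h3 := small_pad_aux (k := 0) hM (acc := []) h2.1 (by simp [SmallRows])
  refine (h3.1.mono ?_ le_rfl).esize_le (h3.2.trans_le ?_)
  · have := h2.2
    simp only [List.length_nil] at this
    simp only [this, M]
    omega
  · have := h2.2
    simp only [List.length_nil] at this
    simp only [this, List.length_nil, M]
    omega

@[fun_prop]
theorem PolyTime.trim {d : α → ℤ} {zs : α → List ℤ} {S : α → List (List ℤ)} (hd : PolyTime d)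
    (hzs : PolyTime zs) (hS : PolyTime S) : PolyTime fun a => trim (d a) (zs a) (S a) := by
  unfold CyclicModule.trim
  fun_prop

@[fun_prop]
theorem PolyTime.stair {fuel : α → List ℤ} {d : α → ℤ} {zs : α → List ℤ} {S : α → List (List ℤ)}
    (hfuel : PolyTime fuel) (hd : PolyTime d) (hzs : PolyTime zs) (hS : PolyTime S) :
    PolyTime fun a => stair (fuel a) (d a) (zs a) (S a) := by
  unfold CyclicModule.stair
  fun_prop

@[fun_prop]
theorem PolyTime.echelon {fuel : α → List ℤ} {d : α → ℤ} {zs : α → List ℤ} {S : α → List (List ℤ)}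
    (hfuel : PolyTime fuel) (hd : PolyTime d) (hzs : PolyTime zs) (hS : PolyTime S) :
    PolyTime fun a => echelon (fuel a) (d a) (zs a) (S a) := by
  unfold CyclicModule.echelon
  fun_prop

@[fun_prop]
theorem PolyTime.restrict {fuel : α → List ℤ} {d : α → ℤ} {zk zn : α → List ℤ}
    {F B S : α → List (List ℤ)} (hfuel : PolyTime fuel) (hd : PolyTime d) (hzk : PolyTime zk)
    (hzn : PolyTime zn) (hF : PolyTime F) (hB : PolyTime B) (hS : PolyTime S) :
    PolyTime fun a => restrict (fuel a) (d a) (zk a) (zn a) (F a) (B a) (S a) := by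
  unfold CyclicModule.restrict
  fun_prop

@[fun_prop]
theorem PolyTime.memb {d : α → ℤ} {st : α → List (List ℤ)} {w : α → List ℤ} (hd : PolyTime d)
    (hst : PolyTime st) (hw : PolyTime w) : PolyTime fun a => memb (d a) (st a) (w a) := by
  let M : α → ℕ := fun a => esize (d a) + esize (st a) + esize (w a)
  have hM : PolyBound M := by fun_prop
  refine .fst_comp (.foldl_of_invariant
    (f := fun a (s : Bool × List ℤ) (p : List ℤ) => (s.1 && decide (s.2.headD 0 % p.headD 0 = 0),
      CyclicModule.axpy (d a) (-(s.2.headD 0 / p.headD 0)) s.2.tail p.tail))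
    (B := fun a => 2 + (M a * (M a + 1) + 1) + 1)
    (by fun_prop) (by fun_prop) hst (by fun_prop) (fun a _ s => Small (M a) (M a) s.2) ?_ ?_ ?_)
  · intro a
    exact (small_self _).mono (by simp [M]) (by simp [M])
  · intro a k s p hp _
    refine small_axpy (by simp [M]; omega) ?_ _ _
    have := (smallRows_self (st a) p hp).tail.1
    simp only [M]; omega
  · intro a s k _ h
    have := esize_bool_le s.1
    have := h.esize_le
    rw [← Prod.mk.eta (p := s), esize_pair]
    omega

@[fun_prop]
theorem PolyTime.idMat {zs : α → List ℤ} (hzs : PolyTime zs) : PolyTime fun a => idMat (zs a) := by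
  refine .foldl_of_invariant
    (f := fun _ (acc : List (List ℤ)) _ => (1 :: acc.map fun _ => (0 : ℤ)) :: acc.map fun v => 0 :: v)
    (B := fun a => esize (zs a) * (esize (zs a) * (2 + 1) + 1 + 1) + 1)
    (by fun_prop) (by fun_prop) hzs (by fun_prop)
    (fun a k s => SmallRows k 2 s ∧ s.length = k) ?_ ?_ ?_
  · intro a
    simp [SmallRows]
  · intro a k s x _ h
    refine ⟨.cons ⟨by simp [h.2], ?_⟩ ?_, by simp [h.2]⟩
    · intro y hy
      rcases List.mem_cons.1 hy with rfl | hy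
      · decide
      · obtain ⟨_, _, rfl⟩ := List.mem_map.1 hy
        decide
    · intro w hw
      obtain ⟨u, hu, rfl⟩ := List.mem_map.1 hw
      refine ⟨by simpa using (h.1 u hu).1, ?_⟩
      intro y hy
      rcases List.mem_cons.1 hy with rfl | hy
      exacts [by decide, (h.1 u hu).2 y hy]
  · intro a s k hk h
    have := length_le_esize (zs a)
    exact (h.1.mono (hk.trans this) le_rfl).esize_le (by omega)

theorem mem_zipWith_add_mul {A B C : ℕ} {c : ℤ} (hc : c.natAbs ≤ C) {u v : List ℤ}
    (hu : ∀ x ∈ u, x.natAbs ≤ A) (hv : ∀ x ∈ v, x.natAbs ≤ B) :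
    ∀ x ∈ List.zipWith (fun a b => a + c * b) u v, x.natAbs ≤ A + C * B := by
  induction u generalizing v with
  | nil => simp
  | cons a u ih =>
    cases v with
    | nil => simp
    | cons b v =>
      intro x hx
      rcases List.mem_cons.1 (by simpa using hx) with rfl | hx
      · refine (Int.natAbs_add_le _ _).trans (Nat.add_le_add (hu a (by simp)) ?_)
        rw [Int.natAbs_mul]
        exact Nat.mul_le_mul hc (hv b (by simp))
      · exact ih (v := v) (fun y hy => hu y (by simp [hy])) (fun y hy => hv y (by simp [hy])) x hx

@[fun_prop]
theorem PolyTime.lc {zs x : α → List ℤ} {V : α → List (List ℤ)} (hzs : PolyTime zs) (hx : PolyTime x)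
    (hV : PolyTime V) : PolyTime fun a => lc (zs a) (x a) (V a) := by
  let M : α → ℕ := fun a => esize (zs a) + esize (x a) + esize (V a)
  have hM : PolyBound M := by fun_prop
  refine .foldl_of_invariant
    (f := fun _ (acc : List ℤ) (q : ℤ × List ℤ) => List.zipWith (fun a b => a + q.1 * b) acc q.2)
    (B := fun a => M a * ((M a + M a + M a + 1) + 1) + 1)
    (by fun_prop) (by fun_prop) (by fun_prop) (by fun_prop)
    (fun a k s => s.length ≤ M a ∧ ∀ z ∈ s, z.natAbs ≤ (k + 1) * (2 ^ M a * 2 ^ M a)) ?_ ?_ ?_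
  · intro a
    refine ⟨?_, ?_⟩
    · have := length_le_esize (zs a)
      simp only [M]; omega
    · intro z hz
      have h1 := (natAbs_lt_two_pow z).le
      have h2 : esize z ≤ M a := (esize_le_of_mem hz).trans (by simp only [M]; omega)
      have h3 := Nat.pow_le_pow_right (n := 2) (by simp) h2
      have h4 : 1 ≤ 2 ^ M a := Nat.one_le_two_pow
      rw [zero_add, one_mul]
      exact (h1.trans h3).trans (Nat.le_mul_of_pos_right _ h4)
  · intro a k s q hq h
    obtain ⟨c, v⟩ := q
    have hz : List.zipWith (fun c v => (c, v)) (x a) (V a) = List.zip (x a) (V a) := rfl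
    rw [hz] at hq
    have h1 := List.of_mem_zip hq
    refine ⟨?_, ?_⟩
    · simp only [List.length_zipWith]
      exact (min_le_left _ _).trans h.1
    · have hb : ∀ y : ℤ, esize y ≤ M a → y.natAbs ≤ 2 ^ M a := fun y hy =>
        (natAbs_lt_two_pow y).le.trans (Nat.pow_le_pow_right (by simp) hy)
      have h3 := mem_zipWith_add_mul (c := c) (B := 2 ^ M a) (C := 2 ^ M a)
        (hb c ((esize_le_of_mem h1.1).trans (by simp only [M]; omega))) h.2 (v := v) fun y hy =>
          hb y (((esize_le_of_mem hy).trans (esize_le_of_mem h1.2)).trans (by simp only [M]; omega))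
      intro z hz
      refine (h3 z hz).trans (le_of_eq ?_)
      ring
  · intro a s k hk h
    refine esize_list_le h.1 fun z hz => esize_le_of_lt ((h.2 z hz).trans_lt ?_)
    have h1 : k + 1 < 2 ^ (M a) := by
      refine Nat.lt_of_lt_of_le (Nat.lt_two_pow_self) (Nat.pow_le_pow_right (by simp) ?_)
      have h2 := length_le_esize (x a)
      have h3 : k ≤ (x a).length := hk.trans (by simp)
      have h4 := one_le_esize (zs a)
      simp only [M]; omega
    calc (k + 1) * (2 ^ M a * 2 ^ M a) < 2 ^ M a * (2 ^ M a * 2 ^ M a) :=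
          Nat.mul_lt_mul_of_pos_right h1 (by positivity)
      _ = _ := by rw [← pow_add, ← pow_add]; ring_nf

@[fun_prop]
theorem PolyTime.act {d : α → ℤ} {zs : α → List ℤ} {T : α → List (List (List ℤ))} {r x : α → List ℤ}
    (hd : PolyTime d) (hzs : PolyTime zs) (hT : PolyTime T) (hr : PolyTime r) (hx : PolyTime x) :
    PolyTime fun a => act (d a) (zs a) (T a) (r a) (x a) := by
  unfold CyclicModule.act
  fun_prop

end CyclicModule

namespace CyclicModule

open Enc

variable {α : Type} [Enc α]

/-! ### A multiple of the exponent -/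

/-- The dot product of two vectors. -/
def dot (u v : List ℤ) : ℤ := (lc [0] u (v.map fun b => [b])).headD 0

/-- The Gram matrix of the columns of `A`. -/
def gram (zs : List ℤ) (A : List (List ℤ)) : List (List ℤ) :=
  (idMat zs).map fun e => lc zs (A.map fun r => dot e r) A

/-- The trace of a matrix. -/
def traceOf (zs : List ℤ) (X : List (List ℤ)) : ℤ :=
  dot (List.zipWith (fun e x => dot e x) (idMat zs) X) (zs.map fun _ => 1)

/-- The traces of the powers of `G`, the last one first. -/
def powerTraces (zs : List ℤ) (G : List (List ℤ)) : List (List ℤ) × List ℤ :=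
  zs.foldl (fun s _ => (s.1.map fun x => lc zs x G, traceOf zs s.1 :: s.2)) (G, [])

/-- The coefficients of the characteristic polynomial from the traces of the powers, by Newton's
identities. -/
def newton (ps : List ℤ) : ℤ × List ℤ :=
  ps.foldl (fun s _ => (s.1 + 1, (-dot ps s.2) / s.1 :: s.2)) (1, [1])

/-- The absolute value of the determinant of the Gram matrix. -/
def gramDet (zs : List ℤ) (A : List (List ℤ)) : ℤ :=
  let c := (newton (powerTraces zs (gram zs A)).2.reverse).2.headD 0
  if decide (0 < c) then c else -c

theorem lc_bound {Z A B : ℕ} {zs x : List ℤ} {V : List (List ℤ)} (hz : ∀ z ∈ zs, z.natAbs ≤ Z)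
    (hx : ∀ c ∈ x, c.natAbs ≤ A) (hV : ∀ v ∈ V, ∀ y ∈ v, y.natAbs ≤ B) :
    (lc zs x V).length ≤ zs.length ∧ ∀ z ∈ lc zs x V, z.natAbs ≤ Z + x.length * (A * B) := by
  unfold lc
  induction x generalizing V zs Z with
  | nil => simpa using hz
  | cons c x ih =>
    cases V with
    | nil => exact ⟨le_rfl, fun z h => (hz z h).trans (Nat.le_add_right _ _)⟩
    | cons v V =>
      have := ih (zs := List.zipWith (fun a b => a + c * b) zs v) (V := V)
        (mem_zipWith_add_mul (hx c (by simp)) hz (hV v (by simp))) (fun y hy => hx y (by simp [hy]))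
        (fun y hy => hV y (by simp [hy]))
      refine ⟨this.1.trans (by simp), fun z h => (this.2 z h).trans ?_⟩
      rw [List.length_cons]
      exact le_of_eq (by ring)

theorem natAbs_dot_le {A B : ℕ} {u v : List ℤ} (hu : ∀ c ∈ u, c.natAbs ≤ A)
    (hv : ∀ c ∈ v, c.natAbs ≤ B) : (dot u v).natAbs ≤ u.length * (A * B) := by
  have h := (lc_bound (Z := 0) (zs := [0]) (V := v.map fun b => [b]) (by simp) hu (B := B) (by
    intro w hw y hy
    obtain ⟨b, hb, rfl⟩ := List.mem_map.1 hw
    simp only [List.mem_singleton] at hy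
    exact hy ▸ hv b hb)).2
  unfold dot
  cases hl : lc [0] u (v.map fun b => [b]) with
  | nil => simp
  | cons c l =>
    have := h c (by simp [hl])
    simpa using this

@[fun_prop]
theorem PolyTime.dot {u v : α → List ℤ} (hu : PolyTime u) (hv : PolyTime v) :
    PolyTime fun a => dot (u a) (v a) := by
  unfold CyclicModule.dot
  fun_prop

@[fun_prop]
theorem PolyTime.gram {zs : α → List ℤ} {A : α → List (List ℤ)} (hzs : PolyTime zs)
    (hA : PolyTime A) : PolyTime fun a => gram (zs a) (A a) := by
  unfold CyclicModule.gram
  fun_prop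

@[fun_prop]
theorem PolyTime.traceOf {zs : α → List ℤ} {X : α → List (List ℤ)} (hzs : PolyTime zs)
    (hX : PolyTime X) : PolyTime fun a => traceOf (zs a) (X a) := by
  unfold CyclicModule.traceOf
  fun_prop

theorem esize_le_of_natAbs_le {x : ℤ} {k : ℕ} (h : x.natAbs ≤ 2 ^ k) : esize x ≤ k + 2 :=
  esize_le_of_lt (h.trans_lt (Nat.pow_lt_pow_right (by simp) (Nat.lt_succ_self _)))

theorem natAbs_le_two_pow {x : ℤ} {M : ℕ} (h : esize x ≤ M) : x.natAbs ≤ 2 ^ M :=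
  (natAbs_lt_two_pow x).le.trans (Nat.pow_le_pow_right (by simp) h)

theorem idMat_bound (zs : List ℤ) : (idMat zs).length = zs.length ∧
    ∀ v ∈ idMat zs, v.length = zs.length ∧ ∀ x ∈ v, x.natAbs ≤ 1 := by
  have key : ∀ (zs : List ℤ) (acc : List (List ℤ)) (k : ℕ), acc.length = k →
      (∀ v ∈ acc, v.length = k ∧ ∀ x ∈ v, x.natAbs ≤ 1) →
      let r := zs.foldl (fun (acc : List (List ℤ)) _ =>
        (1 :: acc.map fun _ => (0 : ℤ)) :: acc.map fun v => 0 :: v) acc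
      r.length = k + zs.length ∧ ∀ v ∈ r, v.length = k + zs.length ∧ ∀ x ∈ v, x.natAbs ≤ 1 := by
    intro zs
    induction zs with
    | nil => intro acc k h1 h2; exact ⟨h1, h2⟩
    | cons z zs ih =>
      intro acc k h1 h2
      have := ih ((1 :: acc.map fun _ => (0 : ℤ)) :: acc.map fun v => 0 :: v) (k + 1) (by simp [h1]) ?_
      · simpa [add_assoc, add_comm 1] using this
      · intro v hv
        rcases List.mem_cons.1 hv with rfl | hv
        · refine ⟨by simp [h1], fun x hx => ?_⟩
          rcases List.mem_cons.1 hx with rfl | hx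
          · simp
          · obtain ⟨_, _, rfl⟩ := List.mem_map.1 hx
            simp
        · obtain ⟨u, hu, rfl⟩ := List.mem_map.1 hv
          refine ⟨by simp [(h2 u hu).1], fun x hx => ?_⟩
          rcases List.mem_cons.1 hx with rfl | hx
          exacts [by simp, (h2 u hu).2 x hx]
  simpa [idMat] using key zs [] 0 rfl (by simp)

theorem traceOf_bound {zs : List ℤ} {X : List (List ℤ)} {E : ℕ}
    (h : ∀ v ∈ X, ∀ x ∈ v, x.natAbs ≤ E) :
    (traceOf zs X).natAbs ≤ zs.length * (zs.length * E) := by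
  have h1 : ∀ c ∈ List.zipWith (fun e x => dot e x) (idMat zs) X, c.natAbs ≤ zs.length * E := by
    intro c hc
    rw [← List.map_uncurry_zip_eq_zipWith] at hc
    obtain ⟨⟨e, x⟩, hq, rfl⟩ := List.mem_map.1 hc
    have hq := List.of_mem_zip hq
    have h2 := (idMat_bound zs).2 e hq.1
    have := natAbs_dot_le h2.2 (h x hq.2)
    rw [h2.1, one_mul] at this
    exact this
  refine (natAbs_dot_le (B := 1) h1 (by simp)).trans ?_
  rw [mul_one]
  refine Nat.mul_le_mul_right _ ?_
  rw [List.length_zipWith, (idMat_bound zs).1]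
  exact min_le_left _ _

@[fun_prop]
theorem PolyTime.powerTraces {zs : α → List ℤ} {G : α → List (List ℤ)} (hzs : PolyTime zs)
    (hG : PolyTime G) : PolyTime fun a => powerTraces (zs a) (G a) := by
  let M : α → ℕ := fun a => esize (zs a) + esize (G a)
  have hM : PolyBound M := by fun_prop
  refine .foldl_of_invariant
    (f := fun a (s : List (List ℤ) × List ℤ) _ => (s.1.map fun x => CyclicModule.lc (zs a) x (G a),
      CyclicModule.traceOf (zs a) s.1 :: s.2))
    (i := fun a => (G a, []))
    (B := fun a => (M a * (M a * (M a * (3 * M a + 3) + 2 + 1) + 1 + 1) + 1) +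
      (M a * (M a * (3 * M a + 3) + 2 + 1) + 1) + 1)
    (by fun_prop) (by fun_prop) hzs (by fun_prop)
    (fun a k s => (s.1.length ≤ M a ∧ ∀ v ∈ s.1, v.length ≤ M a ∧ ∀ x ∈ v, x.natAbs ≤ 2 ^ (M a * (3 * k + 1)))
      ∧ s.2.length = k ∧ ∀ x ∈ s.2, x.natAbs ≤ 2 ^ (M a * (3 * k + 3))) ?_ ?_ ?_
  · intro a
    refine ⟨⟨?_, fun v hv => ⟨?_, fun x hx => ?_⟩⟩, rfl, by simp⟩
    · have := length_le_esize (G a)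
      simp only [M]; omega
    · have := (smallRows_self (G a) v hv).1
      simp only [M]; omega
    · have := (smallRows_self (G a) v hv).2 x hx
      simpa using natAbs_le_two_pow (this.trans (Nat.le_add_left _ (esize (zs a))))
  · intro a k s z hz h
    obtain ⟨⟨h1, h2⟩, h3, h4⟩ := h
    have hzM : (zs a).length ≤ M a := (length_le_esize _).trans (by simp [M])
    have hM2 : M a ≤ 2 ^ M a := Nat.lt_two_pow_self.le
    have h1M : 1 ≤ 2 ^ M a := Nat.one_le_two_pow
    have hpos : 1 ≤ M a := (one_le_esize (zs a)).trans (by simp [M])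
    refine ⟨⟨by simpa using h1, ?_⟩, by simp [h3], ?_⟩
    · intro w hw
      obtain ⟨v, hv, rfl⟩ := List.mem_map.1 hw
      have h5 := lc_bound (zs := zs a) (x := v) (V := G a) (Z := 2 ^ M a)
        (fun z hz => natAbs_le_two_pow ((esize_le_of_mem hz).trans (by simp [M]))) (h2 v hv).2
        (B := 2 ^ M a) (fun u hu y hy => natAbs_le_two_pow
          (((esize_le_of_mem hy).trans (esize_le_of_mem hu)).trans (by simp [M])))
      refine ⟨h5.1.trans hzM, fun x hx => (h5.2 x hx).trans ?_⟩
      have h6 : v.length ≤ 2 ^ M a := (h2 v hv).1.trans hM2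
      have h2M : 2 ≤ 2 ^ M a := by
        calc 2 = 2 ^ 1 := rfl
          _ ≤ _ := Nat.pow_le_pow_right (by simp) hpos
      calc 2 ^ M a + v.length * (2 ^ (M a * (3 * k + 1)) * 2 ^ M a)
          ≤ 2 ^ M a * (2 ^ (M a * (3 * k + 1)) * 2 ^ M a) + 2 ^ M a * (2 ^ (M a * (3 * k + 1)) * 2 ^ M a) := by
            refine Nat.add_le_add (Nat.le_mul_of_pos_right _ (by positivity)) (Nat.mul_le_mul_right _ h6)
        _ = 2 * (2 ^ M a * (2 ^ (M a * (3 * k + 1)) * 2 ^ M a)) := by ring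
        _ ≤ 2 ^ M a * (2 ^ M a * (2 ^ (M a * (3 * k + 1)) * 2 ^ M a)) := Nat.mul_le_mul_right _ h2M
        _ = 2 ^ (M a * (3 * (k + 1) + 1)) := by rw [← pow_add, ← pow_add, ← pow_add]; ring_nf
    · intro x hx
      rcases List.mem_cons.1 hx with rfl | hx
      · refine (traceOf_bound fun v hv => (h2 v hv).2).trans ?_
        have h6 : (zs a).length ≤ 2 ^ M a := hzM.trans hM2
        calc (zs a).length * ((zs a).length * 2 ^ (M a * (3 * k + 1)))
            ≤ 2 ^ M a * (2 ^ M a * 2 ^ (M a * (3 * k + 1))) := by gcongr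
          _ = 2 ^ (M a * (3 * k + 3)) := by rw [← pow_add, ← pow_add]; ring_nf
          _ ≤ _ := Nat.pow_le_pow_right (by simp) (Nat.mul_le_mul_left _ (by omega))
      · exact (h4 x hx).trans (Nat.pow_le_pow_right (by simp) (Nat.mul_le_mul_left _ (by omega)))
  · intro a s k hk h
    obtain ⟨⟨h1, h2⟩, h3, h4⟩ := h
    have hkM : k ≤ M a := (hk.trans (length_le_esize _)).trans (by simp [M])
    have h5 : ∀ (e : ℕ) (x : ℤ), e ≤ 3 * k + 3 → x.natAbs ≤ 2 ^ (M a * e) →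
        esize x ≤ M a * (3 * M a + 3) + 2 := by
      intro e x he hx
      exact (esize_le_of_natAbs_le hx).trans (Nat.add_le_add_right (Nat.mul_le_mul_left _ (by omega)) 2)
    rw [← Prod.mk.eta (p := s), esize_pair]
    refine Nat.add_le_add_right (Nat.add_le_add (esize_list_le h1 fun v hv => esize_list_le (h2 v hv).1
      fun x hx => h5 _ x (by omega) ((h2 v hv).2 x hx))
      (esize_list_le (h3.trans_le hkM) fun x hx => h5 _ x le_rfl (h4 x hx))) 1

@[fun_prop]
theorem PolyTime.newton {ps : α → List ℤ} (hps : PolyTime ps) :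
    PolyTime fun a => newton (ps a) := by
  let M : α → ℕ := fun a => esize (ps a) + 1
  have hM : PolyBound M := by fun_prop
  refine .foldl_of_invariant
    (f := fun a (s : ℤ × List ℤ) _ => (s.1 + 1, (-CyclicModule.dot (ps a) s.2) / s.1 :: s.2))
    (i := fun _ => (1, [1]))
    (B := fun a => (M a + 2) + (M a * (M a * (2 * M a) + 2 + 1) + 1) + 1)
    (by fun_prop) (by fun_prop) hps (by fun_prop)
    (fun a k s => s.1.natAbs ≤ k + 1 ∧ s.2.length = k + 1 ∧ ∀ x ∈ s.2, x.natAbs ≤ 2 ^ (M a * (2 * k)))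
    ?_ ?_ ?_
  · intro a
    simp
  · intro a k s z hz h
    obtain ⟨h1, h2, h3⟩ := h
    refine ⟨(Int.natAbs_add_le _ _).trans (by simpa using h1), by simp [h2], ?_⟩
    intro x hx
    rcases List.mem_cons.1 hx with rfl | hx
    · refine (Int.natAbs_ediv_le_natAbs _ _).trans ?_
      rw [Int.natAbs_neg]
      have h4 : (ps a).length ≤ 2 ^ M a := (length_le_esize _).trans
        ((Nat.le_succ _).trans Nat.lt_two_pow_self.le)
      refine (natAbs_dot_le (A := 2 ^ M a) (fun c hc => natAbs_le_two_pow
        ((esize_le_of_mem hc).trans (Nat.le_succ _))) h3).trans ?_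
      calc (ps a).length * (2 ^ M a * 2 ^ (M a * (2 * k)))
          ≤ 2 ^ M a * (2 ^ M a * 2 ^ (M a * (2 * k))) := Nat.mul_le_mul_right _ h4
        _ = _ := by rw [← pow_add, ← pow_add]; ring_nf
    · exact (h3 x hx).trans (Nat.pow_le_pow_right (by simp) (Nat.mul_le_mul_left _ (by omega)))
  · intro a s k hk h
    obtain ⟨h1, h2, h3⟩ := h
    have hkM : k + 1 ≤ M a := Nat.succ_le_succ (hk.trans (length_le_esize _))
    rw [← Prod.mk.eta (p := s), esize_pair]
    refine Nat.add_le_add_right (Nat.add_le_add ?_ (esize_list_le (h2.trans_le hkM) fun x hx => ?_)) 1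
    · exact esize_le_of_natAbs_le (h1.trans (hkM.trans Nat.lt_two_pow_self.le))
    · exact (esize_le_of_natAbs_le (h3 x hx)).trans
        (Nat.add_le_add_right (Nat.mul_le_mul_left _ (by omega)) 2)

@[fun_prop]
theorem PolyTime.gramDet {zs : α → List ℤ} {A : α → List (List ℤ)} (hzs : PolyTime zs)
    (hA : PolyTime A) : PolyTime fun a => gramDet (zs a) (A a) := by
  unfold CyclicModule.gramDet
  fun_prop

/-- A list with one entry for every binary digit of `z`. -/
def bits (z : ℤ) : List ℤ :=
  ((fun s : ℤ × List ℤ => (s.1 / 2, 0 :: s.2))^[z.toNat.size] (z, [])).2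

theorem iterate_halve (k : ℕ) (z : ℤ) (l : List ℤ) :
    (fun s : ℤ × List ℤ => (s.1 / 2, 0 :: s.2))^[k] (z, l) = (z / 2 ^ k, List.replicate k 0 ++ l) := by
  induction k generalizing z l with
  | zero => simp
  | succ k ih =>
    rw [Function.iterate_succ, Function.comp, ih, Int.ediv_ediv_of_nonneg (by norm_num), pow_succ']
    simp [List.replicate_succ']

@[simp]
theorem length_bits (z : ℤ) : (bits z).length = z.toNat.size := by
  simp [bits, iterate_halve]

@[fun_prop]
theorem PolyTime.bits {z : α → ℤ} (hz : PolyTime z) : PolyTime fun a => bits (z a) := by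
  refine .snd_comp (.loop (g := fun a => (z a, [])) (c := fun s => decide (0 < s.1))
    (f := fun s : ℤ × List ℤ => (s.1 / 2, 0 :: s.2)) (n := fun a => (z a).toNat.size)
    (B := fun a => esize (z a) + (esize (z a) * (1 + 1) + 1) + 1) (by fun_prop) (by fun_prop) (by fun_prop)
    ?_ (by fun_prop) ?_ ?_ ?_)
  · refine PolyBound.mono (b' := fun a => esize (z a)) (by fun_prop) fun a => ?_
    have : (z a).toNat ≤ (z a).natAbs := by omega
    exact (Nat.size_le_size this).trans (Nat.le_succ _)
  · intro a
    rw [iterate_halve]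
    have h := Nat.lt_size_self (z a).toNat
    have h1 : (z a) < 2 ^ (z a).toNat.size := by
      have : ((z a).toNat : ℤ) < 2 ^ (z a).toNat.size := by exact_mod_cast h
      omega
    simp only [decide_eq_false_iff_not, not_lt]
    exact Int.lt_add_one_iff.1 (Int.ediv_lt_of_lt_mul (by positivity) (by simpa using h1))
  · intro a j hj
    rw [iterate_halve]
    have h := Nat.lt_size.1 hj
    have h1 : (2 : ℤ) ^ j ≤ z a := by
      have h2 : 0 < 2 ^ j := by positivity
      have : ((2 ^ j : ℕ) : ℤ) ≤ (z a) := by omega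
      simpa using this
    simp only [decide_eq_true_eq]
    exact Int.le_of_lt_add_one (by
      have := (Int.le_ediv_iff_mul_le (a := 1) (by positivity : (0 : ℤ) < 2 ^ j)).2 (by simpa using h1)
      omega)
  · intro a j hj
    rw [iterate_halve, esize_pair]
    refine Nat.add_le_add_right (Nat.add_le_add (size_le_of_natAbs_le (Int.natAbs_ediv_le_natAbs _ _))
      (esize_list_le ?_ ?_)) 1
    · have : (z a).toNat ≤ (z a).natAbs := by omega
      have := Nat.size_le_size this
      simp [esize_int]; omega
    · intro x hx
      simp at hx
      rw [hx.2]
      exact le_rfl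

end CyclicModule

namespace CyclicModule

open Enc

variable {α : Type} [Enc α]

/-! ### The program -/

/-- All products of the rows of `A` with the rows of `B`. -/
def products (d : ℤ) (zs : List ℤ) (T : List (List (List ℤ))) (A B : List (List ℤ)) :
    List (List ℤ) :=
  A.flatMap fun a => B.map fun b => act d zs T a b

/-- Is the vector `w` in the lattice spanned by `S` and the multiples of `d`? -/
def inLattice (fuel : List ℤ) (d : ℤ) (zs : List ℤ) (S : List (List ℤ)) (w : List ℤ) : Bool :=
  memb d (stair fuel d zs S).reverse w

/-- The elements `r` of the lattice `B` with `r L` in the lattice `S`. -/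
def colon (fuel : List ℤ) (d : ℤ) (zk zn : List ℤ) (T : List (List (List ℤ)))
    (S B L : List (List ℤ)) : List (List ℤ) :=
  L.foldl (fun B a => restrict fuel d zk zn (B.map fun r => act d zk T r a) B S) B

/-- Generators of `J M`, together with the relations, from generators of `J`. -/
def mulTop (d : ℤ) (zm : List ℤ) (U : List (List (List ℤ))) (relM J : List (List ℤ)) :
    List (List ℤ) :=
  relM ++ products d zm U J (idMat zm)

/-- States in coordinates. -/
abbrev RawState := List (List ℤ) × List ℤ × List (List ℤ)

/-- The first generator of `N` that is not in the lattice `Q`. -/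
def pickRow (fuel : List ℤ) (d : ℤ) (zm : List ℤ) (Q N : List (List ℤ)) : List ℤ :=
  (N.filter fun w => !inLattice fuel d zm Q w).headD zm

/-- The end of a round, with the element `x` and its annihilator `a`. -/
def finishRound (fuel : List ℤ) (d : ℤ) (zn zm : List ℤ) (T U : List (List (List ℤ)))
    (relM : List (List ℤ)) (s : RawState) (x : List ℤ) (a : List (List ℤ)) :
    (Bool × Option (List ℤ)) × RawState :=
  if (colon fuel d zn zn T s.1 a a).all (inLattice fuel d zn s.1) then
    if (idMat zm).all (inLattice fuel d zm
        (mulTop d zm U relM a ++ products d zm U (idMat zn) [x])) then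
      ((false, none), (colon fuel d zn zn T s.1 (idMat zn) a, axpy d 1 x s.2.1,
        echelon fuel d zm (relM ++ products d zm U a s.2.2)))
    else ((true, none), s)
  else ((false, none), (colon fuel d zn zn T s.1 a a, s.2))

/-- One round: has the algorithm stopped, with which answer, and what is the new state? -/
def round (fuel : List ℤ) (d : ℤ) (zn zm : List ℤ) (T U : List (List (List ℤ)))
    (relM : List (List ℤ)) (s : RawState) : (Bool × Option (List ℤ)) × RawState :=
  if (idMat zm).all (inLattice fuel d zm (mulTop d zm U relM s.1)) then ((true, some s.2.1), s)
  else finishRound fuel d zn zm T U relM s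
    (pickRow fuel d zm (mulTop d zm U relM s.1) s.2.2)
    (colon fuel d zm zn U (mulTop d zm U relM s.1) (idMat zn)
      [pickRow fuel d zm (mulTop d zm U relM s.1) s.2.2])

/-- The rounds of the algorithm, at most one for each entry of `clock`. The states are collected,
the last one first. -/
def rounds (fuel : List ℤ) (d : ℤ) (zn zm : List ℤ) (T U : List (List (List ℤ)))
    (relM : List (List ℤ)) (clock : List ℤ) (s₀ : RawState) :
    Bool × Option (List ℤ) × List RawState :=
  clock.foldl (fun acc _ =>
    if acc.1 then acc
    else if (round fuel d zn zm T U relM (acc.2.2.headD s₀)).1.1 then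
      (true, (round fuel d zn zm T U relM (acc.2.2.headD s₀)).1.2, acc.2.2)
    else (false, none, (round fuel d zn zm T U relM (acc.2.2.headD s₀)).2 :: acc.2.2))
    (false, none, [s₀])

/-- The input in coordinates. -/
abbrev RawInput := (ℤ × List (List ℤ) × List (List (List ℤ))) ×
  (ℤ × List (List ℤ) × List (List (List ℤ)))

/-- As many zeros as `R` has generators. -/
def zerosR (P : RawInput) : List ℤ := P.1.2.2.map fun _ => 0

/-- As many zeros as `M` has generators. -/
def zerosM (P : RawInput) : List ℤ := (P.2.2.1.headD []).map fun _ => 0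

/-- The modulus. -/
def modulus (P : RawInput) : ℤ := gramDet (zerosR P) P.1.2.1

/-- The initial state. -/
def startState (P : RawInput) : RawState :=
  (echelon (bits (modulus P)) (modulus P) (zerosR P) P.1.2.1, zerosM P, idMat (zerosM P))

/-- All rounds. -/
def allRounds (P : RawInput) : Bool × Option (List ℤ) × List RawState :=
  rounds (bits (modulus P)) (modulus P) (zerosR P) (zerosM P) P.1.2.2 P.2.2.2 P.2.2.1
    (0 :: (zerosR P).flatMap fun _ => bits (modulus P)) (startState P)

/-- The whole computation. -/
def compute (P : RawInput) : Option (List ℤ) × List RawState :=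
  ((allRounds P).2.1, (allRounds P).2.2.reverse)

@[fun_prop]
theorem PolyTime.products {d : α → ℤ} {zs : α → List ℤ} {T : α → List (List (List ℤ))}
    {A B : α → List (List ℤ)} (hd : PolyTime d) (hzs : PolyTime zs) (hT : PolyTime T)
    (hA : PolyTime A) (hB : PolyTime B) :
    PolyTime fun a => products (d a) (zs a) (T a) (A a) (B a) := by
  unfold CyclicModule.products
  fun_prop

@[fun_prop]
theorem PolyTime.inLattice {fuel : α → List ℤ} {d : α → ℤ} {zs : α → List ℤ}
    {S : α → List (List ℤ)} {w : α → List ℤ} (hfuel : PolyTime fuel) (hd : PolyTime d)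
    (hzs : PolyTime zs) (hS : PolyTime S) (hw : PolyTime w) :
    PolyTime fun a => inLattice (fuel a) (d a) (zs a) (S a) (w a) := by
  unfold CyclicModule.inLattice
  fun_prop

/-- A bound for the bit length of an echelon basis. -/
def echelonBound (d : ℤ) (zs : List ℤ) : ℕ :=
  (esize zs + esize d) * ((esize zs + esize d + (esize zs + esize d)) *
    (esize zs + esize d + 1) + 1 + 1) + 1

@[fun_prop]
theorem PolyBound.echelonBound {d : α → ℤ} {zs : α → List ℤ} (hd : PolyTime d)
    (hzs : PolyTime zs) : PolyBound fun a => echelonBound (d a) (zs a) := by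
  unfold CyclicModule.echelonBound
  fun_prop

theorem esize_restrict_le (fuel : List ℤ) (d : ℤ) (zk zn : List ℤ) (F B S : List (List ℤ)) :
    esize (restrict fuel d zk zn F B S) ≤ echelonBound d zn :=
  esize_echelon_le _ _ _ _

theorem esize_colon_le (fuel : List ℤ) (d : ℤ) (zk zn : List ℤ) (T : List (List (List ℤ)))
    (S B L : List (List ℤ)) :
    esize (colon fuel d zk zn T S B L) ≤ esize B + echelonBound d zn := by
  unfold colon
  cases L using List.reverseRecOn with
  | nil => simp
  | append_singleton L a =>
    rw [List.foldl_append]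
    exact (esize_restrict_le _ _ _ _ _ _ _).trans (Nat.le_add_left _ _)

@[fun_prop]
theorem PolyTime.colon {fuel : α → List ℤ} {d : α → ℤ} {zk zn : α → List ℤ}
    {T : α → List (List (List ℤ))} {S B L : α → List (List ℤ)} (hfuel : PolyTime fuel)
    (hd : PolyTime d) (hzk : PolyTime zk) (hzn : PolyTime zn) (hT : PolyTime T) (hS : PolyTime S)
    (hB : PolyTime B) (hL : PolyTime L) :
    PolyTime fun a => colon (fuel a) (d a) (zk a) (zn a) (T a) (S a) (B a) (L a) := by
  refine .foldl (f := fun a B r => CyclicModule.restrict (fuel a) (d a) (zk a) (zn a)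
    (B.map fun s => CyclicModule.act (d a) (zk a) (T a) s r) B (S a))
    (B := fun a => esize (B a) + CyclicModule.echelonBound (d a) (zn a))
    (by fun_prop) hB hL (by fun_prop) ?_
  intro a l' _
  exact esize_colon_le _ _ _ _ _ _ _ _

@[fun_prop]
theorem PolyTime.mulTop {d : α → ℤ} {zm : α → List ℤ} {U : α → List (List (List ℤ))}
    {relM J : α → List (List ℤ)} (hd : PolyTime d) (hzm : PolyTime zm) (hU : PolyTime U)
    (hrelM : PolyTime relM) (hJ : PolyTime J) :
    PolyTime fun a => mulTop (d a) (zm a) (U a) (relM a) (J a) := by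
  unfold CyclicModule.mulTop
  fun_prop

@[fun_prop]
theorem PolyTime.pickRow {fuel : α → List ℤ} {d : α → ℤ} {zm : α → List ℤ}
    {Q N : α → List (List ℤ)} (hfuel : PolyTime fuel) (hd : PolyTime d) (hzm : PolyTime zm)
    (hQ : PolyTime Q) (hN : PolyTime N) :
    PolyTime fun a => pickRow (fuel a) (d a) (zm a) (Q a) (N a) := by
  unfold CyclicModule.pickRow
  fun_prop

@[fun_prop]
theorem PolyTime.finishRound {fuel : α → List ℤ} {d : α → ℤ} {zn zm : α → List ℤ}
    {T U : α → List (List (List ℤ))} {relM : α → List (List ℤ)} {s : α → RawState}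
    {x : α → List ℤ} {c : α → List (List ℤ)} (hfuel : PolyTime fuel) (hd : PolyTime d)
    (hzn : PolyTime zn) (hzm : PolyTime zm) (hT : PolyTime T) (hU : PolyTime U)
    (hrelM : PolyTime relM) (hs : PolyTime s) (hx : PolyTime x) (hc : PolyTime c) :
    PolyTime fun a => finishRound (fuel a) (d a) (zn a) (zm a) (T a) (U a) (relM a) (s a) (x a)
      (c a) := by
  unfold CyclicModule.finishRound
  fun_prop

@[fun_prop]
theorem PolyTime.round {fuel : α → List ℤ} {d : α → ℤ} {zn zm : α → List ℤ}
    {T U : α → List (List (List ℤ))} {relM : α → List (List ℤ)} {s : α → RawState}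
    (hfuel : PolyTime fuel) (hd : PolyTime d) (hzn : PolyTime zn) (hzm : PolyTime zm)
    (hT : PolyTime T) (hU : PolyTime U) (hrelM : PolyTime relM) (hs : PolyTime s) :
    PolyTime fun a => round (fuel a) (d a) (zn a) (zm a) (T a) (U a) (relM a) (s a) := by
  unfold CyclicModule.round
  fun_prop

/-- A bound for the bit lengths of the components of the states. -/
def stateBound (d : ℤ) (zn zm : List ℤ) (s₀ : RawState) : ℕ := esize s₀ + (esize (idMat zn) +
  echelonBound d zn + echelonBound d zn + echelonBound d zm + (esize s₀ * (esize d + 1) + 1))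

@[fun_prop]
theorem PolyBound.stateBound {d : α → ℤ} {zn zm : α → List ℤ} {s₀ : α → RawState}
    (hd : PolyTime d) (hzn : PolyTime zn) (hzm : PolyTime zm) (hs : PolyTime s₀) :
    PolyBound fun a => stateBound (d a) (zn a) (zm a) (s₀ a) := by
  unfold CyclicModule.stateBound
  fun_prop

/-- The bounds for the states that persist from round to round. -/
def StateInv (d : ℤ) (zn zm : List ℤ) (s₀ s : RawState) : Prop :=
  esize s.1 ≤ stateBound d zn zm s₀ ∧ (s.2.1.length ≤ esize s₀ ∧
    esize s.2.1 ≤ stateBound d zn zm s₀) ∧ esize s.2.2 ≤ stateBound d zn zm s₀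

theorem StateInv.start (d : ℤ) (zn zm : List ℤ) (s₀ : RawState) : StateInv d zn zm s₀ s₀ := by
  obtain ⟨I, y, N⟩ := s₀
  have := length_le_esize y
  simp only [StateInv, stateBound, esize_pair]
  omega

theorem StateInv.round {fuel : List ℤ} {d : ℤ} {zn zm : List ℤ} {T U : List (List (List ℤ))}
    {relM : List (List ℤ)} {s₀ s : RawState} (h : StateInv d zn zm s₀ s) :
    StateInv d zn zm s₀ (round fuel d zn zm T U relM s).2 := by
  unfold CyclicModule.round
  split_ifs
  · exact h
  · have ha : ∀ x, esize (CyclicModule.colon fuel d zm zn U (CyclicModule.mulTop d zm U relM s.1)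
        (idMat zn) [x]) ≤ echelonBound d zn := fun x => esize_restrict_le _ _ _ _ _ _ _
    generalize CyclicModule.pickRow fuel d zm (CyclicModule.mulTop d zm U relM s.1) s.2.2 = x
    have ha := ha x
    generalize CyclicModule.colon fuel d zm zn U (CyclicModule.mulTop d zm U relM s.1)
      (idMat zn) [x] = a at ha ⊢
    unfold CyclicModule.finishRound
    split_ifs
    · have h1 := esize_colon_le fuel d zn zn T s.1 (idMat zn) a
      have h2 : esize (echelon fuel d zm (relM ++ CyclicModule.products d zm U a s.2.2)) ≤
        echelonBound d zm := esize_echelon_le _ _ _ _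
      have h3 : Small (esize s₀) (esize d) (axpy d 1 x s.2.1) := small_axpy le_rfl h.2.1.1 _ _
      have h4 := h3.esize_le
      refine ⟨?_, ⟨h3.1, ?_⟩, ?_⟩ <;> simp only [CyclicModule.stateBound] <;> omega
    · exact h
    · have h1 := esize_colon_le fuel d zn zn T s.1 a a
      refine ⟨?_, h.2⟩
      simp only [CyclicModule.stateBound]
      omega

theorem esize_round_answer (fuel : List ℤ) (d : ℤ) (zn zm : List ℤ) (T U : List (List (List ℤ)))
    (relM : List (List ℤ)) (s : RawState) :
    esize (round fuel d zn zm T U relM s).1.2 ≤ esize s.2.1 + 3 := by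
  unfold round
  split_ifs
  · exact (esize_some _).le
  · unfold finishRound
    split_ifs <;> exact (show esize (none : Option (List ℤ)) = 1 from esize_none).le.trans (by omega)

@[fun_prop]
theorem PolyTime.rounds {fuel : α → List ℤ} {d : α → ℤ} {zn zm : α → List ℤ}
    {T U : α → List (List (List ℤ))} {relM : α → List (List ℤ)} {clock : α → List ℤ}
    {s₀ : α → RawState} (hfuel : PolyTime fuel) (hd : PolyTime d) (hzn : PolyTime zn)
    (hzm : PolyTime zm) (hT : PolyTime T) (hU : PolyTime U) (hrelM : PolyTime relM)
    (hclock : PolyTime clock) (hs : PolyTime s₀) :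
    PolyTime fun a =>
      rounds (fuel a) (d a) (zn a) (zm a) (T a) (U a) (relM a) (clock a) (s₀ a) := by
  let W : α → ℕ := fun a => CyclicModule.stateBound (d a) (zn a) (zm a) (s₀ a)
  have hW : PolyBound W := by fun_prop
  refine .foldl_of_invariant
    (f := fun a (acc : Bool × Option (List ℤ) × List RawState) _ =>
      if acc.1 then acc
      else if (CyclicModule.round (fuel a) (d a) (zn a) (zm a) (T a) (U a) (relM a)
          (acc.2.2.headD (s₀ a))).1.1 then
        (true, (CyclicModule.round (fuel a) (d a) (zn a) (zm a) (T a) (U a) (relM a)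
          (acc.2.2.headD (s₀ a))).1.2, acc.2.2)
      else (false, none, (CyclicModule.round (fuel a) (d a) (zn a) (zm a) (T a) (U a) (relM a)
          (acc.2.2.headD (s₀ a))).2 :: acc.2.2))
    (i := fun a => (false, none, [s₀ a]))
    (B := fun a => 2 + ((W a + 3) + ((esize (clock a) + 1) * (W a + W a + W a + 2 + 1) + 1) + 1) + 1)
    (by fun_prop) (by fun_prop) hclock (by fun_prop)
    (fun a k acc => esize acc.2.1 ≤ W a + 3 ∧
      (∀ s ∈ acc.2.2, StateInv (d a) (zn a) (zm a) (s₀ a) s) ∧ acc.2.2.length ≤ k + 1) ?_ ?_ ?_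
  · intro a
    exact ⟨(esize_none (α := List ℤ)).le.trans (by omega), by simpa using StateInv.start _ _ _ _, by simp⟩
  · intro a k acc z _ h
    obtain ⟨h1, h2, h3⟩ := h
    have h4 : StateInv (d a) (zn a) (zm a) (s₀ a) (acc.2.2.headD (s₀ a)) := by
      cases h : acc.2.2 with
      | nil => exact .start _ _ _ _
      | cons s l => exact h2 s (by simp [h])
    split_ifs
    · exact ⟨h1, h2, h3.trans (Nat.le_succ _)⟩
    · refine ⟨(esize_round_answer _ _ _ _ _ _ _ _).trans (Nat.add_le_add_right h4.2.1.2 3), h2,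
        h3.trans (Nat.le_succ _)⟩
    · refine ⟨(esize_none (α := List ℤ)).le.trans (by omega), ?_, by simpa using h3⟩
      intro s hs
      rcases List.mem_cons.1 hs with rfl | hs
      exacts [h4.round, h2 s hs]
  · intro a acc k hk h
    obtain ⟨h1, h2, h3⟩ := h
    have h5 : ∀ s ∈ acc.2.2, esize s ≤ W a + W a + W a + 2 := by
      rintro ⟨I, y, N⟩ hs
      have h6 := h2 _ hs
      simp only [StateInv] at h6
      simp only [esize_pair, W]
      omega
    have h6 := esize_list_le (h3.trans (Nat.add_le_add_right (hk.trans (length_le_esize _)) 1)) h5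
    have h7 := esize_bool_le acc.1
    obtain ⟨b, o, l⟩ := acc
    simp only [esize_pair] at *
    omega

@[fun_prop]
theorem PolyTime.zerosR {P : α → RawInput} (hP : PolyTime P) : PolyTime fun a => zerosR (P a) := by
  unfold CyclicModule.zerosR
  fun_prop

@[fun_prop]
theorem PolyTime.zerosM {P : α → RawInput} (hP : PolyTime P) : PolyTime fun a => zerosM (P a) := by
  unfold CyclicModule.zerosM
  fun_prop

@[fun_prop]
theorem PolyTime.modulus {P : α → RawInput} (hP : PolyTime P) :
    PolyTime fun a => modulus (P a) := by
  unfold CyclicModule.modulus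
  fun_prop

@[fun_prop]
theorem PolyTime.startState {P : α → RawInput} (hP : PolyTime P) :
    PolyTime fun a => startState (P a) := by
  unfold CyclicModule.startState
  fun_prop

@[fun_prop]
theorem PolyTime.allRounds {P : α → RawInput} (hP : PolyTime P) :
    PolyTime fun a => allRounds (P a) := by
  unfold CyclicModule.allRounds
  fun_prop

theorem PolyTime.compute : PolyTime compute := by
  unfold CyclicModule.compute
  fun_prop

end CyclicModule

namespace CyclicModule

/-! ### Correctness of the linear algebra -/

/-- A vector as a sequence. -/
def seq (v : List ℤ) : ℕ → ℤ := fun i => v.getD i 0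

/-- The lattice spanned by some vectors. -/
def gen (S : List (List ℤ)) : AddSubgroup (ℕ → ℤ) := AddSubgroup.closure (seq '' {v | v ∈ S})

/-- The sequences of multiples of `d`. -/
def dmul (d : ℤ) : AddSubgroup (ℕ → ℤ) where
  carrier := {f | ∀ i, d ∣ f i}
  add_mem' ha hb i := dvd_add (ha i) (hb i)
  zero_mem' _ := dvd_zero d
  neg_mem' ha i := (dvd_neg).2 (ha i)

/-- The lattice spanned by some vectors and the multiples of `d`. -/
def Lat (d : ℤ) (S : List (List ℤ)) : AddSubgroup (ℕ → ℤ) := gen S ⊔ dmul d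

/-- Insertion of a zero at the beginning of a sequence. -/
def emb : (ℕ → ℤ) →+ (ℕ → ℤ) where
  toFun f i := i.casesOn 0 f
  map_zero' := by ext i; cases i <;> rfl
  map_add' f g := by ext i; cases i <;> simp

@[simp] theorem emb_zero (f : ℕ → ℤ) : emb f 0 = 0 := rfl

@[simp] theorem emb_succ (f : ℕ → ℤ) (i : ℕ) : emb f (i + 1) = f i := rfl

/-- A sequence without its first element. -/
def shift : (ℕ → ℤ) →+ (ℕ → ℤ) where
  toFun f i := f (i + 1)
  map_zero' := rfl
  map_add' _ _ := rfl

@[simp] theorem shift_apply (f : ℕ → ℤ) (i : ℕ) : shift f i = f (i + 1) := rfl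

@[simp] theorem shift_emb (f : ℕ → ℤ) : shift (emb f) = f := rfl

@[simp] theorem seq_nil : seq [] = 0 := by ext i; simp [seq]

@[simp] theorem seq_cons_zero (a : ℤ) (v : List ℤ) : seq (a :: v) 0 = a := rfl

@[simp] theorem seq_cons_succ (a : ℤ) (v : List ℤ) (i : ℕ) : seq (a :: v) (i + 1) = seq v i := by
  simp [seq]

theorem seq_zero_cons (v : List ℤ) : seq (0 :: v) = emb (seq v) := by
  ext i; cases i <;> simp

theorem shift_seq (v : List ℤ) : shift (seq v) = seq v.tail := by
  cases v with
  | nil => rfl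
  | cons a v => ext i; simp

theorem seq_apply_zero (v : List ℤ) : seq v 0 = v.headD 0 := by cases v <;> simp

theorem seq_eq_zero {v : List ℤ} (h : ∀ x ∈ v, x = 0) : seq v = 0 := by
  induction v with
  | nil => simp
  | cons a v ih =>
    have := h a (by simp)
    rw [this, seq_zero_cons, ih fun x hx => h x (by simp [hx]), map_zero]

theorem gen_nil : gen [] = ⊥ := by simp [gen]

theorem gen_append (S S' : List (List ℤ)) : gen (S ++ S') = gen S ⊔ gen S' := by
  rw [gen, gen, gen, ← AddSubgroup.closure_union, ← Set.image_union]
  congr 2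
  ext v
  simp

theorem gen_singleton (v : List ℤ) : gen [v] = AddSubgroup.zmultiples (seq v) := by
  simp [gen, AddSubgroup.zmultiples_eq_closure]

theorem gen_cons (v : List ℤ) (S : List (List ℤ)) :
    gen (v :: S) = AddSubgroup.zmultiples (seq v) ⊔ gen S := by
  rw [← gen_singleton, ← gen_append]; rfl

theorem gen_map_zero_cons (S : List (List ℤ)) :
    gen (S.map fun v => 0 :: v) = (gen S).map emb := by
  induction S with
  | nil => simp [gen_nil]
  | cons v S ih =>
    rw [List.map_cons, gen_cons, gen_cons, ih, AddSubgroup.map_sup, seq_zero_cons,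
      AddMonoidHom.map_zmultiples]

theorem mem_gen {v : List ℤ} {S : List (List ℤ)} (h : v ∈ S) : seq v ∈ gen S :=
  AddSubgroup.subset_closure ⟨v, h, rfl⟩

theorem gen_le {S : List (List ℤ)} {X : AddSubgroup (ℕ → ℤ)} (h : ∀ v ∈ S, seq v ∈ X) :
    gen S ≤ X := by
  rw [gen, AddSubgroup.closure_le]
  rintro _ ⟨v, hv, rfl⟩
  exact h v hv

theorem mem_lat {v : List ℤ} {d : ℤ} {S : List (List ℤ)} (h : v ∈ S) : seq v ∈ Lat d S :=
  AddSubgroup.mem_sup_left (mem_gen h)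

theorem dmul_le_lat (d : ℤ) (S : List (List ℤ)) : dmul d ≤ Lat d S := le_sup_right

theorem lat_le {d : ℤ} {S : List (List ℤ)} {X : AddSubgroup (ℕ → ℤ)} (h : ∀ v ∈ S, seq v ∈ X)
    (hd : dmul d ≤ X) : Lat d S ≤ X := sup_le (gen_le h) hd

theorem map_emb_dmul_le (d : ℤ) : (dmul d).map emb ≤ dmul d := by
  rintro _ ⟨f, hf, rfl⟩ i
  cases i with
  | zero => exact dvd_zero d
  | succ i => exact hf i

/-- The vector has entries in the interval from `0` to `d - 1`. -/
def Red (d : ℤ) (v : List ℤ) : Prop := ∀ x ∈ v, 0 ≤ x ∧ x < d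

theorem red_md {d : ℤ} (hd : 0 < d) (x : ℤ) : 0 ≤ md d x ∧ md d x < d := by
  simp only [md, hd, decide_true, if_true]
  exact ⟨Int.emod_nonneg _ hd.ne', Int.emod_lt_of_pos _ hd⟩

theorem dvd_md_sub {d : ℤ} (hd : 0 < d) (x : ℤ) : d ∣ md d x - x := by
  simp only [md, hd, decide_true, if_true]
  exact Int.ModEq.dvd (Int.mod_modEq x d).symm

theorem red_axpy {d : ℤ} (hd : 0 < d) (c : ℤ) (u v : List ℤ) : Red d (axpy d c u v) := by
  unfold axpy
  induction u generalizing v with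
  | nil => simp [Red]
  | cons a u ih =>
    cases v with
    | nil => simp [Red]
    | cons b v =>
      intro x hx
      rcases List.mem_cons.1 (by simpa using hx) with rfl | hx
      exacts [red_md hd _, ih v x hx]

theorem length_axpy {d c : ℤ} {u v : List ℤ} (h : u.length = v.length) :
    (axpy d c u v).length = v.length := by simp [axpy, h]

theorem axpy_sub_mem {d : ℤ} (hd : 0 < d) (c : ℤ) {u v : List ℤ} (h : u.length = v.length) :
    seq (axpy d c u v) - (seq u + c • seq v) ∈ dmul d := by
  intro i
  simp only [Pi.sub_apply, Pi.add_apply, Pi.smul_apply, smul_eq_mul]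
  unfold axpy
  induction u generalizing v i with
  | nil =>
    cases v with
    | nil => simp
    | cons b v => simp at h
  | cons a u ih =>
    cases v with
    | nil => simp at h
    | cons b v =>
      cases i with
      | zero => exact dvd_md_sub hd _
      | succ i => simpa using ih (by simpa using h) i

/-! #### Elimination -/

/-- Two rows during the Euclidean algorithm. -/
structure EuclidPair (d : ℤ) (K : ℕ) (q : List ℤ × List ℤ) : Prop where
  len1 : q.1.length = K + 1
  len2 : q.2.length = K + 1
  pos : 0 < q.1.headD 0
  nonneg : 0 ≤ q.2.headD 0
  red : Red d q.2.tail

/-- The lattice spanned by two rows and the multiples of `d` in the columns after the first. -/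
def pairLat (d : ℤ) (q : List ℤ × List ℤ) : AddSubgroup (ℕ → ℤ) :=
  AddSubgroup.zmultiples (seq q.1) ⊔ AddSubgroup.zmultiples (seq q.2) ⊔ (dmul d).map emb

theorem EuclidPair.step {d : ℤ} (hd : 0 < d) {K : ℕ} {q : List ℤ × List ℤ} (h : EuclidPair d K q) :
    EuclidPair d K (euclidStep d q) ∧ pairLat d (euclidStep d q) = pairLat d q := by
  unfold euclidStep
  split_ifs with h0
  · exact ⟨h, rfl⟩
  · obtain ⟨p, v⟩ := q
    obtain ⟨l1, l2, hp, hv, hr⟩ := h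
    cases p with
    | nil => simp at l1
    | cons a p =>
    cases v with
    | nil => simp at l2
    | cons b v =>
      replace h0 : b ≠ 0 := by simpa using h0
      simp only [List.headD_cons, List.tail_cons, List.length_cons, Nat.add_right_cancel_iff] at *
      have hb : 0 < b := lt_of_le_of_ne hv (Ne.symm h0)
      have hl : p.length = v.length := l1.trans l2.symm
      refine ⟨⟨by simpa using l2, by simpa [length_axpy hl] using l2, hb, Int.emod_nonneg _ h0,
        red_axpy hd _ _ _⟩, ?_⟩
      set r : List ℤ := (a % b) :: axpy d (-(a / b)) p v with hrdef
      have key : seq r - (seq (a :: p) - (a / b) • seq (b :: v)) ∈ (dmul d).map emb := by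
        refine ⟨seq (axpy d (-(a / b)) p v) - (seq p + (-(a / b)) • seq v), axpy_sub_mem hd _ hl, ?_⟩
        ext i
        cases i with
        | zero =>
          simp [hrdef, Int.emod_def]
          ring
        | succ i => simp [hrdef, sub_eq_add_neg]
      unfold pairLat
      refine le_antisymm (sup_le (sup_le ?_ ?_) le_sup_right) (sup_le (sup_le ?_ ?_) le_sup_right)
      · exact le_sup_right.trans le_sup_left
      · rw [AddSubgroup.zmultiples_le]
        have h1 : seq (a :: p) - (a / b) • seq (b :: v) ∈
            AddSubgroup.zmultiples (seq (a :: p)) ⊔ AddSubgroup.zmultiples (seq (b :: v)) ⊔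
              (dmul d).map emb := by
          refine AddSubgroup.mem_sup_left (sub_mem ?_ ?_)
          · exact AddSubgroup.mem_sup_left (AddSubgroup.mem_zmultiples _)
          · exact AddSubgroup.mem_sup_right (zsmul_mem (AddSubgroup.mem_zmultiples _) _)
        simpa using add_mem (AddSubgroup.mem_sup_right key) h1
      · rw [AddSubgroup.zmultiples_le]
        have h1 : seq r + (a / b) • seq (b :: v) ∈
            AddSubgroup.zmultiples (seq (b :: v)) ⊔ AddSubgroup.zmultiples (seq r) ⊔
              (dmul d).map emb := by
          refine AddSubgroup.mem_sup_left (add_mem ?_ ?_)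
          · exact AddSubgroup.mem_sup_right (AddSubgroup.mem_zmultiples _)
          · exact AddSubgroup.mem_sup_left (zsmul_mem (AddSubgroup.mem_zmultiples _) _)
        have h2 := sub_mem h1 (AddSubgroup.mem_sup_right key)
        convert h2 using 1
        abel
      · exact le_sup_left.trans le_sup_left

theorem headD_euclidStep (d : ℤ) (p v : List ℤ) (h : v.headD 0 ≠ 0) :
    (euclidStep d (p, v)).1 = v ∧ (euclidStep d (p, v)).2.headD 0 = p.headD 0 % v.headD 0 := by
  rw [euclidStep, if_neg (by simpa using h)]
  exact ⟨rfl, rfl⟩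

theorem euclidStep_of_eq_zero (d : ℤ) (q : List ℤ × List ℤ) (h : q.2.headD 0 = 0) :
    euclidStep d q = q := by
  rw [euclidStep, if_pos (by simpa using h)]

theorem EuclidPair.halve {d : ℤ} {K : ℕ} {q : List ℤ × List ℤ} (h : EuclidPair d K q) {k : ℕ}
    (hk : q.2.headD 0 < 2 ^ (k + 1)) :
    (euclidStep d (euclidStep d q)).2.headD 0 < 2 ^ k := by
  have hpos : (0 : ℤ) < 2 ^ k := by positivity
  by_cases h0 : q.2.headD 0 = 0
  · rw [euclidStep_of_eq_zero d q h0, euclidStep_of_eq_zero d q h0, h0]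
    exact hpos
  · have h1 := headD_euclidStep d q.1 q.2 h0
    change (euclidStep d q).1 = q.2 ∧ (euclidStep d q).2.headD 0 = _ at h1
    by_cases h2 : (euclidStep d q).2.headD 0 = 0
    · rw [euclidStep_of_eq_zero d _ h2, h2]
      exact hpos
    · have h3 := headD_euclidStep d (euclidStep d q).1 (euclidStep d q).2 h2
      have h4 : (euclidStep d (euclidStep d q)).2.headD 0 = _ := h3.2
      rw [h4, h1.1, h1.2]
      have hb : 0 < q.2.headD 0 := lt_of_le_of_ne h.nonneg (Ne.symm h0)
      have h5 := Int.emod_nonneg (q.1.headD 0) h0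
      have h6 := Int.emod_lt_of_pos (q.1.headD 0) hb
      have h7 : q.1.headD 0 % q.2.headD 0 ≠ 0 := h1.2 ▸ h2
      generalize q.1.headD 0 % q.2.headD 0 = r at *
      generalize q.2.headD 0 = b at *
      have hr : 0 < r := lt_of_le_of_ne h5 (Ne.symm h7)
      have h8 := Int.emod_lt_of_pos b hr
      have h9 : 1 ≤ b / r := (Int.le_ediv_iff_mul_le hr).2 (by omega)
      have h10 := Int.emod_add_mul_ediv b r
      have h11 : r ≤ r * (b / r) := le_mul_of_one_le_right h5 h9
      rw [pow_succ] at hk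
      omega

theorem EuclidPair.euclid {d : ℤ} (hd : 0 < d) {K : ℕ} (fuel : List ℤ) {p v : List ℤ}
    (h : EuclidPair d K (p, v)) (hf : v.headD 0 < 2 ^ fuel.length) :
    EuclidPair d K (euclid fuel d p v) ∧ pairLat d (euclid fuel d p v) = pairLat d (p, v) ∧
      (euclid fuel d p v).2.headD 0 = 0 := by
  unfold CyclicModule.euclid
  generalize hq : (p, v) = q at h
  replace hf : q.2.headD 0 < 2 ^ fuel.length := by rw [← hq]; exact hf
  clear hq
  induction fuel generalizing q with
  | nil =>
    refine ⟨h, rfl, le_antisymm ?_ h.nonneg⟩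
    simpa using Int.lt_add_one_iff.1 (by simpa using hf : q.2.headD 0 < 0 + 1)
  | cons z fuel ih =>
    have h1 := h.step hd
    have h2 := h1.1.step hd
    have h3 := ih _ h2.1 (h.halve hf)
    exact ⟨h3.1, h3.2.1.trans (h2.2.trans h1.2), h3.2.2⟩

theorem seq_of_headD_eq_zero {v : List ℤ} (h : v.headD 0 = 0) : seq v = emb (seq v.tail) := by
  cases v with
  | nil => simp
  | cons a v => simp at h; rw [h, seq_zero_cons]; rfl

theorem elimCol_aux {d : ℤ} (hd : 0 < d) {K : ℕ} {fuel : List ℤ} (hf : d ≤ 2 ^ fuel.length)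
    {S : List (List ℤ)} (hS : ∀ v ∈ S, v.length = K + 1 ∧ Red d v)
    {acc : List ℤ × List (List ℤ)} (hp : acc.1.length = K + 1) (hp0 : 0 < acc.1.headD 0)
    (ha : ∀ v ∈ acc.2, v.length = K ∧ Red d v) :
    let r := S.foldl (fun acc v => ((euclid fuel d acc.1 v).1,
      (euclid fuel d acc.1 v).2.tail :: acc.2)) acc
    r.1.length = K + 1 ∧ 0 < r.1.headD 0 ∧ (∀ v ∈ r.2, v.length = K ∧ Red d v) ∧
      AddSubgroup.zmultiples (seq r.1) ⊔ (Lat d r.2).map emb =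
        AddSubgroup.zmultiples (seq acc.1) ⊔ (Lat d acc.2).map emb ⊔ gen S := by
  induction S generalizing acc with
  | nil =>
    refine ⟨hp, hp0, ha, ?_⟩
    simp [gen_nil]
  | cons v S ih =>
    have hv := hS v (by simp)
    have hr0 : 0 ≤ v.headD 0 ∧ v.headD 0 < d := by
      cases v with
      | nil => simp at hv
      | cons a v => exact hv.2 a (by simp)
    have h := EuclidPair.euclid (K := K) hd fuel (p := acc.1) (v := v)
      ⟨hp, hv.1, hp0, hr0.1, fun x hx => hv.2 x (List.mem_of_mem_tail hx)⟩ (hr0.2.trans_le hf)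
    obtain ⟨h1, h2, h3⟩ := h
    have := ih (acc := ((euclid fuel d acc.1 v).1, (euclid fuel d acc.1 v).2.tail :: acc.2))
      (fun w hw => hS w (by simp [hw])) h1.len1 h1.pos (by
        intro w hw
        rcases List.mem_cons.1 hw with rfl | hw
        · exact ⟨by simp [h1.len2], h1.red⟩
        · exact ha w hw)
    refine ⟨this.1, this.2.1, this.2.2.1, this.2.2.2.trans ?_⟩
    rw [gen_cons, Lat, gen_cons, Lat]
    simp only [AddSubgroup.map_sup]
    rw [AddMonoidHom.map_zmultiples, ← seq_of_headD_eq_zero h3]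
    have e : ∀ a b c x y z g : AddSubgroup (ℕ → ℤ), a ⊔ b ⊔ c = x ⊔ y ⊔ c →
        a ⊔ (b ⊔ z ⊔ c) ⊔ g = x ⊔ (z ⊔ c) ⊔ (y ⊔ g) := by
      intro a b c x y z g h
      calc a ⊔ (b ⊔ z ⊔ c) ⊔ g = (a ⊔ b ⊔ c) ⊔ (z ⊔ g) := by ac_rfl
        _ = x ⊔ (z ⊔ c) ⊔ (y ⊔ g) := by rw [h]; ac_rfl
    exact e _ _ _ _ _ _ _ h2

theorem zmultiples_sup_map_emb_dmul (d : ℤ) {zs : List ℤ} (hz : ∀ z ∈ zs, z = 0) :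
    AddSubgroup.zmultiples (seq (d :: zs)) ⊔ (dmul d).map emb = dmul d := by
  refine le_antisymm (sup_le ?_ (map_emb_dmul_le d)) ?_
  · rw [AddSubgroup.zmultiples_le]
    intro i
    cases i with
    | zero => simp
    | succ i => simp [seq_eq_zero hz]
  · intro f hf
    obtain ⟨c, hc⟩ := hf 0
    have : f = c • seq (d :: zs) + emb (shift f) := by
      ext i
      cases i with
      | zero => simp [hc, mul_comm]
      | succ i => simp [seq_eq_zero hz]
    rw [this]
    exact add_mem (AddSubgroup.mem_sup_left (zsmul_mem (AddSubgroup.mem_zmultiples _) _))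
      (AddSubgroup.mem_sup_right ⟨_, fun i => hf (i + 1), rfl⟩)

theorem elimCol_spec {d : ℤ} (hd : 0 < d) {fuel zs : List ℤ} (hf : d ≤ 2 ^ fuel.length)
    (hz : ∀ z ∈ zs, z = 0) {S : List (List ℤ)} (hS : ∀ v ∈ S, v.length = zs.length + 1 ∧ Red d v) :
    let r := elimCol fuel d (d :: zs) S
    r.1.length = zs.length + 1 ∧ 0 < r.1.headD 0 ∧ (∀ v ∈ r.2, v.length = zs.length ∧ Red d v) ∧
      AddSubgroup.zmultiples (seq r.1) ⊔ (Lat d r.2).map emb = Lat d S := by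
  have h := elimCol_aux hd hf hS (acc := (d :: zs, [])) (by simp) (by simpa using hd) (by simp)
  refine ⟨h.1, h.2.1, h.2.2.1, h.2.2.2.trans ?_⟩
  rw [Lat, gen_nil, bot_sup_eq, zmultiples_sup_map_emb_dmul d hz, Lat, sup_comm]

/-- The rows `ps` are the pivot rows of the lattice `X`, where the elements of `X` that vanish in the
pivot columns are those of `Y`, and there are `r` further columns. -/
def IsStair (d : ℤ) (r : ℕ) (Y : AddSubgroup (ℕ → ℤ)) :
    List (List ℤ) → AddSubgroup (ℕ → ℤ) → Prop
  | [], X => X = Y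
  | p :: ps, X => p.length = ps.length + 1 + r ∧ 0 < p.headD 0 ∧ ∃ X', dmul d ≤ X' ∧
      X = AddSubgroup.zmultiples (seq p) ⊔ X'.map emb ∧ IsStair d r Y ps X'

theorem sweep_aux {d : ℤ} (hd : 0 < d) {fuel : List ℤ} (hf : d ≤ 2 ^ fuel.length) (r : ℕ)
    (zs₀ : List ℤ) {q : List ℤ × List (List ℤ) × List (List ℤ)}
    (hq : q.1.length = zs₀.length + r) (hz : ∀ z ∈ q.1, z = 0)
    (hS : ∀ v ∈ q.2.1, v.length = q.1.length ∧ Red d v) :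
    let t := zs₀.foldl (fun s _ => (s.1.tail, (elimCol fuel d (d :: s.1.tail) s.2.1).2,
      (elimCol fuel d (d :: s.1.tail) s.2.1).1 :: s.2.2)) q
    (∀ v ∈ t.2.1, v.length = r ∧ Red d v) ∧ ∃ ps, t.2.2 = ps.reverse ++ q.2.2 ∧
      ps.length = zs₀.length ∧ IsStair d r (Lat d t.2.1) ps (Lat d q.2.1) := by
  induction zs₀ generalizing q with
  | nil =>
    refine ⟨fun v hv => ?_, [], rfl, rfl, rfl⟩
    have := hS v hv
    rw [hq] at this
    simpa using this
  | cons z zs₀ ih =>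
    obtain ⟨zs, S, out⟩ := q
    rw [List.length_cons] at hq
    change zs.length = _ at hq
    have hlen : zs.tail.length = zs₀.length + r := by rw [List.length_tail]; omega
    have h := elimCol_spec hd (zs := zs.tail) hf (fun z hz' => hz z (List.mem_of_mem_tail hz'))
      (S := S) (fun v hv => ⟨by rw [(hS v hv).1, hlen]; change zs.length = _; omega, (hS v hv).2⟩)
    obtain ⟨h1, h2, h3, h4⟩ := h
    have := ih (q := (zs.tail, (elimCol fuel d (d :: zs.tail) S).2,
      (elimCol fuel d (d :: zs.tail) S).1 :: out)) hlen
      (fun z hz' => hz z (List.mem_of_mem_tail hz')) h3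
    obtain ⟨h5, ps, h6, h7, h8⟩ := this
    refine ⟨h5, (elimCol fuel d (d :: zs.tail) S).1 :: ps, ?_, by simp [h7], ?_⟩
    · refine h6.trans ?_
      simp
    · exact ⟨by rw [h1, hlen, h7]; omega, h2, _, dmul_le_lat _ _, h4.symm, h8⟩

theorem sweep_spec {d : ℤ} (hd : 0 < d) {fuel : List ℤ} (hf : d ≤ 2 ^ fuel.length) {r : ℕ}
    {zs₀ zs : List ℤ} (hl : zs.length = zs₀.length + r) (hz : ∀ z ∈ zs, z = 0) {S : List (List ℤ)}
    (hS : ∀ v ∈ S, v.length = zs.length ∧ Red d v) :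
    (∀ v ∈ (sweep fuel d zs₀ zs S).2.1, v.length = r ∧ Red d v) ∧
      ∃ ps, (sweep fuel d zs₀ zs S).2.2 = ps.reverse ∧ ps.length = zs₀.length ∧
        IsStair d r (Lat d (sweep fuel d zs₀ zs S).2.1) ps (Lat d S) := by
  have := sweep_aux hd hf r zs₀ (q := (zs, S, [])) hl hz hS
  simpa [sweep] using this

theorem trim_spec {d : ℤ} (hd : 0 < d) {zs : List ℤ} {S : List (List ℤ)}
    (hS : ∀ v ∈ S, v.length = zs.length) :
    (∀ v ∈ trim d zs S, v.length = zs.length ∧ Red d v) ∧ Lat d (trim d zs S) = Lat d S := by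
  have key : ∀ (zs v : List ℤ), v.length = zs.length →
      Red d (List.zipWith (fun _ x => md d x) zs v) ∧
      seq (List.zipWith (fun _ x => md d x) zs v) - seq v ∈ dmul d := by
    intro zs
    induction zs with
    | nil =>
      intro v hv
      rw [List.length_nil, List.length_eq_zero_iff] at hv
      simp [hv, Red, zero_mem]
    | cons z zs ih =>
      intro v hv
      cases v with
      | nil => simp at hv
      | cons a v =>
        have h := ih v (by simpa using hv)
        refine ⟨?_, ?_⟩
        · intro x hx
          rcases List.mem_cons.1 (by simpa using hx) with rfl | hx
          exacts [red_md hd _, h.1 x hx]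
        · intro i
          cases i with
          | zero => exact dvd_md_sub hd _
          | succ i => simpa using h.2 i
  refine ⟨?_, le_antisymm (lat_le ?_ (dmul_le_lat _ _)) (lat_le ?_ (dmul_le_lat _ _))⟩
  · intro w hw
    obtain ⟨v, hv, rfl⟩ := List.mem_map.1 hw
    exact ⟨by simp [hS v hv], (key zs v (hS v hv)).1⟩
  · intro w hw
    obtain ⟨v, hv, rfl⟩ := List.mem_map.1 hw
    simpa using add_mem (dmul_le_lat d S (key zs v (hS v hv)).2) (mem_lat hv)
  · intro v hv
    have h1 : seq (List.zipWith (fun _ x => md d x) zs v) ∈ Lat d (trim d zs S) :=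
      mem_lat (List.mem_map.2 ⟨v, hv, rfl⟩)
    simpa using sub_mem h1 (dmul_le_lat d (trim d zs S) (key zs v (hS v hv)).2)

theorem lat_eq_dmul {d : ℤ} {S : List (List ℤ)} (h : ∀ v ∈ S, v.length = 0) : Lat d S = dmul d :=
  le_antisymm (lat_le (fun v hv => by
    rw [List.length_eq_zero_iff.1 (h v hv), seq_nil]; exact zero_mem _) le_rfl) (dmul_le_lat _ _)

theorem stair_spec {d : ℤ} (hd : 0 < d) {fuel : List ℤ} (hf : d ≤ 2 ^ fuel.length)
    {zs : List ℤ} (hz : ∀ z ∈ zs, z = 0) {S : List (List ℤ)} (hS : ∀ v ∈ S, v.length = zs.length) :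
    ∃ ps, stair fuel d zs S = ps.reverse ∧ ps.length = zs.length ∧
      IsStair d 0 (dmul d) ps (Lat d S) := by
  have h := trim_spec hd hS
  obtain ⟨h1, ps, h2, h3, h4⟩ := sweep_spec hd hf (zs₀ := zs) (r := 0) rfl hz h.1
  rw [h.2, lat_eq_dmul fun v hv => (h1 v hv).1] at h4
  exact ⟨ps, h2, h3, h4⟩

theorem IsStair.pad {d : ℤ} {r : ℕ} {ps : List (List ℤ)} {X : AddSubgroup (ℕ → ℤ)}
    (h : IsStair d r (dmul d) ps X) (hX : dmul d ≤ X) :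
    (∀ v ∈ pad ps.reverse, v.length = ps.length + r) ∧ Lat d (pad ps.reverse) = X := by
  induction ps generalizing X with
  | nil => exact ⟨by simp [CyclicModule.pad], by rw [h]; simp [CyclicModule.pad, Lat, gen_nil]⟩
  | cons p ps ih =>
    obtain ⟨h1, h2, X', h3, h4, h5⟩ := h
    have h6 := ih h5 h3
    have h7 : CyclicModule.pad (p :: ps).reverse =
        p :: (CyclicModule.pad ps.reverse).map fun v => 0 :: v := by
      simp [CyclicModule.pad]
    rw [h7]
    refine ⟨?_, ?_⟩
    · intro v hv
      rcases List.mem_cons.1 hv with rfl | hv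
      · rw [h1, List.length_cons]
      · obtain ⟨w, hw, rfl⟩ := List.mem_map.1 hv
        rw [List.length_cons, List.length_cons, h6.1 w hw]
        omega
    · refine le_antisymm (sup_le ?_ hX) ?_
      · rw [gen_cons, gen_map_zero_cons, h4, ← h6.2]
        exact sup_le_sup_left (AddSubgroup.map_mono le_sup_left) _
      · rw [h4, Lat, gen_cons, gen_map_zero_cons, ← h6.2, Lat, AddSubgroup.map_sup, sup_assoc]
        exact sup_le_sup_left (sup_le_sup_left (map_emb_dmul_le d) _) _

theorem echelon_spec {d : ℤ} (hd : 0 < d) {fuel : List ℤ} (hf : d ≤ 2 ^ fuel.length)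
    {zs : List ℤ} (hz : ∀ z ∈ zs, z = 0) {S : List (List ℤ)} (hS : ∀ v ∈ S, v.length = zs.length) :
    (∀ v ∈ echelon fuel d zs S, v.length = zs.length) ∧ Lat d (echelon fuel d zs S) = Lat d S := by
  obtain ⟨ps, h1, h2, h3⟩ := stair_spec hd hf hz hS
  have := h3.pad (dmul_le_lat d S)
  rwa [← h1, h2, add_zero] at this

theorem mem_zmultiples_sup_map_emb {p : List ℤ} {X : AddSubgroup (ℕ → ℤ)} {f : ℕ → ℤ} :
    f ∈ AddSubgroup.zmultiples (seq p) ⊔ X.map emb ↔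
      ∃ q : ℤ, f 0 = q * p.headD 0 ∧ shift f - q • seq p.tail ∈ X := by
  rw [AddSubgroup.mem_sup]
  constructor
  · rintro ⟨_, ⟨q, rfl⟩, _, ⟨x, hx, rfl⟩, rfl⟩
    refine ⟨q, by simp [seq_apply_zero], ?_⟩
    rw [map_add, map_zsmul, shift_seq, shift_emb]
    simpa using hx
  · rintro ⟨q, h1, h2⟩
    refine ⟨q • seq p, ⟨q, rfl⟩, _, ⟨_, h2, rfl⟩, ?_⟩
    ext i
    cases i with
    | zero => simp [h1, seq_apply_zero]
    | succ i => simp [← shift_seq]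

theorem memb_aux {d : ℤ} (hd : 0 < d) {ps : List (List ℤ)} {X : AddSubgroup (ℕ → ℤ)}
    (h : IsStair d 0 (dmul d) ps X) (b : Bool) {w : List ℤ} (hw : w.length = ps.length) :
    (ps.foldl (fun s p => (s.1 && decide (s.2.headD 0 % p.headD 0 = 0),
      axpy d (-(s.2.headD 0 / p.headD 0)) s.2.tail p.tail)) (b, w)).1 = true ↔
      b = true ∧ seq w ∈ X := by
  induction ps generalizing X b w with
  | nil =>
    rw [List.length_nil, List.length_eq_zero_iff] at hw
    simp [hw, zero_mem]
  | cons p ps ih =>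
    obtain ⟨h1, h2, X', h3, h4, h5⟩ := h
    have hl : w.tail.length = p.tail.length := by simp [h1, hw]
    rw [List.foldl_cons, ih h5 _ (by rw [length_axpy hl]; simp [h1]), h4, mem_zmultiples_sup_map_emb,
      Bool.and_eq_true, and_assoc, decide_eq_true_eq]
    refine and_congr_right fun _ => ?_
    have h6 := h3 (axpy_sub_mem hd (-(w.headD 0 / p.headD 0)) hl)
    constructor
    · rintro ⟨h7, h8⟩
      refine ⟨w.headD 0 / p.headD 0, ?_, ?_⟩
      · rw [seq_apply_zero, Int.ediv_mul_cancel (Int.dvd_of_emod_eq_zero h7)]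
      · rw [shift_seq]
        have := sub_mem h8 h6
        simpa [sub_eq_add_neg] using this
    · rintro ⟨q, h7, h8⟩
      rw [seq_apply_zero] at h7
      refine ⟨by rw [h7]; exact Int.mul_emod_left _ _, ?_⟩
      have h9 : w.headD 0 / p.headD 0 = q := by rw [h7, Int.mul_ediv_cancel _ h2.ne']
      rw [h9] at h6 ⊢
      rw [shift_seq] at h8
      have := add_mem h6 h8
      rwa [neg_smul, ← sub_eq_add_neg, sub_add_cancel] at this

theorem inLattice_iff {d : ℤ} (hd : 0 < d) {fuel : List ℤ} (hf : d ≤ 2 ^ fuel.length)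
    {zs : List ℤ} (hz : ∀ z ∈ zs, z = 0) {S : List (List ℤ)} (hS : ∀ v ∈ S, v.length = zs.length)
    {w : List ℤ} (hw : w.length = zs.length) :
    inLattice fuel d zs S w = true ↔ seq w ∈ Lat d S := by
  obtain ⟨ps, h1, h2, h3⟩ := stair_spec hd hf hz hS
  rw [inLattice, memb, h1, List.reverse_reverse, memb_aux hd h3 _ (hw.trans h2.symm)]
  simp

/-! #### Groups given by generators and relations -/

/-- Insertion of `k` zeros at the beginning of a sequence. -/
def embN (k : ℕ) : (ℕ → ℤ) →+ (ℕ → ℤ) where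
  toFun f i := if i < k then 0 else f (i - k)
  map_zero' := by ext i; simp
  map_add' f g := by ext i; by_cases h : i < k <;> simp [h]

/-- A sequence without its first `k` elements. -/
def shiftN (k : ℕ) : (ℕ → ℤ) →+ (ℕ → ℤ) where
  toFun f i := f (i + k)
  map_zero' := rfl
  map_add' _ _ := rfl

/-- The first `k` elements of a sequence. -/
def cut (k : ℕ) : (ℕ → ℤ) →+ (ℕ → ℤ) where
  toFun f i := if i < k then f i else 0
  map_zero' := by ext i; simp
  map_add' f g := by ext i; by_cases h : i < k <;> simp [h]

theorem cut_add_embN (k : ℕ) (f : ℕ → ℤ) : cut k f + embN k (shiftN k f) = f := by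
  ext i
  by_cases h : i < k
  · simp [cut, embN, h]
  · simp only [cut, embN, shiftN, AddMonoidHom.coe_mk, ZeroHom.coe_mk, Pi.add_apply, h, if_false,
      zero_add]
    congr 1
    omega

theorem cut_embN (k : ℕ) (f : ℕ → ℤ) : cut k (embN k f) = 0 := by
  ext i
  by_cases h : i < k <;> simp [cut, embN, h]

theorem shiftN_embN (k : ℕ) (f : ℕ → ℤ) : shiftN k (embN k f) = f := by
  ext i
  simp [shiftN, embN]

theorem seq_append (u v : List ℤ) : seq (u ++ v) = seq u + embN u.length (seq v) := by
  ext i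
  by_cases h : i < u.length
  · simp [seq, embN, h, List.getElem?_append_left h]
  · have h' : u.length ≤ i := by omega
    simp [seq, embN, h, List.getElem?_append_right h']

theorem cut_seq (v : List ℤ) : cut v.length (seq v) = seq v := by
  ext i
  by_cases h : i < v.length
  · simp [cut, h]
  · simp [cut, seq, h]

theorem exists_seq_eq_cut (k : ℕ) (f : ℕ → ℤ) : ∃ v : List ℤ, v.length = k ∧ seq v = cut k f := by
  refine ⟨List.ofFn fun i : Fin k => f i, by simp, ?_⟩
  ext i
  by_cases h : i < k
  · simp [cut, seq, h]
  · simp [cut, seq, h]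

theorem cut_mem_dmul {k : ℕ} {d : ℤ} {f : ℕ → ℤ} (h : f ∈ dmul d) : cut k f ∈ dmul d := by
  intro i
  by_cases hi : i < k
  · simpa [cut, hi] using h i
  · simp [cut, hi]

theorem IsStair.embN_mem {d : ℤ} {r : ℕ} {Y : AddSubgroup (ℕ → ℤ)} {ps : List (List ℤ)}
    {X : AddSubgroup (ℕ → ℤ)} (h : IsStair d r Y ps X) (f : ℕ → ℤ) :
    embN ps.length f ∈ X ↔ f ∈ Y := by
  induction ps generalizing X with
  | nil =>
    have : X = Y := h
    rw [this]
    have : embN 0 f = f := by ext i; simp [embN]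
    simp [this]
  | cons p ps ih =>
    obtain ⟨h1, h2, X', h3, h4, h5⟩ := h
    rw [h4, mem_zmultiples_sup_map_emb, ← ih h5]
    have h6 : embN (p :: ps).length f 0 = 0 := by simp [embN]
    have h7 : shift (embN (p :: ps).length f) = embN ps.length f := by
      ext i
      simp [embN]
    rw [h6, h7]
    constructor
    · rintro ⟨q, h8, h9⟩
      rcases mul_eq_zero.1 h8.symm with rfl | h
      · simpa using h9
      · exact absurd h h2.ne'
    · intro h
      exact ⟨0, by simp, by simpa using h⟩

/-- The group `G` is given by `K` generators and the relations `rel`, and it is killed by `d`; the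
homomorphism `φ` takes coefficients to elements. -/
structure Pres (d : ℤ) (K : ℕ) {G : Type*} [AddCommGroup G] (φ : (ℕ → ℤ) →+ G)
    (rel : List (List ℤ)) : Prop where
  dmul : ∀ f ∈ dmul d, φ f = 0
  surj : ∀ x, ∃ v : List ℤ, v.length = K ∧ φ (seq v) = x
  ker : ∀ v : List ℤ, v.length = K → φ (seq v) = 0 → seq v ∈ Lat d rel
  rel : ∀ v ∈ rel, v.length = K ∧ φ (seq v) = 0

/-- The rows `S` span, together with the multiples of `d`, the preimage of `J`. -/
def Rep (d : ℤ) (K : ℕ) {G : Type*} [AddCommGroup G] (φ : (ℕ → ℤ) →+ G) (S : List (List ℤ))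
    (J : AddSubgroup G) : Prop :=
  (∀ v ∈ S, v.length = K) ∧ ∀ v : List ℤ, v.length = K → (seq v ∈ Lat d S ↔ φ (seq v) ∈ J)

section Presentations

variable {d : ℤ} {K : ℕ} {G : Type*} [AddCommGroup G] {φ : (ℕ → ℤ) →+ G} {rel : List (List ℤ)}

theorem Rep.closure_eq (hφ : Pres d K φ rel) {S : List (List ℤ)} {J : AddSubgroup G}
    (h : Rep d K φ S J) : AddSubgroup.closure ((fun v => φ (seq v)) '' {v | v ∈ S}) = J := by
  refine le_antisymm ((AddSubgroup.closure_le _).2 ?_) ?_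
  · rintro _ ⟨v, hv, rfl⟩
    exact (h.2 v (h.1 v hv)).1 (mem_lat hv)
  · intro x hx
    obtain ⟨v, hv, rfl⟩ := hφ.surj x
    have h1 := (h.2 v hv).2 hx
    have h2 : Lat d S ≤ (AddSubgroup.closure ((fun v => φ (seq v)) '' {v | v ∈ S})).comap φ := by
      refine lat_le (fun v hv => AddSubgroup.subset_closure ⟨v, hv, rfl⟩) fun f hf => ?_
      rw [AddSubgroup.mem_comap, hφ.dmul f hf]
      exact zero_mem _
    exact h2 h1

theorem Pres.rep_append (hφ : Pres d K φ rel) {S : List (List ℤ)} (hS : ∀ v ∈ S, v.length = K) :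
    Rep d K φ (rel ++ S) (AddSubgroup.closure ((fun v => φ (seq v)) '' {v | v ∈ S})) := by
  refine ⟨fun v hv => ?_, fun v hv => ⟨fun h => ?_, fun h => ?_⟩⟩
  · rcases List.mem_append.1 hv with hv | hv
    exacts [(hφ.rel v hv).1, hS v hv]
  · have h2 : Lat d (rel ++ S) ≤
        (AddSubgroup.closure ((fun v => φ (seq v)) '' {v | v ∈ S})).comap φ := by
      refine lat_le (fun v hv => ?_) fun f hf => ?_
      · rcases List.mem_append.1 hv with hv | hv
        · rw [AddSubgroup.mem_comap, (hφ.rel v hv).2]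
          exact zero_mem _
        · exact AddSubgroup.subset_closure ⟨v, hv, rfl⟩
      · rw [AddSubgroup.mem_comap, hφ.dmul f hf]
        exact zero_mem _
    exact h2 h
  · have h1 : AddSubgroup.closure ((fun v => φ (seq v)) '' {v | v ∈ S}) = (gen S).map φ := by
      rw [gen, AddMonoidHom.map_closure, Set.image_image]
    rw [h1] at h
    obtain ⟨f, hf, hfv⟩ := h
    have h2 : cut K f = f := by
      have : gen S ≤ (AddMonoidHom.id _).eqLocus (cut K) := gen_le fun v hv => by
        change seq v = cut K (seq v)
        rw [← hS v hv, cut_seq]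
      exact (this hf).symm
    obtain ⟨u, hu, hu2⟩ := exists_seq_eq_cut K (seq v - f)
    have h3 : seq u = seq v - f := by
      rw [hu2, map_sub, h2, ← hv, cut_seq]
    have h4 := hφ.ker u hu (by rw [h3, map_sub, hfv, sub_self])
    have h5 : Lat d rel ≤ Lat d (rel ++ S) := by
      rw [Lat, Lat, gen_append]
      exact sup_le_sup_right le_sup_left _
    have h6 : gen S ≤ Lat d (rel ++ S) := by
      rw [Lat, gen_append]
      exact le_sup_right.trans le_sup_left
    have := add_mem (h5 h4) (h6 hf)
    rwa [h3, sub_add_cancel] at this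

theorem Rep.echelon {S : List (List ℤ)} {J : AddSubgroup G} (h : Rep d K φ S J) (hd : 0 < d)
    {fuel zs : List ℤ} (hf : d ≤ 2 ^ fuel.length) (hz : ∀ z ∈ zs, z = 0) (hK : zs.length = K) :
    Rep d K φ (echelon fuel d zs S) J := by
  subst hK
  have := echelon_spec hd hf hz h.1
  refine ⟨this.1, ?_⟩
  rw [this.2]
  exact h.2

theorem Rep.inLattice_iff {S : List (List ℤ)} {J : AddSubgroup G} (h : Rep d K φ S J) (hd : 0 < d)
    {fuel zs : List ℤ} (hf : d ≤ 2 ^ fuel.length) (hz : ∀ z ∈ zs, z = 0) (hK : zs.length = K)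
    {w : List ℤ} (hw : w.length = K) : inLattice fuel d zs S w = true ↔ φ (seq w) ∈ J := by
  subst hK
  rw [CyclicModule.inLattice_iff hd hf hz h.1 hw, h.2 w hw]

theorem Rep.restrict {k : ℕ} {H : Type*} [AddCommGroup H] {φ' : (ℕ → ℤ) →+ H}
    {rel' : List (List ℤ)} (hφ : Pres d K φ rel) (hφ' : Pres d k φ' rel') {B S : List (List ℤ)}
    {J : AddSubgroup G} {J' : AddSubgroup H} (hB : Rep d K φ B J) (hS : Rep d k φ' S J') (hd : 0 < d)
    {fuel zk zn : List ℤ} (hf : d ≤ 2 ^ fuel.length) (hzk : ∀ z ∈ zk, z = 0) (hk : zk.length = k)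
    (hzn : ∀ z ∈ zn, z = 0) (hK : zn.length = K) (ψ : G →+ H) (F : List ℤ → List ℤ)
    (hF : ∀ b ∈ B, (F b).length = k ∧ φ' (seq (F b)) = ψ (φ (seq b))) :
    Rep d K φ (restrict fuel d zk zn (B.map F) B S) (J ⊓ J'.comap ψ) := by
  subst hk hK
  obtain ⟨rows, hrows⟩ : ∃ rows, rows = (B.map fun b => F b ++ b) ++ S.map fun v => v ++ zn :=
    ⟨_, rfl⟩
  have hzip : List.zipWith (fun v b => v ++ b) (B.map F) B = B.map fun b => F b ++ b := by
    rw [List.zipWith_map_left, List.zipWith_self]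
  have hz : ∀ z ∈ zk ++ zn, z = 0 := by
    intro z hz
    rcases List.mem_append.1 hz with h | h
    exacts [hzk z h, hzn z h]
  have hlen : ∀ v ∈ rows, v.length = (zk ++ zn).length := by
    intro v hv
    rw [hrows] at hv
    rcases List.mem_append.1 hv with h | h
    · obtain ⟨b, hb, rfl⟩ := List.mem_map.1 h
      rw [List.length_append, List.length_append, (hF b hb).1, hB.1 b hb]
    · obtain ⟨b, hb, rfl⟩ := List.mem_map.1 h
      rw [List.length_append, List.length_append, hS.1 b hb]
  have ht := trim_spec hd hlen
  obtain ⟨h1, ps, h2, h3, h4⟩ := sweep_spec hd hf (zs₀ := zk) (zs := zk ++ zn) (r := zn.length)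
    (by simp) hz ht.1
  rw [ht.2] at h4
  have h5 := echelon_spec hd hf hzn fun v hv => (h1 v hv).1
  have e : CyclicModule.restrict fuel d zk zn (B.map F) B S = CyclicModule.echelon fuel d zn
      (sweep fuel d zk (zk ++ zn) (trim d (zk ++ zn) rows)).2.1 := by
    rw [CyclicModule.restrict, hzip, hrows]
  refine ⟨by rw [e]; exact h5.1, fun v hv => ?_⟩
  rw [e, h5.2, ← h4.embN_mem, h3]
  have hpair : ∀ f ∈ Lat d rows, shiftN zk.length f ∈ Lat d B ∧
      φ' (cut zk.length f) - ψ (φ (shiftN zk.length f)) ∈ J' := by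
    have h6 : Lat d rows ≤ (Lat d B).comap (shiftN zk.length) ⊓
        J'.comap (φ'.comp (cut zk.length) - ψ.comp (φ.comp (shiftN zk.length))) := by
      have happ : ∀ u b : List ℤ, u.length = zk.length →
          cut zk.length (seq (u ++ b)) = seq u ∧ shiftN zk.length (seq (u ++ b)) = seq b := by
        intro u b hu
        rw [seq_append, map_add, map_add, ← hu, cut_seq, cut_embN, shiftN_embN]
        refine ⟨add_zero _, ?_⟩
        have : shiftN u.length (seq u) = 0 := by
          ext i
          simp [shiftN, seq]
        rw [this, zero_add]
      refine lat_le (fun v hv => ?_) fun f hf => ?_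
      · rw [hrows] at hv
        rcases List.mem_append.1 hv with h | h
        · obtain ⟨b, hb, rfl⟩ := List.mem_map.1 h
          have h7 := happ (F b) b (hF b hb).1
          refine ⟨?_, ?_⟩
          · change shiftN zk.length _ ∈ Lat d B
            rw [h7.2]
            exact mem_lat hb
          · change φ' (cut zk.length _) - ψ (φ (shiftN zk.length _)) ∈ J'
            simp only [h7.1, h7.2, (hF b hb).2, sub_self]
            exact zero_mem _
        · obtain ⟨b, hb, rfl⟩ := List.mem_map.1 h
          have h7 := happ b zn (hS.1 b hb)
          refine ⟨?_, ?_⟩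
          · change shiftN zk.length _ ∈ Lat d B
            rw [h7.2, seq_eq_zero hzn]
            exact zero_mem _
          · change φ' (cut zk.length _) - ψ (φ (shiftN zk.length _)) ∈ J'
            simp only [h7.1, h7.2, seq_eq_zero hzn,
              map_zero, sub_zero]
            exact (hS.2 b (hS.1 b hb)).1 (mem_lat hb)
      · have h8 : shiftN zk.length f ∈ CyclicModule.dmul d := fun i => hf (i + zk.length)
        refine ⟨dmul_le_lat d B h8, ?_⟩
        change φ' (cut zk.length _) - ψ (φ (shiftN zk.length _)) ∈ J'
        simp only [hφ.dmul _ h8,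
          hφ'.dmul _ (cut_mem_dmul hf), map_zero, sub_zero]
        exact zero_mem _
    intro f hf
    exact ⟨(h6 hf).1, (h6 hf).2⟩
  constructor
  · intro h
    have := hpair _ h
    rw [shiftN_embN, cut_embN, map_zero, zero_sub, neg_mem_iff] at this
    exact ⟨(hB.2 v hv).1 this.1, this.2⟩
  · rintro ⟨h6, h7⟩
    have h8 : Lat d B ≤ (Lat d rows).map (shiftN zk.length) := by
      refine lat_le (fun b hb => ?_) fun f hf => ?_
      · refine ⟨_, mem_lat (v := F b ++ b) (by rw [hrows]; simp only [List.mem_append, List.mem_map]; exact .inl ⟨b, hb, rfl⟩), ?_⟩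
        rw [seq_append, map_add, (hF b hb).1, shiftN_embN]
        have : shiftN zk.length (seq (F b)) = 0 := by
          ext i
          simp [shiftN, seq, (hF b hb).1]
        rw [this, zero_add]
      · refine ⟨embN zk.length f, dmul_le_lat d _ fun i => ?_, shiftN_embN _ _⟩
        by_cases hi : i < zk.length
        · simp [embN, hi]
        · simpa [embN, hi] using hf (i - zk.length)
    obtain ⟨f, hf, hfv⟩ := h8 ((hB.2 v hv).2 h6)
    have h9 := (hpair f hf).2
    rw [hfv] at h9
    have h10 : φ' (cut zk.length f) ∈ J' := by
      have := add_mem h9 h7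
      rwa [sub_add_cancel] at this
    obtain ⟨u, hu, hu2⟩ := exists_seq_eq_cut zk.length f
    rw [← hu2] at h10
    have h11 : Lat d S ≤ Lat d rows := by
      refine lat_le (fun s hs => ?_) (dmul_le_lat d _)
      have : seq s = seq (s ++ zn) := by rw [seq_append, seq_eq_zero hzn, map_zero, add_zero]
      rw [this]
      exact mem_lat (by rw [hrows]; simp only [List.mem_append, List.mem_map]; exact .inr ⟨s, hs, rfl⟩)
    have h12 := sub_mem hf (h11 ((hS.2 u hu).2 h10))
    rw [hu2] at h12
    have h13 : f - cut zk.length f = embN zk.length (seq v) := by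
      rw [← hfv, sub_eq_iff_eq_add', cut_add_embN]
    rwa [h13] at h12

end Presentations

end CyclicModule

namespace CyclicModule

/-! ### Correctness of the matrix computations -/

/-- The rows of a matrix. -/
def ofMat {k n : ℕ} (X : Matrix (Fin k) (Fin n) ℤ) : List (List ℤ) :=
  List.ofFn fun i => List.ofFn (X i)

theorem zipWith_ofFn {β γ δ : Type*} {n : ℕ} (f : β → γ → δ) (a : Fin n → β) (b : Fin n → γ) :
    List.zipWith f (List.ofFn a) (List.ofFn b) = List.ofFn fun i => f (a i) (b i) := by
  refine List.ext_getElem (by simp) fun i h1 h2 => ?_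
  simp

theorem length_lc {zs x : List ℤ} {V : List (List ℤ)} (hV : ∀ v ∈ V, v.length = zs.length) :
    (lc zs x V).length = zs.length := by
  unfold lc
  induction x generalizing V zs with
  | nil => rfl
  | cons c x ih =>
    cases V with
    | nil => rfl
    | cons v V =>
      have hv := hV v (by simp)
      have h1 : (List.zipWith (fun a b => a + c * b) zs v).length = zs.length := by simp [hv]
      exact (ih fun w hw => (hV w (by simp [hw])).trans h1.symm).trans h1

theorem hom_lc {G : Type*} [AddCommGroup G] (φ : (ℕ → ℤ) →+ G) {zs x : List ℤ}
    {V : List (List ℤ)} (hV : ∀ v ∈ V, v.length = zs.length) :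
    φ (seq (lc zs x V)) =
      φ (seq zs) + (List.zipWith (fun (c : ℤ) v => c • φ (seq v)) x V).sum := by
  unfold lc
  induction x generalizing V zs with
  | nil => simp
  | cons c x ih =>
    cases V with
    | nil => simp
    | cons v V =>
      have hv := hV v (by simp)
      have h1 : (List.zipWith (fun a b => a + c * b) zs v).length = zs.length := by simp [hv]
      have h2 : seq (List.zipWith (fun a b => a + c * b) zs v) = seq zs + c • seq v := by
        ext i
        by_cases hi : i < zs.length
        · have hi' : i < v.length := hv ▸ hi
          simp [seq, hi, hi', h1]
        · have hi' : ¬ i < v.length := hv ▸ hi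
          simp [seq, hi, hi']
      have := ih (zs := List.zipWith (fun a b => a + c * b) zs v) (V := V)
        fun w hw => (hV w (by simp [hw])).trans h1.symm
      refine this.trans ?_
      rw [h2, map_add, map_zsmul, List.zipWith_cons_cons, List.sum_cons, add_assoc]

/-- The evaluation of sequences at an index. -/
def evalAt (i : ℕ) : (ℕ → ℤ) →+ ℤ := Pi.evalAddMonoidHom _ i

@[simp] theorem evalAt_apply (i : ℕ) (f : ℕ → ℤ) : evalAt i f = f i := rfl

theorem map_ofMat {β : Type} {k n : ℕ} (X : Matrix (Fin k) (Fin n) ℤ) (f : List ℤ → β) :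
    (ofMat X).map f = List.ofFn fun i => f (List.ofFn (X i)) := by
  rw [ofMat, List.map_ofFn]
  rfl

theorem dot_ofFn {n : ℕ} (u v : Fin n → ℤ) : dot (List.ofFn u) (List.ofFn v) = u ⬝ᵥ v := by
  have h := hom_lc (evalAt 0) (zs := [0]) (x := List.ofFn u)
    (V := (List.ofFn v).map fun b => [b]) (by simp)
  rw [List.map_ofFn, zipWith_ofFn, List.sum_ofFn] at h
  simp only [evalAt_apply, seq_apply_zero] at h
  rw [dot, List.map_ofFn, h]
  simp [dotProduct]

theorem lc_ofMat {k n : ℕ} {zs : List ℤ} (hz : ∀ z ∈ zs, z = 0) (hn : zs.length = n)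
    (x : Fin k → ℤ) (V : Matrix (Fin k) (Fin n) ℤ) :
    lc zs (List.ofFn x) (ofMat V) = List.ofFn (Matrix.vecMul x V) := by
  have hV : ∀ v ∈ ofMat V, v.length = zs.length := by
    intro v hv
    obtain ⟨i, rfl⟩ := (List.mem_ofFn' _ _).1 hv
    simp [hn]
  refine List.ext_getElem (by rw [length_lc hV]; simp [hn]) fun i h1 h2 => ?_
  have h := hom_lc (evalAt i) (x := List.ofFn x) hV
  rw [show List.zipWith (fun (c : ℤ) v => c • evalAt i (seq v)) (List.ofFn x) (ofMat V) = _ from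
    zipWith_ofFn _ _ _, List.sum_ofFn, seq_eq_zero hz, map_zero, zero_add, evalAt_apply, seq,
    List.getD_eq_getElem _ _ h1] at h
  have hi : i < n := by simpa using h2
  rw [List.getElem_ofFn]
  refine h.trans ?_
  simp [Matrix.vecMul, dotProduct, seq, hi]

theorem ofMat_one_succ (n : ℕ) : ofMat (1 : Matrix (Fin (n + 1)) (Fin (n + 1)) ℤ) =
    (1 :: (ofMat (1 : Matrix (Fin n) (Fin n) ℤ)).map fun _ => 0) ::
      (ofMat (1 : Matrix (Fin n) (Fin n) ℤ)).map fun v => 0 :: v := by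
  simp only [ofMat, List.map_ofFn]
  rw [List.ofFn_succ]
  congr 1
  · rw [List.ofFn_succ]
    congr 1
  · refine congrArg List.ofFn (funext fun i => ?_)
    rw [List.ofFn_succ, Function.comp]
    congr 1
    refine congrArg List.ofFn (funext fun j => ?_)
    simp [Matrix.one_apply]

theorem idMat_eq {n : ℕ} {zs : List ℤ} (hn : zs.length = n) :
    idMat zs = ofMat (1 : Matrix (Fin n) (Fin n) ℤ) := by
  have key : ∀ (zs : List ℤ) (k n : ℕ), zs.length + k = n →
      zs.foldl (fun acc _ => (1 :: acc.map fun _ => (0 : ℤ)) :: acc.map fun v => 0 :: v)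
        (ofMat (1 : Matrix (Fin k) (Fin k) ℤ)) = ofMat (1 : Matrix (Fin n) (Fin n) ℤ) := by
    intro zs
    induction zs with
    | nil =>
      intro k n h
      obtain rfl : k = n := by simpa using h
      rfl
    | cons z zs ih =>
      intro k n h
      rw [List.foldl_cons, ← ofMat_one_succ]
      exact ih (k + 1) n (by rw [← h, List.length_cons]; omega)
  exact key zs 0 n hn

theorem gram_ofMat {k n : ℕ} {zs : List ℤ} (hz : ∀ z ∈ zs, z = 0) (hn : zs.length = n)
    (A : Matrix (Fin k) (Fin n) ℤ) : gram zs (ofMat A) = ofMat (A.transpose * A) := by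
  rw [gram, idMat_eq hn, map_ofMat]
  refine congrArg List.ofFn (funext fun i => ?_)
  have h : (ofMat A).map (fun r => dot (List.ofFn ((1 : Matrix (Fin n) (Fin n) ℤ) i)) r) =
      List.ofFn (A.transpose i) := by
    rw [map_ofMat]
    refine congrArg List.ofFn (funext fun j => ?_)
    rw [dot_ofFn]
    simp [dotProduct, Matrix.one_apply]
  rw [h, lc_ofMat hz hn]
  rfl

theorem traceOf_ofMat {n : ℕ} {zs : List ℤ} (hn : zs.length = n) (X : Matrix (Fin n) (Fin n) ℤ) :
    traceOf zs (ofMat X) = X.trace := by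
  have h : zs.map (fun _ => (1 : ℤ)) = List.ofFn fun _ : Fin n => (1 : ℤ) := by
    subst hn
    refine List.ext_getElem (by simp) fun i h1 h2 => by simp
  rw [traceOf, idMat_eq hn, h, ofMat, ofMat, zipWith_ofFn]
  simp only [dot_ofFn]
  simp [dotProduct, Matrix.trace, Matrix.one_apply]

theorem powerTraces_ofMat {n : ℕ} {zs : List ℤ} (hz : ∀ z ∈ zs, z = 0) (hn : zs.length = n)
    (X : Matrix (Fin n) (Fin n) ℤ) :
    (powerTraces zs (ofMat X)).2.reverse = (List.range n).map fun i => (X ^ (i + 1)).trace := by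
  have key : ∀ (l : List ℤ) (j : ℕ) (out : List ℤ),
      (l.foldl (fun (s : List (List ℤ) × List ℤ) _ => (s.1.map fun x => lc zs x (ofMat X),
        traceOf zs s.1 :: s.2)) (ofMat (X ^ (j + 1)), out)).2 =
      ((List.range l.length).map fun i => (X ^ (i + j + 1)).trace).reverse ++ out := by
    intro l
    induction l with
    | nil => simp
    | cons z l ih =>
      intro j out
      have h : (ofMat (X ^ (j + 1))).map (fun x => lc zs x (ofMat X)) = ofMat (X ^ (j + 1 + 1)) := by
        rw [map_ofMat]
        refine congrArg List.ofFn (funext fun i => ?_)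
        rw [lc_ofMat hz hn, pow_succ X (j + 1)]
        rfl
      rw [List.foldl_cons, h, ih, traceOf_ofMat hn, List.length_cons, List.range_succ_eq_map,
        List.map_cons, List.map_map, List.reverse_cons, List.append_assoc]
      congr 2
      · refine List.map_congr_left fun i _ => ?_
        simp only [Function.comp]
        congr 2
        omega
      · simp
  have := key zs 0 []
  rw [zero_add, pow_one, List.append_nil] at this
  rw [powerTraces, this, List.reverse_reverse, hn]

theorem newton_eq {n : ℕ} (p c : ℕ → ℤ) (hc0 : c 0 = 1)
    (hc : ∀ k < n, ((k : ℤ) + 1) * c (k + 1) = -∑ i ∈ Finset.range (k + 1), p (i + 1) * c (k - i)) :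
    (newton ((List.range n).map fun i => p (i + 1))).2.headD 0 = c n := by
  set ps := (List.range n).map fun i => p (i + 1) with hps
  have hdot : ∀ k < n, dot ps ((List.range (k + 1)).map fun i => c (k - i)) =
      ∑ i ∈ Finset.range (k + 1), p (i + 1) * c (k - i) := by
    intro k hk
    have h := hom_lc (evalAt 0) (zs := [0]) (x := ps)
      (V := ((List.range (k + 1)).map fun i => c (k - i)).map fun b => [b]) (by simp)
    simp only [evalAt_apply, seq_apply_zero] at h
    rw [dot, h]
    have : List.zipWith (fun (x : ℤ) v => x • v.headD 0) ps
        (((List.range (k + 1)).map fun i => c (k - i)).map fun b => [b]) =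
        (List.range (k + 1)).map fun i => p (i + 1) * c (k - i) := by
      refine List.ext_getElem (by simp [hps]; omega) fun i h1 h2 => ?_
      simp [hps]
    rw [this]
    rw [Finset.sum_eq_multiset_sum, Finset.range_val, Multiset.range, Multiset.map_coe,
      Multiset.sum_coe]
    simp
  have key : ∀ (l : List ℤ) (k : ℕ), k + l.length ≤ n →
      l.foldl (fun (s : ℤ × List ℤ) _ => (s.1 + 1, (-dot ps s.2) / s.1 :: s.2))
        ((k : ℤ) + 1, (List.range (k + 1)).map fun i => c (k - i)) =
      (((k + l.length : ℕ) : ℤ) + 1,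
        (List.range (k + l.length + 1)).map fun i => c (k + l.length - i)) := by
    intro l
    induction l with
    | nil => simp
    | cons z l ih =>
      intro k hk
      rw [List.length_cons] at hk
      have h1 : (-dot ps ((List.range (k + 1)).map fun i => c (k - i))) / ((k : ℤ) + 1) = c (k + 1) := by
        rw [hdot k (by omega), ← hc k (by omega)]
        exact Int.mul_ediv_cancel_left _ (by omega)
      have h2 : c (k + 1) :: ((List.range (k + 1)).map fun i => c (k - i)) =
          (List.range (k + 1 + 1)).map fun i => c (k + 1 - i) := by
        rw [List.range_succ_eq_map (n := k + 1), List.map_cons, List.map_map]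
        congr 1
        refine List.map_congr_left fun i _ => ?_
        simp
      have := ih (k + 1) (by omega)
      simp only [List.foldl_cons, h1, h2]
      rw [List.length_cons]
      push_cast at this ⊢
      rw [this]
      simp only [Prod.mk.injEq]
      refine ⟨by ring, ?_⟩
      rw [show k + 1 + l.length = k + (l.length + 1) by omega]
  have := key ps 0 (by simp [hps])
  simp only [Nat.cast_zero, zero_add, List.range_one, List.map_cons, List.map_nil, Nat.sub_zero, hc0] at this
  rw [newton, this, List.range_succ_eq_map]
  simp [hps]

open Polynomial in
theorem charpoly_newton {n : ℕ} {G : Matrix (Fin n) (Fin n) ℤ} (hG : G.IsSymm) {k : ℕ}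
    (hk : k < n) : ((k : ℤ) + 1) * G.charpoly.coeff (n - (k + 1)) =
      -∑ i ∈ Finset.range (k + 1), (G ^ (i + 1)).trace * G.charpoly.coeff (n - (k - i)) := by
  let A : Matrix (Fin n) (Fin n) ℝ := G.map (Int.castRingHom ℝ)
  have hA : A.IsHermitian := by
    ext i j
    have := congrFun (congrFun hG i) j
    simp only [Matrix.transpose_apply] at this
    simp [A, this]
  let lam := hA.eigenvalues
  let E : ℕ → ℝ := fun j => MvPolynomial.aeval lam (MvPolynomial.esymm (Fin n) ℝ j)
  have htr : ∀ j, (((G ^ j).trace : ℤ) : ℝ) = MvPolynomial.aeval lam (MvPolynomial.psum (Fin n) ℝ j) := by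
    intro j
    have h1 : (((G ^ j).trace : ℤ) : ℝ) = (A ^ j).trace := by
      have : A ^ j = (G ^ j).map (Int.castRingHom ℝ) := by
        simp only [A, ← RingHom.mapMatrix_apply, map_pow]
      rw [this]
      simp [Matrix.trace]
    rw [h1, hA.spectral_theorem, ← map_pow, Matrix.diagonal_pow, Unitary.conjStarAlgAut_apply,
      Matrix.trace_mul_cycle, Unitary.coe_star_mul_self, one_mul, Matrix.trace_diagonal]
    simp [MvPolynomial.psum, lam]
  have hc : ∀ j ≤ n, ((G.charpoly.coeff (n - j) : ℤ) : ℝ) = (-1) ^ j * E j := by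
    intro j hj
    have h1 : ((G.charpoly.coeff (n - j) : ℤ) : ℝ) = A.charpoly.coeff (n - j) := by
      rw [Matrix.charpoly_map, Polynomial.coeff_map]
      rfl
    have h2 := Multiset.prod_X_sub_C_coeff (Finset.univ.val.map lam) (k := n - j) (by simp)
    rw [h1, hA.charpoly_eq]
    simp only [Multiset.map_map, Multiset.card_map, Finset.card_val, Finset.card_univ, Fintype.card_fin] at h2
    rw [show n - (n - j) = j by omega] at h2
    refine h2.trans ?_
    simp only [E, MvPolynomial.aeval_esymm_eq_multiset_esymm]
  have hN := congrArg (MvPolynomial.aeval lam) (MvPolynomial.mul_esymm_eq_sum (Fin n) ℝ (k + 1))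
  rw [Finset.sum_filter, Finset.Nat.sum_antidiagonal_eq_sum_range_succ_mk, Finset.sum_range_succ] at hN
  simp only [lt_self_iff_false, if_false, add_zero, map_mul, map_sum, map_natCast, map_pow, map_neg,
    map_one] at hN
  have hR : ((k : ℝ) + 1) * ((G.charpoly.coeff (n - (k + 1)) : ℤ) : ℝ) =
      -∑ i ∈ Finset.range (k + 1), (((G ^ (i + 1)).trace : ℤ) : ℝ) *
        ((G.charpoly.coeff (n - (k - i)) : ℤ) : ℝ) := by
    rw [hc (k + 1) hk, ← Finset.sum_range_reflect]
    have h1 : ((k : ℝ) + 1) * ((-1) ^ (k + 1) * E (k + 1)) =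
        (-1) ^ (k + 1) * (((k + 1 : ℕ) : ℝ) * E (k + 1)) := by push_cast; ring
    rw [h1, hN, ← mul_assoc, ← pow_add, show k + 1 + (k + 1 + 1) = 2 * (k + 1) + 1 by ring, pow_succ,
      pow_mul]
    simp only [even_two, Even.neg_pow, one_pow, one_mul, neg_mul]
    congr 1
    refine Finset.sum_congr rfl fun i hi => ?_
    have hi : i < k + 1 := Finset.mem_range.1 hi
    rw [if_pos hi, hc _ (by omega), htr]
    simp only [map_mul, map_pow, map_neg, map_one]
    rw [show k - (k + 1 - 1 - i) = i by omega, show k + 1 - 1 - i + 1 = k + 1 - i by omega]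
    ring
  exact_mod_cast hR

theorem gramDet_eq {k n : ℕ} {zs : List ℤ} (hz : ∀ z ∈ zs, z = 0) (hn : zs.length = n)
    (A : Matrix (Fin k) (Fin n) ℤ) : gramDet zs (ofMat A) = |(A.transpose * A).det| := by
  set G := A.transpose * A with hG
  have hsymm : G.IsSymm := by
    rw [Matrix.IsSymm, hG, Matrix.transpose_mul, Matrix.transpose_transpose]
  have h := newton_eq (n := n) (fun i => (G ^ i).trace) (fun k => G.charpoly.coeff (n - k))
    (by
      have := G.charpoly_monic.coeff_natDegree
      rwa [Matrix.charpoly_natDegree_eq_dim, Fintype.card_fin] at this)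
    fun k hk => charpoly_newton hsymm hk
  rw [gramDet, gram_ofMat hz hn, powerTraces_ofMat hz hn, h, Nat.sub_self]
  have h2 : |G.det| = |G.charpoly.coeff 0| := by
    rw [Matrix.det_eq_sign_charpoly_coeff, abs_mul, abs_pow, abs_neg, abs_one, one_pow, one_mul]
  rw [h2]
  simp only [decide_eq_true_eq]
  split_ifs with h3
  · exact (abs_of_pos h3).symm
  · exact (abs_of_nonpos (not_lt.1 h3)).symm

end CyclicModule

namespace CyclicModule

/-! ### Presentations -/

theorem det_gram_ne_zero {k n : ℕ} {A : Matrix (Fin k) (Fin n) ℤ}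
    (h : ∀ v : Fin n → ℤ, A.mulVec v = 0 → v = 0) : (A.transpose * A).det ≠ 0 := by
  intro h0
  obtain ⟨v, hv, hAv⟩ := Matrix.exists_mulVec_eq_zero_iff.2 h0
  refine hv (h v ?_)
  rw [← dotProduct_self_eq_zero, Matrix.dotProduct_mulVec, ← Matrix.mulVec_transpose,
    Matrix.mulVec_mulVec, hAv, zero_dotProduct]

section Relations

variable {G : Type*} [AddCommGroup G] {n : ℕ}

/-- The element with given coefficients, as a homomorphism. -/
def coef (g : Fin n → G) : (ℕ → ℤ) →+ G where
  toFun f := ∑ i : Fin n, f i • g i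
  map_zero' := by simp
  map_add' f f' := by simp [add_smul, Finset.sum_add_distrib]

theorem coef_apply (g : Fin n → G) (f : ℕ → ℤ) : coef g f = ∑ i : Fin n, f i • g i := rfl

theorem coef_seq_ofFn (g : Fin n → G) (w : Fin n → ℤ) :
    coef g (seq (List.ofFn w)) = comb g w := by
  rw [coef_apply, comb]
  refine Finset.sum_congr rfl fun i _ => ?_
  simp [seq]

theorem comb_add (g : Fin n → G) (v w : Fin n → ℤ) : comb g (v + w) = comb g v + comb g w := by
  simp [comb, add_smul, Finset.sum_add_distrib]

theorem comb_single (g : Fin n → G) (c : ℤ) (i : Fin n) : comb g (Pi.single i c) = c • g i := by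
  simp [comb, Pi.single_apply, ite_smul]

theorem exists_eq_ofFn {v : List ℤ} (h : v.length = n) : ∃ w : Fin n → ℤ, v = List.ofFn w := by
  subst h
  exact ⟨fun i => v[i], by simp⟩

/-- The relations as the rows of a matrix. -/
def relMatrix (rel : List (Fin n → ℤ)) : Matrix (Fin rel.length) (Fin n) ℤ := fun i => rel[i]

theorem ofMat_relMatrix (rel : List (Fin n → ℤ)) :
    ofMat (relMatrix rel) = rel.map fun w => List.ofFn w := by
  refine List.ext_getElem (by simp [ofMat]) fun i h1 h2 => ?_
  simp [ofMat, relMatrix]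

/-- The Gram determinant of the relations. -/
def relDet (rel : List (Fin n → ℤ)) : ℤ := |((relMatrix rel).transpose * relMatrix rel).det|

theorem relDet_pos [Finite G] {g : Fin n → G} {rel : List (Fin n → ℤ)}
    (h : ∀ w, comb g w = 0 ↔ w ∈ AddSubgroup.closure {w | w ∈ rel}) : 0 < relDet rel := by
  refine abs_pos.2 (det_gram_ne_zero fun v hv => ?_)
  have h1 : ∀ w ∈ AddSubgroup.closure {w | w ∈ rel}, w ⬝ᵥ v = 0 := by
    intro w hw
    induction hw using AddSubgroup.closure_induction with
    | mem w hw =>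
      obtain ⟨i, hi, rfl⟩ := List.mem_iff_getElem.1 hw
      exact congrFun hv ⟨i, hi⟩
    | zero => simp
    | add a b _ _ ha hb => rw [add_dotProduct, ha, hb, add_zero]
    | neg a _ ha => rw [neg_dotProduct, ha, neg_zero]
  funext i
  have h2 := h1 (Pi.single i (Nat.card G : ℤ)) ((h _).1 (by
    rw [comb_single, natCast_zsmul, card_nsmul_eq_zero']))
  rw [single_dotProduct] at h2
  exact (mul_eq_zero.1 h2).resolve_left (Nat.cast_ne_zero.2 Nat.card_pos.ne')

theorem relDet_smul {g : Fin n → G} {rel : List (Fin n → ℤ)}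
    (h : ∀ w ∈ rel, comb g w = 0) (i : Fin n) : relDet rel • g i = 0 := by
  set A := relMatrix rel with hA
  have h1 : ∀ l, ∑ j, (A.transpose * A) l j • g j = 0 := by
    intro l
    simp only [Matrix.mul_apply, Finset.sum_smul, Matrix.transpose_apply]
    rw [Finset.sum_comm]
    refine Finset.sum_eq_zero fun r _ => ?_
    have := h _ (List.getElem_mem r.2)
    simp only [mul_smul, ← Finset.smul_sum]
    rw [show ∑ j, A r j • g j = 0 from this, smul_zero]
  have h2 : (A.transpose * A).det • g i = 0 := by
    have h3 : ∑ j, ((A.transpose * A).adjugate * (A.transpose * A)) i j • g j = 0 := by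
      generalize (A.transpose * A).adjugate = B
      generalize A.transpose * A = C at h1 ⊢
      simp only [Matrix.mul_apply, Finset.sum_smul]
      rw [Finset.sum_comm]
      refine Finset.sum_eq_zero fun l _ => ?_
      simp only [mul_smul, ← Finset.smul_sum]
      rw [h1 l, smul_zero]
    rw [Matrix.adjugate_mul] at h3
    simpa [Matrix.smul_apply, Matrix.one_apply, ite_smul] using h3
  rcases abs_choice (A.transpose * A).det with h3 | h3 <;> rw [relDet, ← hA, h3]
  exacts [h2, by rw [neg_smul, h2, neg_zero]]

theorem pres_coef {d : ℤ} {g : Fin n → G} {rel : List (Fin n → ℤ)}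
    (hsurj : Function.Surjective (comb g))
    (h : ∀ w, comb g w = 0 ↔ w ∈ AddSubgroup.closure {w | w ∈ rel}) (hd : ∀ x : G, d • x = 0) :
    Pres d n (coef g) (rel.map fun w => List.ofFn w) where
  dmul f hf := (coef_apply g f).trans <| Finset.sum_eq_zero fun i _ => by
    obtain ⟨c, hc⟩ := hf i
    rw [hc, mul_smul, hd]
  surj x := by
    obtain ⟨w, rfl⟩ := hsurj x
    exact ⟨List.ofFn w, by simp, coef_seq_ofFn g w⟩
  ker v hv h0 := by
    obtain ⟨w, rfl⟩ := exists_eq_ofFn hv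
    rw [coef_seq_ofFn, h] at h0
    let F : (Fin n → ℤ) →+ (ℕ → ℤ) :=
      { toFun := fun w => seq (List.ofFn w)
        map_zero' := seq_eq_zero fun x hx => by
          obtain ⟨i, rfl⟩ := (List.mem_ofFn' _ _).1 hx
          rfl
        map_add' := fun u v => by
          ext i
          by_cases hi : i < n <;> simp [seq, hi] }
    have h1 : AddSubgroup.closure {w | w ∈ rel} ≤
        (Lat d (rel.map fun w => List.ofFn w)).comap F :=
      (AddSubgroup.closure_le _).2 fun w hw => mem_lat (List.mem_map.2 ⟨w, hw, rfl⟩)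
    exact h1 h0
  rel v hv := by
    obtain ⟨w, hw, rfl⟩ := List.mem_map.1 hv
    exact ⟨by simp, by rw [coef_seq_ofFn]; exact (h w).2 (AddSubgroup.subset_closure hw)⟩

theorem hom_map_md {d : ℤ} (hd : 0 < d) {φ : (ℕ → ℤ) →+ G} (hφ : ∀ f ∈ dmul d, φ f = 0)
    (v : List ℤ) : φ (seq (v.map (md d))) = φ (seq v) := by
  rw [← sub_eq_zero, ← map_sub]
  refine hφ _ fun i => ?_
  by_cases hi : i < v.length
  · simpa [seq, hi] using dvd_md_sub hd v[i]
  · simp [seq, hi]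

end Relations

section Act

variable {R M : Type*} [CommRing R] [AddCommGroup M] [Module R M] {n m : ℕ}

/-- A table of vectors as a list. -/
def ofTab (U : Fin n → Fin m → Fin m → ℤ) : List (List (List ℤ)) := List.ofFn fun i => ofMat (Matrix.of (U i))

theorem length_act {d : ℤ} {zs r x : List ℤ} {U : Fin n → Fin m → Fin m → ℤ} (hm : zs.length = m) :
    (act d zs (ofTab U) r x).length = m := by
  have hU : ∀ V ∈ ofTab U, ∀ v ∈ V, v.length = zs.length := by
    intro V hV v hv
    obtain ⟨i, rfl⟩ := (List.mem_ofFn' _ _).1 hV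
    obtain ⟨j, rfl⟩ := (List.mem_ofFn' _ _).1 hv
    simp [hm]
  rw [act, List.length_map, length_lc, hm]
  intro v hv
  obtain ⟨V, hV, rfl⟩ := List.mem_map.1 hv
  rw [List.length_map, length_lc (hU V hV)]

theorem coef_act {d : ℤ} (hd : 0 < d) {g : Fin n → R} {h : Fin m → M}
    {U : Fin n → Fin m → Fin m → ℤ} (hU : ∀ i j, g i • h j = comb h (U i j))
    (hM : ∀ f ∈ dmul d, coef h f = 0) {zs r x : List ℤ} (hz : ∀ z ∈ zs, z = 0)
    (hm : zs.length = m) (hr : r.length = n) (hx : x.length = m) :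
    coef h (seq (act d zs (ofTab U) r x)) = coef g (seq r) • coef h (seq x) := by
  obtain ⟨r, rfl⟩ := exists_eq_ofFn hr
  obtain ⟨x, rfl⟩ := exists_eq_ofFn hx
  have hlc : ∀ i, coef h (seq ((lc zs (List.ofFn x) (ofMat (Matrix.of (U i)))).map (md d))) =
      g i • comb h x := by
    intro i
    rw [hom_map_md hd hM, lc_ofMat hz hm, coef_seq_ofFn, comb, comb, Finset.smul_sum]
    simp only [Matrix.vecMul, dotProduct, Matrix.of_apply, Finset.sum_smul]
    rw [Finset.sum_comm]
    refine Finset.sum_congr rfl fun j _ => ?_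
    rw [smul_comm, hU, comb, Finset.smul_sum]
    simp only [mul_smul]
  have e : (ofTab U).map (fun V => (lc zs (List.ofFn x) V).map (md d)) =
      List.ofFn fun i => (lc zs (List.ofFn x) (ofMat (Matrix.of (U i)))).map (md d) := by
    rw [ofTab, List.map_ofFn]
    rfl
  rw [act, hom_map_md hd hM, e, hom_lc, seq_eq_zero hz, map_zero, zero_add, zipWith_ofFn,
    List.sum_ofFn, coef_seq_ofFn, coef_seq_ofFn, comb, Finset.sum_smul]
  · refine Finset.sum_congr rfl fun i _ => ?_
    rw [hlc, smul_assoc]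
  · intro v hv
    obtain ⟨i, rfl⟩ := (List.mem_ofFn' _ _).1 hv
    rw [List.length_map, length_lc]
    intro v hv
    obtain ⟨j, rfl⟩ := (List.mem_ofFn' _ _).1 hv
    simp [hm]

end Act

end CyclicModule

namespace CyclicModule

/-! ### Correctness of the algorithm -/

section Ideals

variable {A : Type*} [CommRing A]

/-- An ideal of an Artinian ring that meets its annihilator trivially is generated by an
idempotent. -/
theorem exists_idempotent [IsArtinianRing A] [IsNoetherianRing A] {a : Ideal A}
    (h : a ⊓ a.annihilator = ⊥) :
    ∃ e : A, IsIdempotentElem e ∧ a = Ideal.span {e} ∧ a.annihilator = Ideal.span {1 - e} := by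
  obtain ⟨n, hn⟩ := IsArtinian.monotone_stabilizes (R := A) (M := A)
    ⟨fun n => OrderDual.toDual (a ^ n), fun i j hij => Ideal.pow_le_pow_right hij⟩
  have hn : ∀ m, n ≤ m → a ^ n = a ^ m := hn
  have hid : IsIdempotentElem (a ^ (n + 1)) := by
    rw [IsIdempotentElem, ← pow_add, ← hn (n + 1 + (n + 1)) (by omega), ← hn (n + 1) (by omega)]
  obtain ⟨e, he, hae⟩ := (Ideal.isIdempotentElem_iff_of_fg _ (IsNoetherian.noetherian _)).1 hid
  have hea : e ∈ a := Ideal.pow_le_self n.succ_ne_zero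
    (hae ▸ Ideal.mem_span_singleton_self e)
  have hee : e * e = e := he
  set f : Ideal A := Ideal.span {1 - e} with hf
  have hff : f * f = f := by
    rw [hf, Ideal.span_singleton_mul_span_singleton]
    congr 2
    linear_combination hee
  have hpow : ∀ j, (f * a) ^ (j + 1) = f * a ^ (j + 1) := by
    intro j
    rw [mul_pow]
    congr 1
    induction j with
    | zero => rw [zero_add, pow_one]
    | succ j ih => rw [pow_succ, ih, hff]
  have hzero : (f * a) ^ (n + 1) = ⊥ := by
    rw [hpow, hae, hf, Ideal.submodule_span_eq, Ideal.span_singleton_mul_span_singleton,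
      Ideal.span_singleton_eq_bot]
    linear_combination -hee
  have hdown : ∀ j, (f * a) ^ (j + 1 + 1) = ⊥ → (f * a) ^ (j + 1) = ⊥ := by
    intro j hj
    rw [eq_bot_iff, ← h]
    refine le_inf ((Ideal.pow_le_self j.succ_ne_zero).trans Ideal.mul_le_right) ?_
    intro t ht
    rw [Submodule.mem_annihilator]
    intro u hu
    have h1 : t * u ∈ (f * a) ^ (j + 1 + 1) := by
      rw [hpow, pow_succ, ← mul_assoc, ← hpow]
      exact Ideal.mul_mem_mul ht hu
    rw [hj] at h1
    exact h1
  have hfa : f * a = ⊥ := by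
    have : ∀ j, (f * a) ^ (j + 1) = ⊥ → f * a = ⊥ := by
      intro j
      induction j with
      | zero => rw [zero_add, pow_one]; exact id
      | succ j ih => exact fun h => ih (hdown j h)
    exact this n hzero
  have hmul : ∀ t ∈ a, t * e = t := by
    intro t ht
    have : (1 - e) * t ∈ f * a := Ideal.mul_mem_mul (Ideal.mem_span_singleton_self _) ht
    rw [hfa, Ideal.mem_bot] at this
    linear_combination -this
  refine ⟨e, he, le_antisymm (fun t ht => ?_) ?_, le_antisymm (fun t ht => ?_) ?_⟩
  · rw [← hmul t ht]
    exact Ideal.mul_mem_left _ _ (Ideal.mem_span_singleton_self e)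
  · rwa [Ideal.span_singleton_le_iff_mem]
  · have h1 : t * e = 0 := Submodule.mem_annihilator.1 ht e hea
    have : t = t * (1 - e) := by linear_combination h1
    rw [this]
    exact Ideal.mul_mem_left _ _ (Ideal.mem_span_singleton_self _)
  · rw [Ideal.span_singleton_le_iff_mem, Submodule.mem_annihilator]
    intro t ht
    rw [smul_eq_mul]
    linear_combination -hmul t ht

theorem bijective_of_idempotent {a b : Ideal A} (hab : a ⊓ b = ⊥) {e : A} (ha : e ∈ a)
    (hb : 1 - e ∈ b) :
    Function.Bijective fun t : A => (Ideal.Quotient.mk a t, Ideal.Quotient.mk b t) := by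
  constructor
  · intro s t hst
    obtain ⟨h1, h2⟩ := Prod.ext_iff.1 hst
    have : s - t ∈ a ⊓ b := ⟨Ideal.Quotient.eq.1 h1, Ideal.Quotient.eq.1 h2⟩
    rw [hab] at this
    exact sub_eq_zero.1 this
  · rintro ⟨u, v⟩
    obtain ⟨u, rfl⟩ := Ideal.Quotient.mk_surjective u
    obtain ⟨v, rfl⟩ := Ideal.Quotient.mk_surjective v
    refine ⟨u * (1 - e) + v * e, Prod.ext (Ideal.Quotient.eq.2 ?_) (Ideal.Quotient.eq.2 ?_)⟩
    · convert a.mul_mem_left (v - u) ha using 1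
      ring
    · convert b.mul_mem_left (u - v) hb using 1
      ring

theorem two_mul_card_quotient_le [Finite A] {I J : Ideal A} (h : I < J) :
    2 * Nat.card (A ⧸ J) ≤ Nat.card (A ⧸ I) := by
  have h1 := AddSubgroup.relIndex_mul_index (H := I.toAddSubgroup) (K := J.toAddSubgroup) h.le
  have h2 : I.toAddSubgroup.relIndex J.toAddSubgroup ≠ 1 := fun h3 =>
    h.not_ge (AddSubgroup.relIndex_eq_one.1 h3)
  have h3 : I.toAddSubgroup.index ≠ 0 := AddSubgroup.FiniteIndex.index_ne_zero
  have h4 : I.toAddSubgroup.relIndex J.toAddSubgroup ≠ 0 := fun h5 => by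
    rw [h5, zero_mul] at h1
    exact h3 h1.symm
  change 2 * J.toAddSubgroup.index ≤ I.toAddSubgroup.index
  rw [← h1]
  exact Nat.mul_le_mul_right _ (by omega)

theorem eq_top_of_forall_isMaximal {R M : Type*} [CommRing R] [AddCommGroup M] [Module R M]
    [Module.Finite R M] {P : Submodule R M}
    (h : ∀ m : Ideal R, m.IsMaximal → P ⊔ m • ⊤ = ⊤) : P = ⊤ := by
  by_contra hP
  have h1 : Module.annihilator R (M ⧸ P) ≠ ⊤ := by
    intro h2
    refine hP (eq_top_iff.2 fun x _ => ?_)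
    have h3 : (1 : R) ∈ Module.annihilator R (M ⧸ P) := h2 ▸ Submodule.mem_top
    have h4 := Module.mem_annihilator.1 h3 (Submodule.Quotient.mk x)
    rwa [one_smul, Submodule.Quotient.mk_eq_zero] at h4
  obtain ⟨m, hm, hle⟩ := Ideal.exists_le_maximal _ h1
  have h2 : (⊤ : Submodule R (M ⧸ P)) ≤ m • ⊤ := by
    have := congrArg (Submodule.map P.mkQ) (h m hm)
    rw [Submodule.map_sup, Submodule.map_smul'', Submodule.map_top, Submodule.range_mkQ,
      Submodule.mkQ_map_self, bot_sup_eq] at this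
    exact this.ge
  obtain ⟨r, hr, h3⟩ := Submodule.exists_sub_one_mem_and_smul_eq_zero_of_fg_of_le_smul m ⊤
    Module.Finite.fg_top h2
  have h4 : r ∈ m := hle (Module.mem_annihilator.2 fun q => h3 q trivial)
  refine hm.ne_top ((Ideal.eq_top_iff_one m).2 ?_)
  simpa using sub_mem h4 hr

end Ideals

section States

variable {R : Type u} {M : Type v} [CommRing R] [AddCommGroup M] [Module R M]

theorem one_tmul_eq_zero_iff (I : Ideal R) (x : M) :
    ((1 : R ⧸ I) ⊗ₜ[R] x : (R ⧸ I) ⊗[R] M) = 0 ↔ x ∈ I • (⊤ : Submodule R M) := by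
  rw [← (TensorProduct.quotTensorEquivQuotSMul M I).map_eq_zero_iff,
    ← map_one (Ideal.Quotient.mk I), TensorProduct.quotTensorEquivQuotSMul_mk_tmul, one_smul,
    Submodule.Quotient.mk_eq_zero]

theorem forall_tmul_eq_zero_iff (I : Ideal R) :
    (∀ z : (R ⧸ I) ⊗[R] M, z = 0) ↔ I • (⊤ : Submodule R M) = ⊤ := by
  rw [eq_top_iff]
  refine ⟨fun h x _ => (one_tmul_eq_zero_iff I x).1 (h _), fun h z => ?_⟩
  rw [← (TensorProduct.quotTensorEquivQuotSMul M I).map_eq_zero_iff]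
  obtain ⟨x, hx⟩ := Submodule.Quotient.mk_surjective _
    (TensorProduct.quotTensorEquivQuotSMul M I z)
  rw [← hx, Submodule.Quotient.mk_eq_zero]
  exact h trivial

theorem forall_exists_tmul_iff (J : Ideal R) (x : M) :
    (∀ z : (R ⧸ J) ⊗[R] M, ∃ t : R ⧸ J, t ⊗ₜ[R] x = z) ↔
      Submodule.span R {x} ⊔ J • (⊤ : Submodule R M) = ⊤ := by
  let E := TensorProduct.quotTensorEquivQuotSMul M J
  have hE : ∀ (r : R), E (Ideal.Quotient.mk J r ⊗ₜ[R] x) = Submodule.Quotient.mk (r • x) :=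
    fun r => TensorProduct.quotTensorEquivQuotSMul_mk_tmul J r x
  rw [eq_top_iff]
  constructor
  · intro h w _
    obtain ⟨t, ht⟩ := h (E.symm (Submodule.Quotient.mk w))
    obtain ⟨r, rfl⟩ := Ideal.Quotient.mk_surjective t
    have h1 := congrArg E ht
    rw [hE, E.apply_symm_apply, Submodule.Quotient.eq] at h1
    refine Submodule.mem_sup.2 ⟨r • x, Submodule.mem_span_singleton.2 ⟨r, rfl⟩, w - r • x, ?_,
      add_sub_cancel _ _⟩
    rw [← neg_sub]
    exact neg_mem h1
  · intro h z
    obtain ⟨w, hw⟩ := Submodule.Quotient.mk_surjective _ (E z)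
    obtain ⟨u, hu, v, hv, rfl⟩ := Submodule.mem_sup.1 (h (trivial : w ∈ _))
    obtain ⟨r, rfl⟩ := Submodule.mem_span_singleton.1 hu
    refine ⟨Ideal.Quotient.mk J r, E.injective ?_⟩
    rw [hE, ← hw, Submodule.Quotient.eq, sub_add_cancel_left]
    exact neg_mem hv

namespace State

variable (s : State R M) {x : M}

theorem pick_iff : s.Pick x ↔ x ∈ s.N ∧ x ∉ s.I • (⊤ : Submodule R M) := by
  rw [Pick, Ne, one_tmul_eq_zero_iff]

theorem mem_pre_a {r : R} : r ∈ s.pre (s.a x) ↔ r • x ∈ s.I • (⊤ : Submodule R M) := by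
  rw [pre, Ideal.mem_comap, a, Ideal.mem_torsionOf_iff, TensorProduct.smul_tmul', smul_eq_mul,
    mul_one, ← one_tmul_eq_zero_iff, ← TensorProduct.smul_tmul, Algebra.smul_def, mul_one]
  rfl

theorem mem_pre_b {r : R} : r ∈ s.pre (s.b x) ↔ ∀ t ∈ s.pre (s.a x), r * t ∈ s.I := by
  rw [pre, Ideal.mem_comap, b, Submodule.mem_annihilator]
  constructor
  · intro h t ht
    have := h _ ht
    rwa [smul_eq_mul, ← map_mul, Ideal.Quotient.eq_zero_iff_mem] at this
  · intro h t ht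
    obtain ⟨t, rfl⟩ := Ideal.Quotient.mk_surjective t
    rw [smul_eq_mul, ← map_mul, Ideal.Quotient.eq_zero_iff_mem]
    exact h t ht

theorem le_pre (c : Ideal s.A) : s.I ≤ s.pre c := fun r hr => by
  rw [pre, Ideal.mem_comap, Ideal.Quotient.eq_zero_iff_mem.2 hr]
  exact zero_mem c

theorem pre_inf (c c' : Ideal s.A) : s.pre (c ⊓ c') = s.pre c ⊓ s.pre c' := rfl

theorem pre_le_iff {c : Ideal s.A} : s.pre c ≤ s.I ↔ c = ⊥ := by
  constructor
  · intro h
    rw [eq_bot_iff]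
    intro t ht
    obtain ⟨t, rfl⟩ := Ideal.Quotient.mk_surjective t
    exact Ideal.Quotient.eq_zero_iff_mem.2 (h ht)
  · rintro rfl r hr
    exact Ideal.Quotient.eq_zero_iff_mem.1 hr

theorem full_iff :
    s.Full x ↔ Submodule.span R {x} ⊔ s.pre (s.a x) • (⊤ : Submodule R M) = ⊤ :=
  forall_exists_tmul_iff _ _

theorem pre_b_mul_pre_a_le : s.pre (s.b x) * s.pre (s.a x) ≤ s.I :=
  Ideal.mul_le.2 fun _ hr _ ht => s.mem_pre_b.1 hr _ ht

/-- The invariants of the algorithm. -/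
def Inv (s : State R M) : Prop := ∀ m : Ideal R, m.IsMaximal →
  (¬ s.I ≤ m → Submodule.span R {s.y} ⊔ m • ⊤ = ⊤ ∧ s.N ≤ m • ⊤) ∧
    (s.I ≤ m → s.y ∈ m • (⊤ : Submodule R M) ∧ s.N ⊔ m • ⊤ = ⊤)

theorem inv_init : Inv (State.init : State R M) := fun _ _ =>
  ⟨fun h => absurd bot_le h, fun _ => ⟨zero_mem _, top_sup_eq _⟩⟩

variable [Finite R]

theorem exists_idempotent (h : s.a x ⊓ s.b x = ⊥) :
    ∃ e : s.A, IsIdempotentElem e ∧ s.a x = Ideal.span {e} ∧ s.b x = Ideal.span {1 - e} :=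
  CyclicModule.exists_idempotent h

theorem pre_sup_eq_top (h : s.a x ⊓ s.b x = ⊥) : s.pre (s.a x) ⊔ s.pre (s.b x) = ⊤ := by
  obtain ⟨e, -, ha, hb⟩ := s.exists_idempotent h
  obtain ⟨r, rfl⟩ := Ideal.Quotient.mk_surjective e
  rw [Ideal.eq_top_iff_one]
  refine Submodule.mem_sup.2 ⟨r, ?_, 1 - r, ?_, add_sub_cancel _ _⟩
  · rw [pre, Ideal.mem_comap, ha]
    exact Ideal.mem_span_singleton_self _
  · rw [pre, Ideal.mem_comap, hb, map_sub, map_one]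
    exact Ideal.mem_span_singleton_self _

theorem full_of_cyclic [Finite M] (h : s.a x ⊓ s.b x = ⊥) {z : M}
    (hz : Submodule.span R {z} = ⊤) : s.Full x := by
  set J := s.pre (s.a x) with hJ
  set Q := M ⧸ J • (⊤ : Submodule R M)
  have h1 : Ideal.torsionOf R Q (Submodule.Quotient.mk x) ≤ J := by
    intro r hr
    rw [Ideal.mem_torsionOf_iff, ← Submodule.Quotient.mk_smul, Submodule.Quotient.mk_eq_zero] at hr
    obtain ⟨j, hj, c, hc, hjc⟩ := Submodule.mem_sup.1
      ((s.pre_sup_eq_top h).ge (Submodule.mem_top (x := (1 : R))))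
    have h2 : c * r ∈ J := by
      rw [hJ, mem_pre_a, mul_smul]
      have h3 : c • r • x ∈ s.pre (s.b x) • J • (⊤ : Submodule R M) := Submodule.smul_mem_smul hc hr
      rw [← Submodule.mul_smul] at h3
      exact Submodule.smul_mono_left s.pre_b_mul_pre_a_le h3
    have : r = r * j + c * r := by linear_combination -r * hjc
    rw [this]
    exact add_mem (J.mul_mem_left _ hj) h2
  have h2 : J ≤ Ideal.torsionOf R Q (Submodule.Quotient.mk z) := by
    intro r hr
    rw [Ideal.mem_torsionOf_iff, ← Submodule.Quotient.mk_smul, Submodule.Quotient.mk_eq_zero]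
    exact Submodule.smul_mem_smul hr trivial
  have h3 : (⊤ : Submodule R Q) = Submodule.span R {Submodule.Quotient.mk z} := by
    have := congrArg (Submodule.map (J • (⊤ : Submodule R M)).mkQ) hz
    rw [Submodule.map_span, Set.image_singleton, Submodule.map_top, Submodule.range_mkQ] at this
    exact this.symm
  have hfin : Finite (R ⧸ Ideal.torsionOf R Q (Submodule.Quotient.mk x)) :=
    .of_surjective _ Ideal.Quotient.mk_surjective
  have hfinQ : Finite Q := .of_surjective _ (Submodule.Quotient.mk_surjective _)
  have h4 : Nat.card Q ≤ Nat.card (Submodule.span R {(Submodule.Quotient.mk x : Q)}) := by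
    have e1 := Nat.card_congr
      (Ideal.quotTorsionOfEquivSpanSingleton R Q (Submodule.Quotient.mk x)).toEquiv
    have e2 := Nat.card_congr
      (Ideal.quotTorsionOfEquivSpanSingleton R Q (Submodule.Quotient.mk z)).toEquiv
    rw [← e1, ← Nat.card_congr (Submodule.topEquiv (R := R) (M := Q)).toEquiv, h3, ← e2]
    exact Nat.card_le_card_of_surjective _ (Ideal.Quotient.factor_surjective (h1.trans h2))
  have h5 : Submodule.span R {(Submodule.Quotient.mk x : Q)} = ⊤ := by
    rw [← SetLike.coe_set_eq, Submodule.top_coe]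
    exact Set.eq_of_subset_of_ncard_le (Set.subset_univ _) (by rw [Set.ncard_univ]; exact h4)
  rw [full_iff, ← hJ]
  have := congrArg (Submodule.comap (J • (⊤ : Submodule R M)).mkQ) h5
  rw [Submodule.comap_top, ← Set.image_singleton (f := Submodule.Quotient.mk),
    show (Submodule.Quotient.mk : M → Q) = (J • (⊤ : Submodule R M)).mkQ from rfl,
    ← Submodule.map_span, Submodule.comap_map_mkQ] at this
  rwa [sup_comm]

end State

theorem Step.lt [Finite R] {s s' : State R M} (h : Step s s') : s.I < s'.I := by
  cases h with
  | shrink x hx hab => exact lt_of_le_not_ge (s.le_pre _) fun h => hab (s.pre_le_iff.1 h)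
  | split x hx hab hf =>
    refine lt_of_le_not_ge (s.le_pre _) fun h => (s.pick_iff.1 hx).2 ?_
    obtain ⟨e, -, ha, hb⟩ := s.exists_idempotent hab
    rw [s.pre_le_iff.1 h, eq_comm, Ideal.span_singleton_eq_bot, sub_eq_zero] at hb
    rw [← hb, Ideal.span_singleton_one] at ha
    have h1 : (1 : R) ∈ s.pre (s.a x) := by
      rw [State.pre, Ideal.mem_comap, ha]
      trivial
    rw [← one_smul R x]
    exact s.mem_pre_a.1 h1

theorem sup_smul_top_eq_top_of_add_mem {m : Ideal R} {x y : M} (hx : x ∈ m • (⊤ : Submodule R M))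
    (h : Submodule.span R {y} ⊔ m • ⊤ = ⊤) : Submodule.span R {x + y} ⊔ m • ⊤ = ⊤ := by
  refine top_le_iff.1 (h.ge.trans (sup_le ?_ le_sup_right))
  rw [Submodule.span_singleton_le_iff_mem]
  refine Submodule.mem_sup.2 ⟨x + y, Submodule.mem_span_singleton_self _, -x, neg_mem hx, by abel⟩

theorem Step.inv [Finite R] {s s' : State R M} (h : Step s s') (hs : s.Inv) : s'.Inv := by
  cases h with
  | shrink x hx hab =>
    intro m hm
    have h1 : s.pre (s.a x ⊓ s.b x) ≤ m ↔ s.I ≤ m := by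
      refine ⟨(s.le_pre _).trans, fun h => ?_⟩
      have h2 : s.pre (s.a x ⊓ s.b x) * s.pre (s.a x ⊓ s.b x) ≤ m := by
        rw [s.pre_inf]
        exact (Ideal.mul_mono inf_le_right inf_le_left).trans (s.pre_b_mul_pre_a_le.trans h)
      exact (hm.isPrime.mul_le.1 h2).elim id id
    simp only [h1]
    exact hs m hm
  | split x hx hab hf =>
    intro m hm
    obtain ⟨h1, h2⟩ := hs m hm
    have hx := s.pick_iff.1 hx
    have htop := s.pre_sup_eq_top hab
    refine ⟨fun hB => ?_, fun hB => ?_⟩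
    · by_cases hI : s.I ≤ m
      · have hJ : s.pre (s.a x) ≤ m :=
          (hm.isPrime.mul_le.1 (s.pre_b_mul_pre_a_le.trans hI)).resolve_left hB
        refine ⟨?_, Submodule.smul_mono hJ le_top⟩
        rw [add_comm]
        refine sup_smul_top_eq_top_of_add_mem (h2 hI).1 (top_le_iff.1 ?_)
        exact (s.full_iff.1 hf).ge.trans (sup_le_sup_left (Submodule.smul_mono_left hJ) _)
      · exact ⟨sup_smul_top_eq_top_of_add_mem ((h1 hI).2 hx.1) (h1 hI).1,
          Submodule.smul_le_right.trans (h1 hI).2⟩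
    · have hI : s.I ≤ m := (s.le_pre _).trans hB
      have hJm : s.pre (s.a x) ⊔ m = ⊤ := eq_top_iff.2 (htop.ge.trans (sup_le_sup_left hB _))
      refine ⟨add_mem ?_ (h2 hI).1, ?_⟩
      · obtain ⟨j, hj, c, hc, hjc⟩ := Submodule.mem_sup.1
          (hJm.ge (Submodule.mem_top (x := (1 : R))))
        rw [← one_smul R x, ← hjc, add_smul]
        exact add_mem (Submodule.smul_mono_left hI (s.mem_pre_a.1 hj))
          (Submodule.smul_mem_smul hc trivial)
      · refine top_le_iff.1 ((h2 hI).2.ge.trans (sup_le ?_ le_sup_right))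
        change s.N ≤ s.pre (s.a x) • s.N ⊔ m • ⊤
        have h3 : s.N = s.pre (s.a x) • s.N ⊔ m • s.N := by
          rw [← Submodule.sup_smul, hJm, Submodule.top_smul]
        exact h3.le.trans <| sup_le_sup_left (Submodule.smul_mono le_rfl le_top) _

theorem Stops.span_eq_top [Finite M] {s : State R M} {y : M} (h : Stops s (some y)) (hs : s.Inv) :
    Submodule.span R {y} = ⊤ := by
  cases h with
  | yes h =>
    refine eq_top_of_forall_isMaximal fun m hm => ?_
    by_cases hI : s.I ≤ m
    · exact top_le_iff.1 (((forall_tmul_eq_zero_iff s.I).1 h).ge.trans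
        ((Submodule.smul_mono_left hI).trans le_sup_right))
    · exact ((hs m hm).1 hI).1

theorem State.Inv.exists_pick [Finite M] {s : State R M} (hs : s.Inv) :
    (∀ z : s.MA, z = 0) ∨ ∃ x, s.Pick x := by
  by_contra! h
  obtain ⟨⟨z, hz⟩, h⟩ := h
  simp only [s.pick_iff, not_and, not_not] at h
  refine hz ((forall_tmul_eq_zero_iff s.I).2 (eq_top_of_forall_isMaximal fun m hm => ?_) z)
  by_cases hI : s.I ≤ m
  · exact top_le_iff.1 (((hs m hm).2 hI).2.ge.trans (sup_le_sup_right h _))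
  · rw [← Submodule.sup_smul, sup_comm, hm.out.2 _ (left_lt_sup.2 hI), Submodule.top_smul]

theorem Stops.not_cyclic [Finite R] [Finite M] {s : State R M} (h : Stops s none) :
    ¬ ∃ y : M, Submodule.span R {y} = ⊤ := by
  cases h with
  | no x hx hab hf => exact fun ⟨y, hy⟩ => hf (s.full_of_cyclic hab hy)

theorem IsPartialRun.inv [Finite R] {τ : List (State R M)} (h : IsPartialRun τ) :
    ∀ s ∈ τ, s.Inv := by
  obtain ⟨h1, h2⟩ := h
  have key : ∀ τ : List (State R M), (∀ s ∈ τ.head?, s.Inv) → τ.IsChain Step → ∀ s ∈ τ, s.Inv := by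
    intro τ
    induction τ with
    | nil => simp
    | cons s τ ih =>
      intro hs hτ t ht
      have hs : s.Inv := hs s rfl
      rcases List.mem_cons.1 ht with rfl | ht
      · exact hs
      · rw [List.isChain_cons] at hτ
        exact ih (fun t ht => (hτ.1 t ht).inv hs) hτ.2 t ht
  refine key τ ?_ h2
  rw [h1]
  rintro s ⟨⟩
  exact State.inv_init

end States

end CyclicModule

namespace CyclicModule

open Enc

/-! ### The number of rounds -/

/-- The input in coordinates. -/
def Input.raw (P : Input) : RawInput :=
  ((P.n, P.relR.map fun w => List.ofFn w, ofTab P.mul),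
    (P.m, P.relM.map fun w => List.ofFn w, ofTab P.smul))

theorem ofVec_eq {n : ℕ} (w : Fin n → ℤ) : Data.ofVec w = enc (List.ofFn w) := by
  rw [Data.ofVec]
  change _ = Data.ofList ((List.ofFn w).map Data.int)
  rw [List.map_ofFn]
  rfl

theorem ofVecs_eq {n : ℕ} (l : List (Fin n → ℤ)) :
    Data.ofVecs l = enc (l.map fun w => List.ofFn w) := by
  rw [Data.ofVecs]
  change _ = Data.ofList ((l.map fun w => List.ofFn w).map enc)
  rw [List.map_map]
  exact congrArg Data.ofList (List.map_congr_left fun w _ => ofVec_eq w)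

theorem ofTable_eq {k l : ℕ} (T : Fin k → Fin l → Fin l → ℤ) :
    Data.ofTable T = enc (ofTab T) := by
  rw [Data.ofTable, ofTab]
  change _ = Data.ofList ((List.ofFn fun i => ofMat (Matrix.of (T i))).map enc)
  rw [List.map_ofFn]
  refine congrArg (fun f => Data.ofList (List.ofFn f)) (funext fun i => ?_)
  change _ = Data.ofList ((ofMat (Matrix.of (T i))).map enc)
  rw [map_ofMat]
  exact congrArg (fun f => Data.ofList (List.ofFn f)) (funext fun j => ofVec_eq _)

theorem Input.encode_eq (P : Input) : P.encode = enc P.raw := by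
  rw [Input.encode, ofVecs_eq, ofVecs_eq, ofTable_eq, ofTable_eq]
  rfl

theorem sum_natAbs_lt {n : ℕ} (w : Fin n → ℤ) : ∑ j, (w j).natAbs < 2 ^ esize (List.ofFn w) := by
  induction n with
  | zero => simp
  | succ n ih =>
    rw [Fin.sum_univ_succ, List.ofFn_succ, esize_cons, pow_succ, pow_add]
    have h1 := natAbs_lt_two_pow (w 0)
    have h2 := ih fun j => w j.succ
    have h3 : 0 < 2 ^ esize (w 0) := by positivity
    have h4 : 0 < 2 ^ esize (List.ofFn fun j => w j.succ) := by positivity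
    nlinarith

theorem natAbs_det_le {n : ℕ} (B : Matrix (Fin n) (Fin n) ℤ) :
    B.det.natAbs ≤ ∏ i, ∑ j, (B i j).natAbs := by
  rw [Finset.prod_univ_sum, ← Matrix.det_transpose, Matrix.det_apply]
  refine (Int.natAbs_sum_le _ _).trans ?_
  have h : ∀ σ : Equiv.Perm (Fin n), (Equiv.Perm.sign σ • ∏ i, B.transpose (σ i) i).natAbs =
      ∏ i, (B i (σ i)).natAbs := by
    intro σ
    rw [Units.smul_def, smul_eq_mul, Int.natAbs_mul, Int.units_natAbs, one_mul]
    exact map_prod Int.natAbsHom _ _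
  rw [Finset.sum_congr rfl fun σ _ => h σ]
  rw [← Finset.sum_image (s := Finset.univ)
    (g := fun σ : Equiv.Perm (Fin n) => (σ : Fin n → Fin n))
    (f := fun f => ∏ i, (B i (f i)).natAbs) (DFunLike.coe_injective.injOn)]
  exact Finset.sum_le_sum_of_subset fun f _ => by simp

theorem sum_esize_le {α : Type} [Enc α] (l : List α) : (l.map esize).sum ≤ esize l := by
  induction l with
  | nil => simp
  | cons a l ih => simp only [List.map_cons, List.sum_cons, esize_cons]; omega

theorem card_le_two_pow {G : Type*} [AddCommGroup G] [Finite G] {n : ℕ} {g : Fin n → G}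
    {rel : List (Fin n → ℤ)} (hsurj : Function.Surjective (comb g))
    (h : ∀ w, comb g w = 0 ↔ w ∈ AddSubgroup.closure {w | w ∈ rel}) :
    Nat.card G ≤ 2 ^ esize (rel.map fun w => List.ofFn w) := by
  classical
  let ι : (Fin n → ℤ) →+ (Fin n → ℚ) := (Int.castAddHom ℚ).compLeft (Fin n)
  have hι : ∀ w i, ι w i = (w i : ℚ) := fun w i => rfl
  set s : Set (Fin n → ℚ) := ι '' {w | w ∈ rel} with hs
  have htop : Submodule.span ℚ s = ⊤ := by
    have h1 : AddSubgroup.closure {w | w ∈ rel} ≤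
        (Submodule.span ℚ s).toAddSubgroup.comap ι :=
      (AddSubgroup.closure_le _).2 fun w hw => Submodule.subset_span ⟨w, hw, rfl⟩
    rw [eq_top_iff, ← (Pi.basisFun ℚ (Fin n)).span_eq, Submodule.span_le]
    rintro _ ⟨i, rfl⟩
    have h2 : ι (Pi.single i (Nat.card G : ℤ)) ∈ Submodule.span ℚ s := h1 ((h _).1 (by
      rw [comb_single, natCast_zsmul, card_nsmul_eq_zero']))
    have h3 : Pi.basisFun ℚ (Fin n) i = (Nat.card G : ℚ)⁻¹ • ι (Pi.single i (Nat.card G : ℤ)) := by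
      ext j
      rw [Pi.basisFun_apply, Pi.smul_apply, hι]
      by_cases hij : j = i
      · subst hij
        have : (Nat.card G : ℚ) ≠ 0 := Nat.cast_ne_zero.2 Nat.card_pos.ne'
        simp [this]
      · simp [hij]
    rw [h3]
    exact Submodule.smul_mem _ _ h2
  have key := Submodule.exists_fun_fin_finrank_span_eq ℚ s
  rw [show Module.finrank ℚ (Submodule.span ℚ s) = n by rw [htop, finrank_top]; simp] at key
  obtain ⟨f, hf, -, hli⟩ := key
  choose w hw hwf using hf
  have hwf' : f = ι ∘ w := funext fun i => (hwf i).symm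
  have hinj : Function.Injective w := fun i j hij => hli.injective (by rw [← hwf, ← hwf, hij])
  have hli2 : LinearIndependent ℤ w := by
    have := hli.restrict_scalars' ℤ
    rw [hwf'] at this
    exact LinearIndependent.of_comp ι.toIntLinearMap this
  let N := Submodule.span ℤ (Set.range w)
  have hdet := Submodule.natAbs_det_basis_change (Pi.basisFun ℤ (Fin n)) N
    (Module.Basis.span hli2)
  have hd2 : (Pi.basisFun ℤ (Fin n)).det (Subtype.val ∘ Module.Basis.span hli2) =
      (Matrix.of w).det := by
    rw [Pi.basisFun_det]
    congr 1
    ext i j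
    simp [Module.Basis.span_apply]
  rw [hd2] at hdet
  have hne : (Matrix.of w).det ≠ 0 := by
    have h1 : LinearIndependent ℚ ((Matrix.of w).map (Int.castRingHom ℚ)).row := by
      have : ((Matrix.of w).map (Int.castRingHom ℚ)).row = f := by
        rw [hwf']
        rfl
      rwa [this]
    rw [Matrix.linearIndependent_rows_iff_isUnit, Matrix.isUnit_iff_isUnit_det,
      ← RingHom.mapMatrix_apply, ← RingHom.map_det] at h1
    intro h2
    rw [h2, map_zero] at h1
    exact not_isUnit_zero h1
  have hcard : Nat.card G ≤ Nat.card ((Fin n → ℤ) ⧸ N) := by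
    have : Finite ((Fin n → ℤ) ⧸ N) := Nat.finite_of_card_ne_zero (by
      rw [← hdet]
      exact Int.natAbs_ne_zero.2 hne)
    let φ : (Fin n → ℤ) →+ G := ⟨⟨comb g, by simp [comb]⟩, comb_add g⟩
    have hN : N ≤ LinearMap.ker φ.toIntLinearMap := by
      rw [Submodule.span_le]
      rintro _ ⟨i, rfl⟩
      exact (h _).2 (AddSubgroup.subset_closure (hw i))
    refine Nat.card_le_card_of_surjective (N.liftQ φ.toIntLinearMap hN) fun x => ?_
    obtain ⟨v, rfl⟩ := hsurj x
    exact ⟨Submodule.Quotient.mk v, rfl⟩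
  rw [← hdet] at hcard
  refine (hcard.trans (natAbs_det_le _)).trans ?_
  calc ∏ i, ∑ j, (Matrix.of w i j).natAbs ≤ ∏ i, 2 ^ esize (List.ofFn (w i)) :=
        Finset.prod_le_prod' fun i _ => (sum_natAbs_lt (w i)).le
    _ = 2 ^ ∑ i, esize (List.ofFn (w i)) := Finset.prod_pow_eq_pow_sum _ _ _
    _ ≤ 2 ^ esize (rel.map fun w => List.ofFn w) := by
        refine Nat.pow_le_pow_right (by norm_num) (le_trans ?_ (sum_esize_le _))
        rw [← Finset.sum_image (s := Finset.univ) (g := w) (f := fun v => esize (List.ofFn v))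
          hinj.injOn, List.map_map, Finset.sum_list_map_count]
        have hsub : Finset.univ.image w ⊆ rel.toFinset := fun v hv => by
          obtain ⟨i, -, rfl⟩ := Finset.mem_image.1 hv
          exact List.mem_toFinset.2 (hw i)
        refine (Finset.sum_le_sum_of_subset hsub).trans (Finset.sum_le_sum fun v hv => ?_)
        have := List.count_pos_iff.2 (List.mem_toFinset.1 hv)
        exact Nat.le_mul_of_pos_left _ this

section Rounds

variable {R : Type u} {M : Type v} [CommRing R] [AddCommGroup M] [Module R M]

theorem card_init : Nat.card (State.init : State R M).A = Nat.card R :=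
  Nat.card_congr (RingEquiv.quotientBot R).toEquiv

variable [Finite R]

theorem Step.two_mul_card_le {s s' : State R M} (h : Step s s') :
    2 * Nat.card s'.A ≤ Nat.card s.A := two_mul_card_quotient_le h.lt

theorem State.card_pos (s : State R M) : 0 < Nat.card s.A := by
  have : Finite s.A := .of_surjective _ Ideal.Quotient.mk_surjective
  exact Nat.card_pos

theorem two_pow_length_le {s : State R M} {τ : List (State R M)} (h : (s :: τ).IsChain Step) :
    2 ^ τ.length ≤ Nat.card s.A := by
  induction τ generalizing s with
  | nil => exact s.card_pos
  | cons t τ ih =>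
    rw [List.isChain_cons_cons] at h
    have h1 := ih h.2
    have h2 := h.1.two_mul_card_le
    rw [List.length_cons, pow_succ']
    omega

theorem IsPartialRun.two_pow_le {τ : List (State R M)} (h : IsPartialRun τ) :
    2 ^ (τ.length - 1) ≤ Nat.card R := by
  obtain ⟨h1, h2⟩ := h
  cases τ with
  | nil => simp at h1
  | cons s τ =>
    obtain rfl : s = State.init := by simpa using h1
    rw [← card_init (M := M)]
    exact two_pow_length_le h2

theorem IsPartialRun.length_le {P : Input} {g : Fin P.n → R} {h : Fin P.m → M}
    (hP : P.Presents g h) {τ : List (State R M)} (hτ : IsPartialRun τ) :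
    τ.length ≤ 2 * P.length := by
  have h1 := hτ.two_pow_le.trans (card_le_two_pow hP.genR hP.relR)
  have h2 := (Nat.pow_le_pow_iff_right (by norm_num)).1 h1
  have h3 : esize (P.relR.map fun w => List.ofFn w) + 1 ≤ P.length := by
    rw [Input.length, Input.encode_eq]
    change _ ≤ esize P.raw
    simp only [Input.raw, esize_pair]
    omega
  omega

end Rounds

end CyclicModule

namespace CyclicModule

/-! ### Correctness of the program -/

section Rows

variable {d : ℤ} {K : ℕ} {G : Type*} [AddCommGroup G] {φ : (ℕ → ℤ) →+ G} {rel : List (List ℤ)}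

/-- The subgroup generated by the elements with given coefficients. -/
def rowClosure (φ : (ℕ → ℤ) →+ G) (S : List (List ℤ)) : AddSubgroup G :=
  AddSubgroup.closure ((fun v => φ (seq v)) '' {v | v ∈ S})

theorem rowClosure_le_iff {S : List (List ℤ)} {J : AddSubgroup G} :
    rowClosure φ S ≤ J ↔ ∀ v ∈ S, φ (seq v) ∈ J := by
  rw [rowClosure, AddSubgroup.closure_le, Set.image_subset_iff]
  rfl

theorem mem_rowClosure {S : List (List ℤ)} {v : List ℤ} (h : v ∈ S) :
    φ (seq v) ∈ rowClosure φ S := AddSubgroup.subset_closure ⟨v, h, rfl⟩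

theorem rowClosure_append (S S' : List (List ℤ)) :
    rowClosure φ (S ++ S') = rowClosure φ S ⊔ rowClosure φ S' := by
  refine le_antisymm (rowClosure_le_iff.2 fun v hv => ?_)
    (sup_le (rowClosure_le_iff.2 fun v hv => mem_rowClosure (List.mem_append_left _ hv))
      (rowClosure_le_iff.2 fun v hv => mem_rowClosure (List.mem_append_right _ hv)))
  rcases List.mem_append.1 hv with h | h
  exacts [AddSubgroup.mem_sup_left (mem_rowClosure h), AddSubgroup.mem_sup_right (mem_rowClosure h)]

theorem rep_idMat {zs : List ℤ} (hz : ∀ z ∈ zs, z = 0) (hK : zs.length = K) :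
    Rep d K φ (idMat zs) ⊤ := by
  have hlen : ∀ v ∈ idMat zs, v.length = K := by
    rw [idMat_eq hK]
    intro v hv
    obtain ⟨i, rfl⟩ := (List.mem_ofFn' _ _).1 hv
    simp
  refine ⟨hlen, fun v hv => iff_of_true (AddSubgroup.mem_sup_left ?_) trivial⟩
  obtain ⟨w, rfl⟩ := exists_eq_ofFn hv
  have h1 := lc_ofMat hz hK w 1
  rw [Matrix.vecMul_one] at h1
  have h2 := hom_lc (AddMonoidHom.id _) (zs := zs) (x := List.ofFn w) (V := idMat zs)
    fun v hv => (hlen v hv).trans hK.symm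
  rw [idMat_eq hK, h1, seq_eq_zero hz, map_zero, zero_add, AddMonoidHom.id_apply, ← idMat_eq hK] at h2
  rw [h2]
  refine AddSubgroup.list_sum_mem _ fun f hf => ?_
  obtain ⟨i, hi, rfl⟩ := List.mem_iff_getElem.1 hf
  rw [List.getElem_zipWith]
  exact zsmul_mem (mem_gen (List.getElem_mem _)) _

theorem Rep.all_inLattice_iff (hφ : Pres d K φ rel) {S X : List (List ℤ)} {J J' : AddSubgroup G}
    (hS : Rep d K φ S J) (hX : Rep d K φ X J') (hd : 0 < d) {fuel zs : List ℤ}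
    (hf : d ≤ 2 ^ fuel.length) (hz : ∀ z ∈ zs, z = 0) (hK : zs.length = K) :
    X.all (CyclicModule.inLattice fuel d zs S) = true ↔ J' ≤ J := by
  rw [← hX.closure_eq hφ, ← rowClosure, rowClosure_le_iff, List.all_eq_true]
  exact forall₂_congr fun v hv => hS.inLattice_iff hd hf hz hK (hX.1 v hv)

end Rows

section Programs

variable {R : Type u} {M : Type v} [CommRing R] [AddCommGroup M] [Module R M]

/-- The table `T` describes the scalar multiplication. -/
def IsTable (d : ℤ) (n m : ℕ) (zm : List ℤ) (T : List (List (List ℤ))) (φ : (ℕ → ℤ) →+ R)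
    (ψ : (ℕ → ℤ) →+ M) : Prop :=
  ∀ r x : List ℤ, r.length = n → x.length = m → (act d zm T r x).length = m ∧
    ψ (seq (act d zm T r x)) = φ (seq r) • ψ (seq x)

variable {d : ℤ} {n m : ℕ} {fuel zn zm : List ℤ} {T U : List (List (List ℤ))}
  {relR relM : List (List ℤ)} {φ : (ℕ → ℤ) →+ R} {ψ : (ℕ → ℤ) →+ M}

theorem closure_image2_smul {I : Ideal R} {S : Set R} (hS : AddSubgroup.closure S = I.toAddSubgroup)
    (X : Set M) : AddSubgroup.closure (Set.image2 (fun r x => r • x) S X) =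
      (I • Submodule.span R X).toAddSubgroup := by
  refine le_antisymm ((AddSubgroup.closure_le _).2 ?_) fun z hz => ?_
  · rintro _ ⟨r, hr, x, hx, rfl⟩
    have : r ∈ I.toAddSubgroup := hS ▸ AddSubgroup.subset_closure hr
    exact Submodule.smul_mem_smul this (Submodule.subset_span hx)
  · have key : ∀ x ∈ Submodule.span R X, ∀ r ∈ I,
        r • x ∈ AddSubgroup.closure (Set.image2 (fun r x => r • x) S X) := by
      intro x hx
      induction hx using Submodule.span_induction with
      | mem x hx =>
        intro r hr
        have hr' : r ∈ AddSubgroup.closure S := hS ▸ hr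
        clear hr
        induction hr' using AddSubgroup.closure_induction with
        | mem r hr => exact AddSubgroup.subset_closure ⟨r, hr, x, hx, rfl⟩
        | zero => rw [zero_smul]; exact zero_mem _
        | add a b _ _ ha hb => rw [add_smul]; exact add_mem ha hb
        | neg a _ ha => rw [neg_smul]; exact neg_mem ha
      | zero => intro r _; rw [smul_zero]; exact zero_mem _
      | add a b _ _ ha hb => intro r hr; rw [smul_add]; exact add_mem (ha r hr) (hb r hr)
      | smul a x _ ih => intro r hr; rw [smul_smul]; exact ih _ (I.mul_mem_right _ hr)
    exact Submodule.smul_induction_on (p := fun z => z ∈ AddSubgroup.closure _) hz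
      (fun r hr x hx => key x hx r hr) fun _ _ => add_mem

theorem length_of_mem_products (hT : IsTable d n m zm U φ ψ) {J X : List (List ℤ)}
    (hJ : ∀ v ∈ J, v.length = n) (hX : ∀ v ∈ X, v.length = m) :
    ∀ v ∈ products d zm U J X, v.length = m := by
  intro v hv
  obtain ⟨a, ha, hv⟩ := List.mem_flatMap.1 hv
  obtain ⟨b, hb, rfl⟩ := List.mem_map.1 hv
  exact (hT a b (hJ a ha) (hX b hb)).1

theorem rowClosure_products (hT : IsTable d n m zm U φ ψ) {J X : List (List ℤ)}
    (hJ : ∀ v ∈ J, v.length = n) (hX : ∀ v ∈ X, v.length = m) {I : Ideal R}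
    (hI : rowClosure φ J = I.toAddSubgroup) :
    rowClosure ψ (products d zm U J X) =
      (I • Submodule.span R ((fun v => ψ (seq v)) '' {v | v ∈ X})).toAddSubgroup := by
  rw [← closure_image2_smul hI, rowClosure]
  congr 1
  ext z
  constructor
  · rintro ⟨v, hv, rfl⟩
    obtain ⟨a, ha, hv⟩ := List.mem_flatMap.1 hv
    obtain ⟨b, hb, rfl⟩ := List.mem_map.1 hv
    exact ⟨_, ⟨a, ha, rfl⟩, _, ⟨b, hb, rfl⟩, (hT a b (hJ a ha) (hX b hb)).2.symm⟩
  · rintro ⟨_, ⟨a, ha, rfl⟩, _, ⟨b, hb, rfl⟩, rfl⟩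
    exact ⟨_, List.mem_flatMap.2 ⟨a, ha, List.mem_map.2 ⟨b, hb, rfl⟩⟩,
      (hT a b (hJ a ha) (hX b hb)).2⟩

theorem Rep.span_eq (hψ : Pres d m ψ relM) {X : List (List ℤ)} {N : Submodule R M}
    (h : Rep d m ψ X N.toAddSubgroup) :
    Submodule.span R ((fun v => ψ (seq v)) '' {v | v ∈ X}) = N := by
  have h1 := h.closure_eq hψ
  refine le_antisymm (Submodule.span_le.2 fun z hz => ?_) fun z hz => ?_
  · have : z ∈ N.toAddSubgroup := h1 ▸ AddSubgroup.subset_closure hz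
    exact this
  · have h2 : z ∈ AddSubgroup.closure ((fun v => ψ (seq v)) '' {v | v ∈ X}) := h1 ▸ hz
    have h3 : AddSubgroup.closure ((fun v => ψ (seq v)) '' {v | v ∈ X}) ≤
        (Submodule.span R ((fun v => ψ (seq v)) '' {v | v ∈ X})).toAddSubgroup :=
      (AddSubgroup.closure_le _).2 Submodule.subset_span
    exact h3 h2

theorem rep_colon (hφ : Pres d n φ relR) (hψ : Pres d m ψ relM) (hT : IsTable d n m zm U φ ψ)
    (hd : 0 < d) (hf : d ≤ 2 ^ fuel.length) (hzn : ∀ z ∈ zn, z = 0) (hn : zn.length = n)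
    (hzm : ∀ z ∈ zm, z = 0) (hm : zm.length = m) {S : List (List ℤ)} {J' : AddSubgroup M}
    (hS : Rep d m ψ S J') (L : List (List ℤ)) (hL : ∀ a ∈ L, a.length = m) {B : List (List ℤ)}
    {J : AddSubgroup R} (hB : Rep d n φ B J) {J'' : AddSubgroup R}
    (hJ : ∀ r, r ∈ J'' ↔ r ∈ J ∧ ∀ a ∈ L, r • ψ (seq a) ∈ J') :
    Rep d n φ (colon fuel d zm zn U S B L) J'' := by
  unfold colon
  induction L generalizing B J with
  | nil =>
    obtain rfl : J'' = J := by ext r; simp [hJ r]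
    exact hB
  | cons a L ih =>
    rw [List.foldl_cons]
    have ha := hL a (by simp)
    refine ih (fun b hb => hL b (by simp [hb]))
      (Rep.restrict hφ hψ hB hS hd hf hzm hm hzn hn
        (LinearMap.toSpanSingleton R M (ψ (seq a))).toAddMonoidHom _
        fun b hb => hT b a (hB.1 b hb) ha) fun r => ?_
    rw [hJ r, List.forall_mem_cons, AddSubgroup.mem_inf, AddSubgroup.mem_comap, ← and_assoc]
    rfl

/-- The data of the program describe the ring and the module. -/
structure Setting (d : ℤ) (n m : ℕ) (fuel zn zm : List ℤ) (T U : List (List (List ℤ)))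
    (relR relM : List (List ℤ)) (φ : (ℕ → ℤ) →+ R) (ψ : (ℕ → ℤ) →+ M) : Prop where
  pos : 0 < d
  fuel : d ≤ 2 ^ fuel.length
  zn_zero : ∀ z ∈ zn, z = 0
  zn_length : zn.length = n
  zm_zero : ∀ z ∈ zm, z = 0
  zm_length : zm.length = m
  presR : Pres d n φ relR
  presM : Pres d m ψ relM
  mul : IsTable d n n zn T φ φ
  smul : IsTable d n m zm U φ ψ

/-- The data of the program describe the state. -/
structure Good (d : ℤ) (n m : ℕ) (φ : (ℕ → ℤ) →+ R) (ψ : (ℕ → ℤ) →+ M) (q : RawState)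
    (s : State R M) : Prop where
  I : Rep d n φ q.1 s.I.toAddSubgroup
  length : q.2.1.length = m
  y : ψ (seq q.2.1) = s.y
  N : Rep d m ψ q.2.2 s.N.toAddSubgroup

namespace Setting

theorem rep_products (S : Setting d n m fuel zn zm T U relR relM φ ψ)
    {J X : List (List ℤ)} {I : Ideal R} {N : Submodule R M}
    (hJ : Rep d n φ J I.toAddSubgroup) (hX : Rep d m ψ X N.toAddSubgroup) :
    Rep d m ψ (relM ++ products d zm U J X) (I • N).toAddSubgroup := by
  have h := S.presM.rep_append (length_of_mem_products S.smul hJ.1 hX.1)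
  rwa [← rowClosure, rowClosure_products S.smul hJ.1 hX.1 (hJ.closure_eq S.presR),
    hX.span_eq S.presM] at h

theorem rep_mulTop (S : Setting d n m fuel zn zm T U relR relM φ ψ)
    {J : List (List ℤ)} {I : Ideal R} (hJ : Rep d n φ J I.toAddSubgroup) :
    Rep d m ψ (mulTop d zm U relM J) (I • (⊤ : Submodule R M)).toAddSubgroup :=
  S.rep_products hJ (rep_idMat S.zm_zero S.zm_length)

theorem rep_mulTop_append (S : Setting d n m fuel zn zm T U relR relM φ ψ)
    {J : List (List ℤ)} {I : Ideal R} (hJ : Rep d n φ J I.toAddSubgroup)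
    {x : List ℤ} (hx : x.length = m) :
    Rep d m ψ (mulTop d zm U relM J ++ products d zm U (idMat zn) [x])
      (Submodule.span R {ψ (seq x)} ⊔ I • (⊤ : Submodule R M)).toAddSubgroup := by
  have hidn : Rep d n φ (idMat zn) (⊤ : Ideal R).toAddSubgroup :=
    rep_idMat S.zn_zero S.zn_length
  have hidm : Rep d m ψ (idMat zm) (⊤ : Submodule R M).toAddSubgroup :=
    rep_idMat S.zm_zero S.zm_length
  have hx' : ∀ v ∈ [x], v.length = m := by simpa using hx
  have h := S.presM.rep_append (S := products d zm U J (idMat zm) ++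
    products d zm U (idMat zn) [x]) (by
      intro v hv
      rcases List.mem_append.1 hv with hv | hv
      exacts [length_of_mem_products S.smul hJ.1 hidm.1 v hv,
        length_of_mem_products S.smul hidn.1 hx' v hv])
  rw [← rowClosure, rowClosure_append, rowClosure_products S.smul hJ.1 hidm.1 (hJ.closure_eq S.presR),
    rowClosure_products S.smul hidn.1 hx' (hidn.closure_eq S.presR), hidm.span_eq S.presM,
    Submodule.top_smul, ← Submodule.sup_toAddSubgroup, sup_comm] at h
  rw [mulTop, List.append_assoc]
  have hset : (fun v => ψ (seq v)) '' {v | v ∈ [x]} = {ψ (seq x)} := by simp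
  rwa [hset] at h

theorem good_start (S : Setting d n m fuel zn zm T U relR relM φ ψ)
    : Good d n m φ ψ (echelon fuel d zn relR, zm, idMat zm) State.init where
  I := by
    have h := S.presR.rep_append (S := []) (by simp)
    rw [List.append_nil] at h
    simp only [List.not_mem_nil, Set.ofPred_false, Set.image_empty, AddSubgroup.closure_empty] at h
    exact h.echelon S.pos S.fuel S.zn_zero S.zn_length
  length := S.zm_length
  y := by rw [seq_eq_zero S.zm_zero, map_zero]; rfl
  N := rep_idMat S.zm_zero S.zm_length

variable {q : RawState} {s : State R M}

theorem pick_pickRow (S : Setting d n m fuel zn zm T U relR relM φ ψ)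
    [Finite M] (hq : Good d n m φ ψ q s) (hs : s.Inv)
    (h : ¬ ∀ z : s.MA, z = 0) :
    (pickRow fuel d zm (mulTop d zm U relM q.1) q.2.2).length = m ∧
      s.Pick (ψ (seq (pickRow fuel d zm (mulTop d zm U relM q.1) q.2.2))) := by
  have hQ := S.rep_mulTop hq.I
  have hmem : ∀ w ∈ q.2.2, (inLattice fuel d zm (mulTop d zm U relM q.1) w = true ↔
      ψ (seq w) ∈ s.I • (⊤ : Submodule R M)) := fun w hw =>
    hQ.inLattice_iff S.pos S.fuel S.zm_zero S.zm_length (hq.N.1 w hw)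
  obtain ⟨x, hx⟩ := hs.exists_pick.resolve_left h
  rw [s.pick_iff] at hx
  have hne : q.2.2.filter (fun w => !inLattice fuel d zm (mulTop d zm U relM q.1) w) ≠ [] := by
    intro h0
    rw [List.filter_eq_nil_iff] at h0
    have h1 : rowClosure ψ q.2.2 ≤ (s.I • (⊤ : Submodule R M)).toAddSubgroup :=
      rowClosure_le_iff.2 fun w hw => (hmem w hw).1 (by simpa using h0 w hw)
    rw [rowClosure, hq.N.closure_eq S.presM] at h1
    exact hx.2 (h1 hx.1)
  have hp : pickRow fuel d zm (mulTop d zm U relM q.1) q.2.2 ∈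
      q.2.2.filter fun w => !inLattice fuel d zm (mulTop d zm U relM q.1) w := by
    rw [pickRow]
    cases h : q.2.2.filter (fun w => !inLattice fuel d zm (mulTop d zm U relM q.1) w) with
    | nil => exact absurd h hne
    | cons a l => simp
  rw [List.mem_filter, Bool.not_eq_true', ← Bool.not_eq_true] at hp
  have hlen := hq.N.1 _ hp.1
  refine ⟨hlen, s.pick_iff.2 ⟨(hq.N.2 _ hlen).1 (mem_lat hp.1), fun h => hp.2 ?_⟩⟩
  exact (hmem _ hp.1).2 h

theorem rep_a (S : Setting d n m fuel zn zm T U relR relM φ ψ)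
    (hq : Good d n m φ ψ q s) {x : List ℤ} (hx : x.length = m) :
    Rep d n φ (colon fuel d zm zn U (mulTop d zm U relM q.1) (idMat zn) [x])
      (s.pre (s.a (ψ (seq x)))).toAddSubgroup :=
  rep_colon S.presR S.presM S.smul S.pos S.fuel S.zn_zero S.zn_length S.zm_zero S.zm_length
    (S.rep_mulTop hq.I) [x] (by simpa using hx) (rep_idMat S.zn_zero S.zn_length) fun r => by
      simpa using s.mem_pre_a

theorem rep_colon_a (S : Setting d n m fuel zn zm T U relR relM φ ψ)
    (hq : Good d n m φ ψ q s) {x : M} {a B : List (List ℤ)} {J : Ideal R}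
    (ha : Rep d n φ a (s.pre (s.a x)).toAddSubgroup) (hB : Rep d n φ B J.toAddSubgroup) :
    Rep d n φ (colon fuel d zn zn T q.1 B a) (J ⊓ s.pre (s.b x)).toAddSubgroup := by
  refine rep_colon S.presR S.presR S.mul S.pos S.fuel S.zn_zero S.zn_length S.zn_zero S.zn_length
    hq.I a ha.1 hB fun r => ?_
  have h1 : r ∈ s.pre (s.b x) ↔ ∀ v ∈ a, r • φ (seq v) ∈ s.I.toAddSubgroup := by
    rw [s.mem_pre_b]
    have h2 := rowClosure_le_iff (φ := φ) (S := a)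
      (J := s.I.toAddSubgroup.comap (AddMonoidHom.mulLeft r))
    rw [rowClosure, ha.closure_eq S.presR] at h2
    exact h2
  rw [← h1]
  rfl

theorem round_spec (S : Setting d n m fuel zn zm T U relR relM φ ψ)
    [Finite M] (hq : Good d n m φ ψ q s) (hs : s.Inv) :
    ((round fuel d zn zm T U relM q).1.1 = true ∧
      Stops s ((round fuel d zn zm T U relM q).1.2.map fun w => ψ (seq w)) ∧
      ∀ w ∈ (round fuel d zn zm T U relM q).1.2, w.length = m) ∨
    ((round fuel d zn zm T U relM q).1.1 = false ∧
      ∃ s', Step s s' ∧ Good d n m φ ψ (round fuel d zn zm T U relM q).2 s') := by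
  have hidn : Rep d n φ (idMat zn) (⊤ : Ideal R).toAddSubgroup :=
    rep_idMat S.zn_zero S.zn_length
  have hidm : Rep d m ψ (idMat zm) (⊤ : Submodule R M).toAddSubgroup :=
    rep_idMat S.zm_zero S.zm_length
  have hzero := (S.rep_mulTop hq.I).all_inLattice_iff S.presM hidm S.pos S.fuel S.zm_zero S.zm_length
  have hzero' : ((⊤ : Submodule R M).toAddSubgroup ≤ (s.I • (⊤ : Submodule R M)).toAddSubgroup) ↔
      ∀ z : s.MA, z = 0 := by
    rw [forall_tmul_eq_zero_iff, ← top_le_iff]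
    rfl
  rw [hzero'] at hzero
  unfold CyclicModule.round
  split_ifs with h0
  · refine .inl ⟨rfl, ?_, ?_⟩
    · change Stops s (some (ψ (seq q.2.1)))
      rw [hq.y]
      exact .yes s (hzero.1 h0)
    · rintro w ⟨⟩
      exact hq.length
  · rw [hzero] at h0
    obtain ⟨hx, hpick⟩ := S.pick_pickRow hq hs h0
    generalize pickRow fuel d zm (mulTop d zm U relM q.1) q.2.2 = x at hx hpick ⊢
    have ha := S.rep_a hq hx
    generalize colon fuel d zm zn U (mulTop d zm U relM q.1) (idMat zn) [x] = a at ha ⊢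
    have hab := S.rep_colon_a hq ha ha
    have hb := S.rep_colon_a hq ha hidn
    rw [top_inf_eq] at hb
    have htest := hq.I.all_inLattice_iff S.presR hab S.pos S.fuel S.zn_zero S.zn_length
    have htest' : ((s.pre (s.a (ψ (seq x))) ⊓ s.pre (s.b (ψ (seq x)))).toAddSubgroup ≤
        s.I.toAddSubgroup) ↔ s.a (ψ (seq x)) ⊓ s.b (ψ (seq x)) = ⊥ := by
      rw [← s.pre_le_iff, s.pre_inf]
      rfl
    rw [htest'] at htest
    have hfull := (S.rep_mulTop_append ha hx).all_inLattice_iff S.presM hidm S.pos S.fuel S.zm_zero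
      S.zm_length
    have hfull' : ((⊤ : Submodule R M).toAddSubgroup ≤ (Submodule.span R {ψ (seq x)} ⊔
        s.pre (s.a (ψ (seq x))) • (⊤ : Submodule R M)).toAddSubgroup) ↔ s.Full (ψ (seq x)) := by
      rw [s.full_iff, ← top_le_iff]
      rfl
    rw [hfull'] at hfull
    unfold finishRound
    split_ifs with h1 h2
    · refine .inr ⟨rfl, _, .split s _ hpick (htest.1 h1) (hfull.1 h2), hb, ?_, ?_, ?_⟩
      · exact (length_axpy (hx.trans hq.length.symm)).trans hq.length
      · have h3 := S.presM.dmul _ (axpy_sub_mem S.pos 1 (hx.trans hq.length.symm))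
        rw [map_sub, sub_eq_zero, map_add, one_smul] at h3
        rw [h3, hq.y]
      · exact (S.rep_products ha hq.N).echelon S.pos S.fuel S.zm_zero S.zm_length
    · refine .inl ⟨rfl, .no s _ hpick (htest.1 h1) fun h => h2 (hfull.2 h), ?_⟩
      rintro w ⟨⟩
    · exact .inr ⟨rfl, _, .shrink s _ hpick fun h => h1 (htest.2 h), hab, hq.length, hq.y, hq.N⟩

end Setting

end Programs

end CyclicModule

namespace CyclicModule

open Enc

section Rounds

variable {R : Type u} {M : Type v} [CommRing R] [AddCommGroup M] [Module R M]
  {d : ℤ} {n m : ℕ} {fuel zn zm : List ℤ} {T U : List (List (List ℤ))}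
  {relR relM : List (List ℤ)} {φ : (ℕ → ℤ) →+ R} {ψ : (ℕ → ℤ) →+ M}

theorem IsPartialRun.init : IsPartialRun [(State.init : State R M)] := ⟨rfl, .singleton _⟩

theorem IsPartialRun.append {s s' : State R M} {σ : List (State R M)}
    (h : IsPartialRun (s :: σ).reverse) (hs : Step s s') :
    IsPartialRun (s' :: s :: σ).reverse := by
  rw [List.reverse_cons]
  refine ⟨?_, List.isChain_append.2 ⟨h.2, .singleton _, ?_⟩⟩
  · rw [List.head?_append, h.1]
    rfl
  · intro a ha b hb
    rw [List.getLast?_reverse] at ha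
    cases ha
    cases hb
    exact hs

/-- The states that the program has collected belong to a run of the algorithm, after `k` rounds. -/
def RoundsInv (d : ℤ) (n m : ℕ) (φ : (ℕ → ℤ) →+ R) (ψ : (ℕ → ℤ) →+ M) (k : ℕ)
    (acc : Bool × Option (List ℤ) × List RawState) : Prop :=
  ∃ (s : State R M) (σ : List (State R M)), List.Forall₂ (Good d n m φ ψ) acc.2.2 (s :: σ) ∧
    IsPartialRun (s :: σ).reverse ∧
    (acc.1 = false → σ.length = k) ∧
    (acc.1 = true → Stops s (acc.2.1.map fun w => ψ (seq w)) ∧ ∀ w ∈ acc.2.1, w.length = m)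

theorem Setting.rounds_spec [Finite R] [Finite M] (S : Setting d n m fuel zn zm T U relR relM φ ψ)
    {q : RawState} (hq : Good d n m φ ψ q State.init) (clock : List ℤ) :
    RoundsInv d n m φ ψ clock.length (rounds fuel d zn zm T U relM clock q) := by
  unfold rounds
  induction clock using List.reverseRecOn with
  | nil => exact ⟨State.init, [], .cons hq .nil, .init, fun _ => rfl, by simp⟩
  | append_singleton clock z ih =>
    rw [List.foldl_append, List.foldl_cons, List.foldl_nil, List.length_append]
    revert ih
    generalize List.foldl _ _ clock = acc
    rintro ⟨s, σ, h1, h2, h3, h4⟩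
    obtain ⟨b, o, l⟩ := acc
    cases h1 with
    | cons hq' hl =>
      rename_i q' l
      cases b with
      | true => exact ⟨s, σ, .cons hq' hl, h2, by simp, fun _ => h4 rfl⟩
      | false =>
        have hs : s.Inv := h2.inv s (by simp)
        change RoundsInv d n m φ ψ (clock.length + 1)
          (if (CyclicModule.round fuel d zn zm T U relM q').1.1 then
            (true, (CyclicModule.round fuel d zn zm T U relM q').1.2, q' :: l)
          else (false, none, (CyclicModule.round fuel d zn zm T U relM q').2 :: q' :: l))
        rcases S.round_spec hq' hs with ⟨h5, h6⟩ | ⟨h5, s', h6, h7⟩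
        · rw [if_pos h5]
          exact ⟨s, σ, .cons hq' hl, h2, by simp, fun _ => h6⟩
        · rw [h5, if_neg Bool.false_ne_true]
          refine ⟨s', s :: σ, .cons h7 (.cons hq' hl), h2.append h6, fun _ => ?_, by simp⟩
          rw [List.length_cons, h3 rfl]

end Rounds

theorem exists_eq_map_ofFn {n : ℕ} {L : List (List ℤ)} (hL : ∀ v ∈ L, v.length = n) :
    ∃ l : List (Fin n → ℤ), L = l.map fun w => List.ofFn w := by
  induction L with
  | nil => exact ⟨[], rfl⟩
  | cons v L ih =>
    obtain ⟨l, rfl⟩ := ih fun v hv => hL v (by simp [hv])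
    obtain ⟨w, rfl⟩ := exists_eq_ofFn (hL v (by simp))
    exact ⟨w :: l, rfl⟩

theorem Good.exists_stateCode {R : Type u} {M : Type v} [CommRing R] [AddCommGroup M] [Module R M]
    {d : ℤ} {n m : ℕ} {g : Fin n → R} {h : Fin m → M}
    {relR relM : List (List ℤ)} (hR : Pres d n (coef g) relR) (hM : Pres d m (coef h) relM)
    {q : RawState} {s : State R M} (hq : Good d n m (coef g) (coef h) q s) :
    ∃ c : StateCode n m, c.encode = enc q ∧ c.Describes g h s := by
  obtain ⟨I, y, N⟩ := q
  have hI := hq.I.closure_eq hR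
  have hN := hq.N.closure_eq hM
  have hy := hq.y
  obtain ⟨I', rfl⟩ := exists_eq_map_ofFn hq.I.1
  obtain ⟨N', rfl⟩ := exists_eq_map_ofFn hq.N.1
  obtain ⟨y', rfl⟩ := exists_eq_ofFn hq.length
  refine ⟨⟨I', y', N'⟩, ?_, ?_, ?_, ?_⟩
  · rw [StateCode.encode, ofVecs_eq, ofVecs_eq, ofVec_eq]
    rfl
  · rw [← hI]
    simp [Set.image, coef_seq_ofFn]
  · rw [← hy, coef_seq_ofFn]
  · rw [← hN]
    simp [Set.image, coef_seq_ofFn]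

section Inputs

variable {P : Input} {R : Type u} {M : Type v} [CommRing R] [AddCommGroup M] [Module R M]
  {g : Fin P.n → R} {h : Fin P.m → M}

theorem length_zerosR (P : Input) : (zerosR P.raw).length = P.n := by
  simp [zerosR, Input.raw, ofTab]

theorem zerosR_eq_zero (P : Input) : ∀ z ∈ zerosR P.raw, z = 0 := by
  simp [zerosR]

theorem zerosM_eq_zero (P : Input) : ∀ z ∈ zerosM P.raw, z = 0 := by
  simp [zerosM]

theorem modulus_eq (P : Input) : modulus P.raw = relDet P.relR := by
  rw [modulus, relDet, ← gramDet_eq (zerosR_eq_zero P) (length_zerosR P), ofMat_relMatrix]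
  rfl

theorem Input.Presents.length_zerosM [Finite M] (hP : P.Presents g h) : (zerosM P.raw).length = P.m := by
  rw [zerosM, List.length_map]
  change ((P.relM.map fun w => List.ofFn w).headD []).length = P.m
  cases hrel : P.relM with
  | cons w l => simp
  | nil =>
    by_contra hm
    have hm : 0 < P.m := Nat.pos_of_ne_zero fun h0 => hm (by simp [h0])
    have h1 := (hP.relM (Pi.single ⟨0, hm⟩ (Nat.card M : ℤ))).1
      (by rw [comb_single, natCast_zsmul, card_nsmul_eq_zero'])
    rw [hrel] at h1
    have h2 := congrFun (show Pi.single ⟨0, hm⟩ (Nat.card M : ℤ) = (0 : Fin P.m → ℤ) by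
      simpa using h1) ⟨0, hm⟩
    simp only [Pi.single_eq_same, Pi.zero_apply] at h2
    exact Nat.card_pos.ne' (Nat.cast_eq_zero.1 h2)

theorem Input.Presents.modulus_smul (hP : P.Presents g h) (r : R) : modulus P.raw • r = 0 := by
  obtain ⟨w, rfl⟩ := hP.genR r
  rw [comb, Finset.smul_sum]
  refine Finset.sum_eq_zero fun i _ => ?_
  rw [smul_comm, modulus_eq, relDet_smul fun w hw => (hP.relR w).2 (AddSubgroup.subset_closure hw),
    smul_zero]

theorem Input.Presents.modulus_pos [Finite R] (hP : P.Presents g h) : 0 < modulus P.raw := by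
  rw [modulus_eq]
  exact relDet_pos hP.relR

theorem isTable_ofTab {d : ℤ} (hd : 0 < d) {n m : ℕ} {g : Fin n → R} {h : Fin m → M}
    {U : Fin n → Fin m → Fin m → ℤ} (hU : ∀ i j, g i • h j = comb h (U i j))
    (hM : ∀ f ∈ dmul d, coef h f = 0) {zs : List ℤ} (hz : ∀ z ∈ zs, z = 0) (hm : zs.length = m) :
    IsTable d n m zs (ofTab U) (coef g) (coef h) := fun _ _ hr hx =>
  ⟨length_act hm, coef_act hd hU hM hz hm hr hx⟩

theorem Input.Presents.setting [Finite R] [Finite M] (hP : P.Presents g h) :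
    Setting (modulus P.raw) P.n P.m (bits (modulus P.raw)) (zerosR P.raw) (zerosM P.raw)
      (ofTab P.mul) (ofTab P.smul) (P.relR.map fun w => List.ofFn w)
      (P.relM.map fun w => List.ofFn w) (coef g) (coef h) := by
  have hR := pres_coef hP.genR hP.relR hP.modulus_smul
  have hM := pres_coef hP.genM hP.relM (d := modulus P.raw) fun x => by
    rw [← one_smul R x, ← smul_assoc, hP.modulus_smul, zero_smul]
  refine ⟨hP.modulus_pos, ?_, zerosR_eq_zero P, length_zerosR P, zerosM_eq_zero P,
    hP.length_zerosM, hR, hM, ?_, ?_⟩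
  · rw [length_bits]
    have h1 := Nat.lt_size_self (modulus P.raw).toNat
    have h2 := Int.toNat_of_nonneg hP.modulus_pos.le
    rw [← h2]
    exact_mod_cast h1.le
  · exact isTable_ofTab hP.modulus_pos hP.mul hR.dmul (zerosR_eq_zero P) (length_zerosR P)
  · exact isTable_ofTab hP.modulus_pos hP.smul hM.dmul (zerosM_eq_zero P) hP.length_zerosM

theorem Input.Presents.card_lt [Finite R] (hP : P.Presents g h) :
    Nat.card R < 2 ^ (0 :: (zerosR P.raw).flatMap fun _ => bits (modulus P.raw)).length := by
  have hd := hP.modulus_pos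
  obtain ⟨k, hk⟩ := Int.eq_ofNat_of_zero_le hd.le
  have hk0 : 0 < k := by omega
  have h1 : Nat.card R ≤ Nat.card (Fin P.n → Fin k) := by
    refine Nat.card_le_card_of_surjective (fun f => comb g fun i => (f i : ℤ)) fun r => ?_
    obtain ⟨w, rfl⟩ := hP.genR r
    have hw : ∀ i, 0 ≤ w i % (k : ℤ) ∧ w i % (k : ℤ) < k := fun i =>
      ⟨Int.emod_nonneg _ (by omega), Int.emod_lt_of_pos _ (by omega)⟩
    refine ⟨fun i => ⟨(w i % (k : ℤ)).toNat, by have := hw i; omega⟩, ?_⟩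
    refine Finset.sum_congr rfl fun i _ => ?_
    have h2 : w i = w i % (k : ℤ) + (k : ℤ) * (w i / k) := (Int.emod_add_mul_ediv _ _).symm
    have h3 : (k : ℤ) • g i = 0 := hk ▸ hP.modulus_smul (g i)
    simp only [Int.toNat_of_nonneg (hw i).1]
    conv_rhs => rw [h2, add_smul, mul_comm, mul_smul, h3, smul_zero, add_zero]
  have h2 : (0 :: (zerosR P.raw).flatMap fun _ => bits (modulus P.raw)).length =
      k.size * P.n + 1 := by
    rw [List.length_cons, List.length_flatMap, hk]
    simp [length_bits, length_zerosR, mul_comm]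
  rw [h2]
  refine h1.trans_lt ?_
  rw [Nat.card_eq_fintype_card, Fintype.card_fun, Fintype.card_fin, Fintype.card_fin, pow_succ,
    pow_mul]
  have h3 := Nat.pow_le_pow_left (Nat.lt_size_self k).le P.n
  have h4 : 0 < (2 ^ k.size) ^ P.n := by positivity
  omega

end Inputs

end CyclicModule

namespace CyclicModule

open Enc

theorem Output.exists_encode_eq {R : Type u} {M : Type v} [CommRing R] [AddCommGroup M] [Module R M]
    {d : ℤ} {n m : ℕ} {g : Fin n → R} {h : Fin m → M} {relR relM : List (List ℤ)}
    (hR : Pres d n (coef g) relR) (hM : Pres d m (coef h) relM) {a : Option (List ℤ)}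
    (ha : ∀ w ∈ a, w.length = m) {l : List RawState} {τ : List (State R M)}
    (hl : List.Forall₂ (Good d n m (coef g) (coef h)) l τ) :
    ∃ o : Output n m, o.encode = enc (a, l) ∧
      o.answer.map (comb h) = a.map (fun w => coef h (seq w)) ∧
      List.Forall₂ (fun q s => q.Describes g h s) o.states τ := by
  obtain ⟨a', rfl⟩ : ∃ a' : Option (Fin m → ℤ), a = a'.map fun w => List.ofFn w := by
    cases a with
    | none => exact ⟨none, rfl⟩
    | some w =>
      obtain ⟨w, rfl⟩ := exists_eq_ofFn (ha w rfl)
      exact ⟨some w, rfl⟩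
  obtain ⟨l', h1, h2⟩ : ∃ l' : List (StateCode n m), l'.map StateCode.encode = l.map enc ∧
      List.Forall₂ (fun q s => q.Describes g h s) l' τ := by
    clear ha
    induction hl with
    | nil => exact ⟨[], rfl, .nil⟩
    | cons hq _ ih =>
      obtain ⟨l', h1, h2⟩ := ih
      obtain ⟨c, h3, h4⟩ := hq.exists_stateCode hR hM
      exact ⟨c :: l', by rw [List.map_cons, List.map_cons, h1, h3], .cons h4 h2⟩
  refine ⟨⟨a', l'⟩, ?_, ?_, h2⟩
  · rw [Output.encode, h1]
    cases a' with
    | none => rfl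
    | some w => simp only [ofVec_eq]; rfl
  · cases a' with
    | none => rfl
    | some w => exact congrArg some (coef_seq_ofFn h w).symm

theorem Input.Presents.exists_output {P : Input} {R : Type u} {M : Type v} [CommRing R]
    [AddCommGroup M] [Module R M] [Finite R] [Finite M] {g : Fin P.n → R} {h : Fin P.m → M}
    (hP : P.Presents g h) : ∃ o : Output P.n P.m, o.encode = enc (compute P.raw) ∧
      ∃ τ : List (State R M), IsRun τ (o.answer.map (comb h)) ∧
        List.Forall₂ (fun q s => q.Describes g h s) o.states τ := by
  have S := hP.setting
  obtain ⟨s, σ, h1, h2, h3, h4⟩ := S.rounds_spec S.good_start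
    (0 :: (zerosR P.raw).flatMap fun _ => bits (modulus P.raw))
  change List.Forall₂ _ (allRounds P.raw).2.2 _ at h1
  change (allRounds P.raw).1 = false → _ at h3
  change (allRounds P.raw).1 = true → Stops s ((allRounds P.raw).2.1.map _) ∧
    ∀ w ∈ (allRounds P.raw).2.1, _ at h4
  cases hb : (allRounds P.raw).1 with
  | false =>
    have h5 := h2.two_pow_le.trans_lt hP.card_lt
    rw [List.length_reverse, List.length_cons, Nat.add_sub_cancel, h3 hb] at h5
    exact absurd h5 (lt_irrefl _)
  | true =>
    obtain ⟨h5, h6⟩ := h4 hb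
    obtain ⟨o, h7, h8, h9⟩ := Output.exists_encode_eq S.presR S.presM h6 (List.rel_reverse h1)
    refine ⟨o, h7, (s :: σ).reverse, ⟨h2, s, ?_, h8 ▸ h5⟩, h9⟩
    rw [List.getLast?_reverse]
    rfl

theorem IsRun.span_eq_top {R : Type u} {M : Type v} [CommRing R] [AddCommGroup M] [Module R M]
    [Finite R] [Finite M] {τ : List (State R M)} {y : M} (h : IsRun τ (some y)) :
    Submodule.span R {y} = ⊤ := by
  obtain ⟨h1, s, h2, h3⟩ := h
  exact h3.span_eq_top (h1.inv s (List.mem_of_getLast? h2))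

theorem IsRun.not_cyclic {R : Type u} {M : Type v} [CommRing R] [AddCommGroup M] [Module R M]
    [Finite R] [Finite M] {τ : List (State R M)} (h : IsRun τ none) :
    ¬ ∃ y : M, Submodule.span R {y} = ⊤ := by
  obtain ⟨_, _, _, h3⟩ := h
  exact h3.not_cyclic

end CyclicModule

theorem theorem1 :
    -- a deterministic program, running in polynomial time, that carries out the algorithm,
    -- decides whether `M` is cyclic and finds a generator
    (∃ (c : CyclicModule.Prog) (p : Polynomial ℕ),
      ∀ (P : CyclicModule.Input) (R : Type u) (M : Type v) [CommRing R] [AddCommGroup M]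
        [Module R M] [Finite R] [Finite M] (g : Fin P.n → R) (h : Fin P.m → M),
        P.Presents g h →
        ∃ (o : CyclicModule.Output P.n P.m) (t : ℕ),
          CyclicModule.Exec c P.encode o.encode t ∧ t ≤ p.eval P.length ∧
          (∀ w, o.answer = some w → Submodule.span R {CyclicModule.comb h w} = ⊤) ∧
          (o.answer = none → ¬ ∃ y : M, Submodule.span R {y} = ⊤) ∧
          ∃ τ : List (CyclicModule.State R M),
            CyclicModule.IsRun τ (o.answer.map (CyclicModule.comb h)) ∧
            List.Forall₂ (fun q s => q.Describes g h s) o.states τ) ∧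
    -- the algorithm itself, for every choice of the elements that it picks
    (∀ (R : Type u) (M : Type v) [CommRing R] [AddCommGroup M] [Module R M] [Finite R] [Finite M],
      -- it is correct
      (∀ (τ : List (CyclicModule.State R M)) (y : M),
        CyclicModule.IsRun τ (some y) → Submodule.span R {y} = ⊤) ∧
      (∀ τ : List (CyclicModule.State R M),
        CyclicModule.IsRun τ none → ¬ ∃ y : M, Submodule.span R {y} = ⊤) ∧
      -- it never gets stuck
      (∀ τ : List (CyclicModule.State R M), CyclicModule.IsPartialRun τ → ∀ s ∈ τ,
        (∀ z : s.MA, z = 0) ∨ ∃ x, s.Pick x) ∧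
      -- if `𝔞 ∩ 𝔟 = 0`, then an idempotent splits `A` into `A ⧸ 𝔞` and `A ⧸ 𝔟`
      (∀ (s : CyclicModule.State R M) (x : M), s.Pick x → s.a x ⊓ s.b x = ⊥ →
        (∃ e : s.A, IsIdempotentElem e ∧ s.a x = Ideal.span {e} ∧ s.b x = Ideal.span {1 - e}) ∧
        Function.Bijective fun t : s.A =>
          (Ideal.Quotient.mk (s.a x) t, Ideal.Quotient.mk (s.b x) t)) ∧
      -- each round at least halves `A`
      (∀ s s' : CyclicModule.State R M, CyclicModule.Step s s' →
        2 * Nat.card s'.A ≤ Nat.card s.A)) ∧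
    -- the number of rounds is at most linear in the length of the input
    (∃ C : ℕ, ∀ (P : CyclicModule.Input) (R : Type u) (M : Type v) [CommRing R] [AddCommGroup M]
      [Module R M] [Finite R] [Finite M] (g : Fin P.n → R) (h : Fin P.m → M), P.Presents g h →
      ∀ τ : List (CyclicModule.State R M), CyclicModule.IsPartialRun τ →
        τ.length ≤ C * P.length) := by
  refine ⟨?_, fun R M _ _ _ _ _ => ⟨fun τ y h => h.span_eq_top, fun τ h => h.not_cyclic,
    fun τ h s hs => (h.inv s hs).exists_pick, fun s x _ hab => ?_,
    fun s s' h => h.two_mul_card_le⟩, 2, fun P R M _ _ _ _ _ g h hP τ hτ => hτ.length_le hP⟩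
  · obtain ⟨c, p, hc⟩ := CyclicModule.PolyTime.compute
    refine ⟨c, p, fun P R M _ _ _ _ _ g h hP => ?_⟩
    obtain ⟨o, ho, τ, hτ, hdesc⟩ := hP.exists_output
    obtain ⟨t, h1, h2⟩ := hc P.raw
    refine ⟨o, t, ?_, ?_, fun w hw => ?_, fun hw => ?_, τ, hτ, hdesc⟩
    · rwa [P.encode_eq, ho]
    · rwa [CyclicModule.Input.length, P.encode_eq]
    · rw [hw] at hτ
      exact hτ.span_eq_top
    · rw [hw] at hτ
      exact hτ.not_cyclic
  · obtain ⟨e, he, ha, hb⟩ := s.exists_idempotent hab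
    refine ⟨⟨e, he, ha, hb⟩, CyclicModule.bijective_of_idempotent hab (e := e) ?_ ?_⟩
    · rw [ha]
      exact Ideal.mem_span_singleton_self e
    · rw [hb]
      exact Ideal.mem_span_singleton_self _
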